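/- Let $\gamma>2$, let $S=\{x+iy: 0<y<1\}$ and $S_-=\{x+iy:-1<y<0\}$, and write $h_y(x)=h(x+iy)$. Let $\mathbb H^{\infty,2}(S)$ be the space of holomorphic $h:S\to\mathbb C$ with $$\sup_{0<y<1}\ \inf_{\substack{f\in L^\infty(\mathbb R),\ g\in L^2(\mathbb R)\\ f+g=h_y}}\Big(\tfrac1{1-y}\|f\|_{L^\infty}+\tfrac1y\|g\|_{L^2}\Big)<\infty,$$ and let $\mathbb H^{\infty,2}(S_-)$ be the space of holomorphic $h:S_-\to\mathbb C$ such that $z\mapsto\overline{h(\bar z)}$ belongs to $\mathbb H^{\infty,2}(S)$. Every $h\in\mathbb H^{\infty,2}(S_-)$ has boundary values $h_0\in L^\infty(\mathbb R)$ and $h_{-1}\in L^2(\mathbb R)$, in the sense that $\int\overline{h_y}\varphi\,dx\to\int\overline{h_0}\varphi\,dx$ as $y\uparrow0$ and $\int\overline{h_y}\varphi\,dx\to\int\overline{h_{-1}}\varphi\,dx$ as $y\downarrow-1$ for every Schwartz function $\varphi$. The three lines problem is to maximize $$\frac{\|h_{-2/\gamma}\|_{L^\infty(\mathbb R)}}{\|h_0\|_{L^\infty(\mathbb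 R)}^{1-2/\gamma}\,\|h_{-1}\|_{L^2(\mathbb R)}^{2/\gamma}}\qquad\text{over } h\in\mathbb H^{\infty,2}(S_-),\ h\not\equiv0 .$$ Put $g_\gamma(k)=\pi\big(2e^{-(2-2/\gamma)|k|}+e^{-(2/\gamma)|k|}-e^{-(4-2/\gamma)|k|}\big)$. For $|\operatorname{Im}z|<2$ the limit $$\theta_\gamma(z)=\frac1{2\pi}\lim_{\epsilon\downarrow0}\int_{|k|\ge\epsilon}\frac{g_\gamma(k)\,(e^{izk}-izk)}{k(\cosh(2k)-1)}\,dk$$ exists (the integrals being absolutely convergent), and the function $$h(z)=B_\gamma(z)\,e^{\theta_\gamma(z)},\qquad B_\gamma(z)=\frac{z-i(2-\frac2\gamma)}{z+i(2-\frac2\gamma)},$$ restricted to $S_-$, is a maximizer of the three lines problem. It is unique up to symmetries: a function $f$ on $S_-$ is a maximizer if and only if there are $\alpha,\kappa\in\mathbb R$ and $\beta\in\mathbb C\setminus\{0\}$ with $f(z)=\beta\,h(z-\kappa)\,e^{i\alpha z}$ for all $z\in S_-$. -/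

import Mathlib

open MeasureTheory Filter Topology
open scoped ENNReal SchwartzMap ComplexConjugate

noncomputable section

namespace ThreeLines

/-- The open strip `{x + iy : 0 < y < 1}`. -/
def upperStrip : Set ℂ := {z | 0 < z.im ∧ z.im < 1}

/-- The open strip `{x + iy : -1 < y < 0}`. -/
def lowerStrip : Set ℂ := {z | -1 < z.im ∧ z.im < 0}

/-- The restriction `h_y(x) = h(x + iy)` of `h` to the horizontal line at height `y`. -/
def lineAt (h : ℂ → ℂ) (y : ℝ) : ℝ → ℂ := fun x => h ((x : ℂ) + (y : ℂ) * Complex.I)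

/-- The norm of the mixed Hardy-type space on the upper strip: the supremum over `0 < y < 1` of the
infimum, over all decompositions `h_y = f + g` (a.e.) with `f ∈ L^p(ℝ)` and `g ∈ L^q(ℝ)`, of
`‖f‖_p / (1 - y) + ‖g‖_q / y` (equal to `∞` if there is no such decomposition). -/
def hardyNorm (p q : ℝ≥0∞) (h : ℂ → ℂ) : ℝ≥0∞ :=
  ⨆ y ∈ Set.Ioo (0 : ℝ) 1,
    ⨅ (f : ℝ → ℂ) (g : ℝ → ℂ) (_ : MemLp f p volume) (_ : MemLp g q volume)
      (_ : f + g =ᵐ[volume] lineAt h y),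
      ENNReal.ofReal (1 / (1 - y)) * eLpNorm f p volume
        + ENNReal.ofReal (1 / y) * eLpNorm g q volume

/-- Membership in `ℍ^{p,q}` of the upper strip; only the values on the strip matter. -/
def MemHardyUpper (p q : ℝ≥0∞) (h : ℂ → ℂ) : Prop :=
  DifferentiableOn ℂ h upperStrip ∧ hardyNorm p q h < ∞

/-- Membership in `ℍ^{p,q}` of the lower strip, through the reflection `z ↦ conj (h (conj z))`. -/
def MemHardyLower (p q : ℝ≥0∞) (h : ℂ → ℂ) : Prop :=
  DifferentiableOn ℂ h lowerStrip ∧ MemHardyUpper p q (fun z => conj (h (conj z)))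

/-- `⟨h_y, φ⟩ → ⟨u, φ⟩` along `l` for all Schwartz functions `φ`, where
`⟨u, φ⟩ = ∫ conj (u x) φ(x) dx`. -/
def TendsToDistributionally (h : ℂ → ℂ) (l : Filter ℝ) (u : ℝ → ℂ) : Prop :=
  ∀ φ : 𝓢(ℝ, ℂ),
    Tendsto (fun y : ℝ => ∫ x : ℝ, conj (lineAt h y x) * φ x) l
      (𝓝 (∫ x : ℝ, conj (u x) * φ x))

/-- `h₀ ∈ L^∞(ℝ)` and `h₁ ∈ L²(ℝ)` are the boundary values of `h` on the lines `Im z = 0` and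
`Im z = -1`, approached from inside the lower strip. -/
structure HasBoundaryValues (h : ℂ → ℂ) (h₀ h₁ : ℝ → ℂ) : Prop where
  memLp_zero : MemLp h₀ ∞ volume
  memLp_one : MemLp h₁ 2 volume
  tendsto_zero : TendsToDistributionally h (𝓝[<] (0 : ℝ)) h₀
  tendsto_one : TendsToDistributionally h (𝓝[>] (-1 : ℝ)) h₁

/-- The three lines quotient
`‖h_{-2/γ}‖_∞ / (‖h_0‖_∞ ^ (1 - 2/γ) * ‖h_{-1}‖_2 ^ (2/γ))`, where `h₀`, `h₁` are the boundary
values of `h`. -/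
def quotient (γ : ℝ) (h : ℂ → ℂ) (h₀ h₁ : ℝ → ℂ) : ℝ≥0∞ :=
  eLpNorm (lineAt h (-(2 / γ))) ∞ volume /
    (eLpNorm h₀ ∞ volume ^ (1 - 2 / γ) * eLpNorm h₁ 2 volume ^ (2 / γ))

/-- `h` is an admissible competitor: a function of `ℍ^{∞,2}` of the lower strip that is not
identically zero there. -/
def Admissible (h : ℂ → ℂ) : Prop :=
  MemHardyLower ∞ 2 h ∧ ∃ z ∈ lowerStrip, h z ≠ 0

/-- `h` maximizes the three lines quotient over all admissible functions. -/
def IsOptimizer (γ : ℝ) (h : ℂ → ℂ) : Prop :=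
  Admissible h ∧ ∃ h₀ h₁ : ℝ → ℂ, HasBoundaryValues h h₀ h₁ ∧
    ∀ f : ℂ → ℂ, Admissible f → ∀ f₀ f₁ : ℝ → ℂ, HasBoundaryValues f f₀ f₁ →
      quotient γ f f₀ f₁ ≤ quotient γ h h₀ h₁

/-- The symmetries `h ↦ β h(z - κ) e^{iαz}` of the three lines problem. -/
def transform (α κ : ℝ) (β : ℂ) (h : ℂ → ℂ) : ℂ → ℂ :=
  fun z => β * h (z - (κ : ℂ)) * Complex.exp (Complex.I * (α : ℂ) * z)

/-- `g_γ(k) = π (2 e^{-(2 - 2/γ)|k|} + e^{-(2/γ)|k|} - e^{-(4 - 2/γ)|k|})`. -/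
def gFun (γ k : ℝ) : ℝ :=
  Real.pi * (2 * Real.exp (-(2 - 2 / γ) * |k|) + Real.exp (-(2 / γ) * |k|)
    - Real.exp (-(4 - 2 / γ) * |k|))

/-- `g_γ(k) (e^{izk} - izk) / (k (cosh(2k) - 1))`. -/
def thetaIntegrand (γ : ℝ) (z : ℂ) (k : ℝ) : ℂ :=
  (gFun γ k : ℂ) * (Complex.exp (Complex.I * z * (k : ℂ)) - Complex.I * z * (k : ℂ))
    / ((k * (Real.cosh (2 * k) - 1) : ℝ) : ℂ)

/-- `(1/2π)` times the integral of `thetaIntegrand` over `|k| ≥ ε`. -/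
def thetaTrunc (γ : ℝ) (z : ℂ) (ε : ℝ) : ℂ :=
  ((1 / (2 * Real.pi) : ℝ) : ℂ) * ∫ k in {k : ℝ | ε ≤ |k|}, thetaIntegrand γ z k

/-- The phase function `θ_γ(z)`, the limit of `thetaTrunc γ z ε` as `ε ↓ 0`. -/
def theta (γ : ℝ) (z : ℂ) : ℂ := limUnder (𝓝[>] (0 : ℝ)) (thetaTrunc γ z)

/-- The Blaschke factor of the upper half plane with zero at `i(2 - 2/γ)`. -/
def blaschke (γ : ℝ) (z : ℂ) : ℂ :=
  (z - Complex.I * ((2 - 2 / γ : ℝ) : ℂ)) / (z + Complex.I * ((2 - 2 / γ : ℝ) : ℂ))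

/-- `B_γ(z) e^{θ_γ(z)}`. -/
def explicitOptimizer (γ : ℝ) (z : ℂ) : ℂ := blaschke γ z * Complex.exp (theta γ z)

end ThreeLines

end

/-! Write `t = 2/γ` and let `h` be the explicit function. The argument is a Cauchy formula whose
kernel is built from the conjectured extremal. For real `α`, `κ` consider `f(w + κ) e^{iαw} / (h(w)
(cosh πw - cos πt))`. The hyperbolic factor vanishes in the closed lower strip only at `w = -it`, so
comparing a line above this pole with one below it and letting both tend to the boundary
(`representation`) expresses a multiple of `f(κ - it) e^{αt} / h(-it)` by integrals of the boundary
values. The densities that appear are `1/(cosh πs - cos πt)` on the real line and `1/(cosh πs + cos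
πt)` on `Im w = -1`, with total masses `p₀` and `p₁`.

The function `h` is made to fit these densities: it has no zeros, `|h| = 1` on the real line, and
`|h|²` is a multiple of the second density on `Im w = -1`. Estimating the first integral by the sup
norm and the second by Cauchy-Schwarz, then choosing `α` to balance the two terms, gives the
inequality `norm_line_le`, with equality for `h` and its images under the symmetries. The modulus of
`h` on the lower line is found by differentiating `Re θ` in `x`: the weight `g_γ` is such that the
sine transform of `cosh(tk)/sinh k` appears, which the partial fractions of the cotangent evaluate,
plus two exponentials that undo the Blaschke factor.

For uniqueness, an optimizer tends to zero along `Im z = -t`, so its supremum there is attained at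
some `κ`. Equality in Cauchy-Schwarz at this `κ` determines its boundary values on `Im z = -1`
(`boundary_ae_eq`), and these determine the function (`eqOn_of_boundary_ae_eq`): in the formula for
a difference, the real-line integrals are bounded independently of `α` while the left side carries
`e^{αt}` with `α → ∞`.

The boundary values exist because pairings of `f_y` with a Schwartz function are Lipschitz in `y`;
the limiting functional is bounded in `L¹` at the top and in `L²` at the bottom
(`exists_hasBoundaryValues`). -/

noncomputable section

namespace ThreeLines

/-! ### The mixed bound on horizontal lines -/

/-- `u` is the sum of a function bounded by `a` and a function of `L²` norm at most `b`. -/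
def SumBound (a b : ℝ) (u : ℝ → ℂ) : Prop :=
  ∃ f g : ℝ → ℂ, MemLp f ∞ volume ∧ MemLp g 2 volume ∧ f + g =ᵐ[volume] u ∧
    eLpNorm f ∞ volume ≤ ENNReal.ofReal a ∧ eLpNorm g 2 volume ≤ ENNReal.ofReal b

lemma SumBound.mono {a b a' b' : ℝ} {u : ℝ → ℂ} (h : SumBound a b u) (ha : a ≤ a') (hb : b ≤ b') :
    SumBound a' b' u := by
  obtain ⟨f, g, hf, hg, hfg, h1, h2⟩ := h
  exact ⟨f, g, hf, hg, hfg, h1.trans (ENNReal.ofReal_le_ofReal ha),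
    h2.trans (ENNReal.ofReal_le_ofReal hb)⟩

lemma SumBound.conj {a b : ℝ} {u : ℝ → ℂ} (h : SumBound a b u) :
    SumBound a b (fun x => conj (u x)) := by
  obtain ⟨f, g, hf, hg, hfg, h1, h2⟩ := h
  have key : ∀ (p : ℝ≥0∞) (w : ℝ → ℂ), eLpNorm (fun x => conj (w x)) p volume
      = eLpNorm w p volume := fun p w => eLpNorm_congr_norm_ae (by simp)
  refine ⟨fun x => conj (f x), fun x => conj (g x), ?_, ?_, ?_, ?_, ?_⟩
  · exact ⟨Complex.continuous_conj.comp_aestronglyMeasurable hf.1, by rw [key]; exact hf.2⟩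
  · exact ⟨Complex.continuous_conj.comp_aestronglyMeasurable hg.1, by rw [key]; exact hg.2⟩
  · filter_upwards [hfg] with x hx
    simp [← hx]
  · rwa [key]
  · rwa [key]

lemma SumBound.of_memLp_top {u : ℝ → ℂ} (h : MemLp u ∞ volume) :
    SumBound (eLpNorm u ∞ volume).toReal 0 u :=
  ⟨u, 0, h, MemLp.zero, by simp, by rw [ENNReal.ofReal_toReal h.2.ne], by simp⟩

lemma SumBound.of_memLp_two {u : ℝ → ℂ} (h : MemLp u 2 volume) :
    SumBound 0 (eLpNorm u 2 volume).toReal u :=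
  ⟨0, u, MemLp.zero, h, by simp, by simp, by rw [ENNReal.ofReal_toReal h.2.ne]⟩

lemma integrable_mul_of_memLp_two {u v : ℝ → ℂ} (hu : MemLp u 2 volume) (hv : MemLp v 2 volume) :
    Integrable (fun x => u x * v x) volume := by
  exact hu.integrable_mul hv

lemma norm_integral_mul_le_of_memLp_two {u v : ℝ → ℂ} (hu : MemLp u 2 volume)
    (hv : MemLp v 2 volume) :
    ‖∫ x, u x * v x‖ ≤ (eLpNorm u 2 volume).toReal * (eLpNorm v 2 volume).toReal := by
  have h1 : eLpNorm (fun x => u x * v x) 1 volume ≤ eLpNorm u 2 volume * eLpNorm v 2 volume := by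
    have := eLpNorm_smul_le_mul_eLpNorm (p := 2) (q := 2) (r := 1) hv.1 hu.1
    exact this
  rw [← ENNReal.toReal_mul]
  refine le_trans ?_ (ENNReal.toReal_mono (ENNReal.mul_ne_top hu.2.ne hv.2.ne) h1)
  refine (norm_integral_le_integral_norm _).trans (le_of_eq ?_)
  rw [eLpNorm_one_eq_lintegral_enorm]
  exact integral_norm_eq_lintegral_enorm (hu.1.mul hv.1)

lemma ae_norm_le_of_eLpNorm_top {f : ℝ → ℂ} {a : ℝ} (ha : 0 ≤ a)
    (h : eLpNorm f ∞ volume ≤ ENNReal.ofReal a) : ∀ᵐ x, ‖f x‖ ≤ a := by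
  filter_upwards [ae_le_eLpNormEssSup (f := f) (μ := volume)] with x hx
  rw [eLpNorm_exponent_top] at h
  have := hx.trans h
  rwa [← ofReal_norm, ENNReal.ofReal_le_ofReal_iff ha] at this

/-- The `L²` norm as a real number. -/
def normTwo (φ : ℝ → ℂ) : ℝ := (eLpNorm φ 2 volume).toReal

lemma SumBound.integrable_mul {a b : ℝ} {u φ : ℝ → ℂ} (h : SumBound a b u)
    (h1 : Integrable φ volume) (h2 : MemLp φ 2 volume) :
    Integrable (fun x => u x * φ x) volume := by
  obtain ⟨f, g, hf, hg, hfg, -, -⟩ := h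
  have hi : Integrable (fun x => f x * φ x) volume := h1.mul_of_top_right hf
  refine (hi.add (integrable_mul_of_memLp_two hg h2)).congr ?_
  filter_upwards [hfg] with x hx
  simp [← hx, add_mul]

lemma SumBound.norm_integral_le {a b : ℝ} {u φ : ℝ → ℂ} (h : SumBound a b u) (ha : 0 ≤ a)
    (hb : 0 ≤ b) (h1 : Integrable φ volume) (h2 : MemLp φ 2 volume) :
    ‖∫ x, u x * φ x‖ ≤ a * (∫ x, ‖φ x‖) + b * normTwo φ := by
  obtain ⟨f, g, hf, hg, hfg, hfa, hgb⟩ := h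
  have hi : Integrable (fun x => f x * φ x) volume := h1.mul_of_top_right hf
  have e : ∫ x, u x * φ x = (∫ x, f x * φ x) + ∫ x, g x * φ x := by
    rw [← integral_add hi (integrable_mul_of_memLp_two hg h2)]
    refine integral_congr_ae ?_
    filter_upwards [hfg] with x hx
    simp [← hx, add_mul]
  rw [e]
  refine (norm_add_le _ _).trans (add_le_add ?_ ?_)
  · rw [← integral_const_mul]
    refine (norm_integral_le_integral_norm _).trans (integral_mono_ae hi.norm (h1.norm.const_mul a) ?_)
    filter_upwards [ae_norm_le_of_eLpNorm_top ha hfa] with x hx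
    simp only [norm_mul]
    gcongr
  · refine (norm_integral_mul_le_of_memLp_two hg h2).trans ?_
    unfold normTwo
    gcongr
    exact ENNReal.toReal_le_of_le_ofReal hb hgb

lemma lineAt_reflect (h : ℂ → ℂ) (y : ℝ) :
    lineAt (fun z => conj (h (conj z))) y = fun x => conj (lineAt h (-y) x) := by
  funext x
  simp [lineAt]

/-- The quantitative content of membership in `ℍ^{∞,2}` of the lower strip. -/
def HardyBound (C : ℝ) (h : ℂ → ℂ) : Prop :=
  ∀ y : ℝ, -1 < y → y < 0 → SumBound (C * (1 + y)) (C * (-y)) (lineAt h y)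

lemma MemHardyLower.exists_hardyBound {h : ℂ → ℂ} (hh : MemHardyLower ∞ 2 h) :
    ∃ C, 0 ≤ C ∧ HardyBound C h := by
  obtain ⟨-, -, hn⟩ := hh
  set N := hardyNorm ∞ 2 (fun z => conj (h (conj z))) with hN
  refine ⟨(N + 1).toReal, ENNReal.toReal_nonneg, fun y hy1 hy0 => ?_⟩
  have hN1 : N + 1 ≠ ∞ := by simp [hn.ne]
  -- The infimum over decompositions need not be attained; the slack from `N` to `N + 1` supplies an
  -- actual decomposition on each line, with one constant for all lines.
  have hlt : N < N + 1 := ENNReal.lt_add_right hn.ne one_ne_zero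
  have hle : (⨅ (f : ℝ → ℂ) (g : ℝ → ℂ) (_ : MemLp f ∞ volume) (_ : MemLp g 2 volume)
      (_ : f + g =ᵐ[volume] lineAt (fun z => conj (h (conj z))) (-y)),
      ENNReal.ofReal (1 / (1 - -y)) * eLpNorm f ∞ volume
        + ENNReal.ofReal (1 / -y) * eLpNorm g 2 volume) ≤ N := by
    rw [hN]
    unfold hardyNorm
    exact le_iSup₂_of_le (-y) ⟨by linarith, by linarith⟩ le_rfl
  have := hle.trans_lt hlt
  simp only [iInf_lt_iff] at this
  obtain ⟨f, g, hf, hg, hfg, hb⟩ := this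
  have key : ∀ (c : ℝ) (X : ℝ≥0∞), 0 < c → ENNReal.ofReal (1 / c) * X ≤ N + 1 →
      X ≤ ENNReal.ofReal ((N + 1).toReal * c) := by
    intro c X hc hX
    rw [ENNReal.ofReal_mul ENNReal.toReal_nonneg, ENNReal.ofReal_toReal hN1, mul_comm]
    calc X = ENNReal.ofReal c * (ENNReal.ofReal (1 / c) * X) := by
          rw [← mul_assoc, ← ENNReal.ofReal_mul hc.le, mul_one_div_cancel hc.ne']; simp
      _ ≤ _ := by gcongr
  have h1 : eLpNorm f ∞ volume ≤ ENNReal.ofReal ((N + 1).toReal * (1 + y)) := by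
    refine key _ _ (by linarith) (le_trans ?_ hb.le)
    rw [sub_neg_eq_add]; exact le_self_add
  have h2 : eLpNorm g 2 volume ≤ ENNReal.ofReal ((N + 1).toReal * (-y)) := by
    refine key _ _ (by linarith) (le_trans ?_ hb.le)
    exact le_add_self
  have := SumBound.conj ⟨f, g, hf, hg, hfg, h1, h2⟩
  simpa [lineAt_reflect] using this

lemma isOpen_lowerStrip : IsOpen lowerStrip :=
  (isOpen_lt continuous_const Complex.continuous_im).inter
    (isOpen_lt Complex.continuous_im continuous_const)

lemma differentiableOn_reflect {h : ℂ → ℂ} (hh : DifferentiableOn ℂ h lowerStrip) :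
    DifferentiableOn ℂ (fun z => conj (h (conj z))) upperStrip := by
  intro z hz
  have hz' : conj z ∈ lowerStrip := by
    simp only [upperStrip, lowerStrip, Set.mem_ofPred_eq, Complex.conj_im] at hz ⊢
    constructor <;> linarith [hz.1, hz.2]
  have := (hh _ hz').differentiableAt (isOpen_lowerStrip.mem_nhds hz')
  have h2 := this.conj_conj
  simp only [Complex.conj_conj] at h2
  exact h2.differentiableWithinAt

lemma memHardyLower_of_hardyBound {h : ℂ → ℂ} {C : ℝ} (hC : 0 ≤ C)
    (hd : DifferentiableOn ℂ h lowerStrip) (hb : HardyBound C h) : MemHardyLower ∞ 2 h := by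
  refine ⟨hd, differentiableOn_reflect hd, ?_⟩
  -- Each of the two weighted norms contributes `C`, since the weights cancel the factors `1 + y`
  -- and `-y` of the bound.
  refine lt_of_le_of_lt (b := ENNReal.ofReal (2 * C)) ?_ ENNReal.ofReal_lt_top
  unfold hardyNorm
  refine iSup₂_le fun y hy => ?_
  have := (hb (-y) (by linarith [hy.2]) (by linarith [hy.1])).conj
  obtain ⟨f, g, hf, hg, hfg, h1, h2⟩ := this
  refine iInf_le_of_le f (iInf_le_of_le g (iInf_le_of_le hf (iInf_le_of_le hg
    (iInf_le_of_le (by rw [lineAt_reflect]; exact hfg) ?_))))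
  have hy1 : 0 < 1 - y := by linarith [hy.2]
  have hy0 : 0 < y := hy.1
  calc _ ≤ ENNReal.ofReal (1 / (1 - y)) * ENNReal.ofReal (C * (1 + -y))
        + ENNReal.ofReal (1 / y) * ENNReal.ofReal (C * (- -y)) := by gcongr
    _ = ENNReal.ofReal (2 * C) := by
      rw [← ENNReal.ofReal_mul (by positivity), ← ENNReal.ofReal_mul (by positivity),
        ← ENNReal.ofReal_add]
      · congr 1
        rw [← sub_eq_add_neg, neg_neg]
        field_simp
        ring
      · rw [← sub_eq_add_neg]; positivity
      · rw [neg_neg]; positivity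

lemma HardyBound.sumBound {C : ℝ} {h : ℂ → ℂ} (hb : HardyBound C h) (hC : 0 ≤ C) {y : ℝ}
    (h1 : -1 < y) (h0 : y < 0) : SumBound C C (lineAt h y) :=
  (hb y h1 h0).mono (by nlinarith) (by nlinarith)

/-! ### Mean value property and bounds on closed substrips -/

lemma two_pi_mul_enorm_le_lintegral {f : ℂ → ℂ} {c : ℂ} {r : ℝ} (hr : 0 ≤ r)
    (hf : DiffContOnCl ℂ f (Metric.ball c r)) :
    ENNReal.ofReal (2 * Real.pi) * ‖f c‖ₑ
      ≤ ∫⁻ θ in Set.Ioo (-Real.pi) Real.pi, ‖f (circleMap c r θ)‖ₑ := by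
  have h := DiffContOnCl.circleAverage (R := r) (by rwa [abs_of_nonneg hr])
  rw [Real.circleAverage_eq_integral_add (-Real.pi),
    intervalIntegral.integral_comp_add_right (fun θ => f (circleMap c r θ))] at h
  have e1 : (0 : ℝ) + -Real.pi = -Real.pi := by ring
  have e2 : 2 * Real.pi + -Real.pi = Real.pi := by ring
  rw [e1, e2, intervalIntegral.integral_of_le (by linarith [Real.pi_pos]),
    integral_Ioc_eq_integral_Ioo] at h
  rw [← h, enorm_smul, Real.enorm_of_nonneg (by positivity), ← mul_assoc,
    ← ENNReal.ofReal_mul (by positivity), mul_inv_cancel₀ (by positivity), ENNReal.ofReal_one,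
    one_mul]
  exact enorm_integral_le_lintegral_enorm _

/-- Multiply the circle inequality by `r` and integrate over `0 < r < δ` in polar coordinates.
Working with lower integrals avoids any integrability of `f` up to the edge of the ball. -/
lemma area_mul_enorm_le_lintegral_ball {f : ℂ → ℂ} {c : ℂ} {δ : ℝ} (hδ : 0 < δ)
    (hf : DifferentiableOn ℂ f (Metric.ball c δ)) :
    ENNReal.ofReal (Real.pi * δ ^ 2) * ‖f c‖ₑ ≤ ∫⁻ w in Metric.ball c δ, ‖f w‖ₑ := by
  classical
  set G : ℂ → ℝ≥0∞ := (Metric.ball c δ).indicator fun w => ‖f w‖ₑ with hG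
  have hGm : Measurable G := by
    rw [hG, ← Set.piecewise_eq_indicator]
    exact hf.continuousOn.enorm.measurable_piecewise continuousOn_const
      Metric.isOpen_ball.measurableSet
  have hmeas : Measurable fun p : ℝ × ℝ =>
      ENNReal.ofReal p.1 * G (c + Complex.polarCoord.symm p) := by
    simp only [Complex.polarCoord_symm_apply]
    refine (ENNReal.measurable_ofReal.comp measurable_fst).mul (hGm.comp ?_)
    fun_prop
  calc ENNReal.ofReal (Real.pi * δ ^ 2) * ‖f c‖ₑ
      = ∫⁻ r in Set.Ioo 0 δ, ENNReal.ofReal r * (ENNReal.ofReal (2 * Real.pi) * ‖f c‖ₑ) := by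
        rw [lintegral_mul_const _ (by fun_prop), ← mul_assoc]
        congr 1
        rw [← ofReal_integral_eq_lintegral_ofReal, ← integral_Ioc_eq_integral_Ioo,
          ← intervalIntegral.integral_of_le hδ.le, integral_id,
          ← ENNReal.ofReal_mul (by nlinarith [sq_nonneg δ])]
        · congr 1; ring
        · exact (continuous_id.integrableOn_Icc (a := 0) (b := δ)).mono_set Set.Ioo_subset_Icc_self
        · filter_upwards [ae_restrict_mem measurableSet_Ioo] with x hx using hx.1.le
    _ ≤ ∫⁻ r in Set.Ioo 0 δ, ENNReal.ofReal r *
          ∫⁻ θ in Set.Ioo (-Real.pi) Real.pi, G (c + Complex.polarCoord.symm (r, θ)) := by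
        refine setLIntegral_mono_ae' measurableSet_Ioo (Eventually.of_forall fun r hr => ?_)
        gcongr
        have hsub : Metric.closedBall c r ⊆ Metric.ball c δ :=
          Metric.closedBall_subset_ball hr.2
        have hdc : DiffContOnCl ℂ f (Metric.ball c r) :=
          DifferentiableOn.diffContOnCl ((hf.mono hsub).mono Metric.closure_ball_subset_closedBall)
        refine (two_pi_mul_enorm_le_lintegral hr.1.le hdc).trans
          (lintegral_mono fun θ => le_of_eq ?_)
        have e : c + Complex.polarCoord.symm (r, θ) = circleMap c r θ := by
          simp [circleMap, Complex.exp_mul_I]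
        rw [e, hG, Set.indicator_of_mem]
        exact hsub (circleMap_mem_closedBall c hr.1.le θ)
    _ ≤ ∫⁻ r in Set.Ioi 0, ENNReal.ofReal r *
          ∫⁻ θ in Set.Ioo (-Real.pi) Real.pi, G (c + Complex.polarCoord.symm (r, θ)) :=
        lintegral_mono_set Set.Ioo_subset_Ioi_self
    _ = ∫⁻ p in polarCoord.target, ENNReal.ofReal p.1 • G (c + Complex.polarCoord.symm p) := by
        simp only [smul_eq_mul]
        rw [polarCoord_target, Measure.volume_eq_prod, ← Measure.prod_restrict,
          lintegral_prod _ hmeas.aemeasurable]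
        refine lintegral_congr fun r => ?_
        dsimp only
        rw [lintegral_const_mul]
        have : Measurable fun θ : ℝ => c + Complex.polarCoord.symm (r, θ) := by
          simp only [Complex.polarCoord_symm_apply]
          fun_prop
        exact hGm.comp this
    _ = ∫⁻ w, G (c + w) := Complex.lintegral_comp_polarCoord_symm fun w => G (c + w)
    _ = ∫⁻ w, G w := lintegral_add_left_eq_self G c
    _ = ∫⁻ w in Metric.ball c δ, ‖f w‖ₑ := lintegral_indicator Metric.isOpen_ball.measurableSet _

/-- The ball lies in the square of half-side `δ`, and Tonelli slices the square horizontally, which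
is the direction in which the Hardy bound gives control. -/
lemma lintegral_ball_le {F : ℂ → ℝ≥0∞} {c : ℂ} {δ : ℝ} {A : ℝ≥0∞}
    (hA : ∀ y ∈ Set.Ioo (c.im - δ) (c.im + δ),
      ∫⁻ x in Set.Ioo (c.re - δ) (c.re + δ), F ((x : ℂ) + (y : ℂ) * Complex.I) ≤ A)
    (hF : Measurable ((Metric.ball c δ).indicator F)) :
    ∫⁻ w in Metric.ball c δ, F w ≤ ENNReal.ofReal (2 * δ) * A := by
  set s := Set.Ioo (c.re - δ) (c.re + δ)
  set t := Set.Ioo (c.im - δ) (c.im + δ)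
  set G := (Metric.ball c δ).indicator F
  have hmem : ∀ w ∈ Metric.ball c δ, w.re ∈ s ∧ w.im ∈ t := by
    intro w hw
    rw [Metric.mem_ball, dist_eq_norm] at hw
    have h1 := (Complex.abs_re_le_norm (w - c)).trans_lt hw
    have h2 := (Complex.abs_im_le_norm (w - c)).trans_lt hw
    rw [Complex.sub_re, abs_lt] at h1
    rw [Complex.sub_im, abs_lt] at h2
    exact ⟨⟨by linarith, by linarith⟩, ⟨by linarith, by linarith⟩⟩
  have hsymm : ∀ x y : ℝ, Complex.measurableEquivRealProd.symm (x, y)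
      = (x : ℂ) + (y : ℂ) * Complex.I := fun x y => by
    simp [Complex.measurableEquivRealProd_symm_apply, Complex.mk_eq_add_mul_I]
  have hGm : Measurable fun p : ℝ × ℝ => G (Complex.measurableEquivRealProd.symm p) :=
    hF.comp Complex.measurableEquivRealProd.symm.measurable
  calc ∫⁻ w in Metric.ball c δ, F w = ∫⁻ w, G w :=
        (lintegral_indicator Metric.isOpen_ball.measurableSet _).symm
    _ = ∫⁻ p : ℝ × ℝ, G (Complex.measurableEquivRealProd.symm p) :=
        ((Complex.volume_preserving_equiv_real_prod.symm).lintegral_comp_emb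
          Complex.measurableEquivRealProd.symm.measurableEmbedding _).symm
    _ = ∫⁻ y, ∫⁻ x, G (Complex.measurableEquivRealProd.symm (x, y)) := by
        rw [Measure.volume_eq_prod, lintegral_prod_symm' _ hGm]
    _ ≤ ∫⁻ y, t.indicator (fun _ => A) y := by
        refine lintegral_mono fun y => ?_
        by_cases hy : y ∈ t
        · rw [Set.indicator_of_mem hy]
          refine le_trans ?_ (hA y hy)
          rw [← lintegral_indicator measurableSet_Ioo]
          refine lintegral_mono fun x => ?_
          simp only [hsymm]
          by_cases hw : (x : ℂ) + (y : ℂ) * Complex.I ∈ Metric.ball c δ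
          · have := (hmem _ hw).1
            simp only [Complex.add_re, Complex.ofReal_re, Complex.mul_re, Complex.I_re, mul_zero,
              Complex.ofReal_im, Complex.I_im, zero_mul, sub_zero, add_zero] at this
            rw [Set.indicator_of_mem this]
            exact Set.indicator_le_self _ _ _
          · simp only [G]
            rw [Set.indicator_of_notMem hw]; exact zero_le
        · rw [Set.indicator_of_notMem hy]
          refine le_of_eq ((lintegral_congr fun x => ?_).trans lintegral_zero)
          simp only [hsymm, G]
          refine Set.indicator_of_notMem (fun hw => hy ?_) _
          simpa using (hmem _ hw).2
    _ = ENNReal.ofReal (2 * δ) * A := by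
        rw [lintegral_indicator measurableSet_Ioo, setLIntegral_const, Real.volume_Ioo, mul_comm]
        congr 2; ring

/-- On a set of measure at most one, Hölder bounds the `L¹` norm by any `L^p` norm, so both summands
can be measured in the same way. -/
lemma SumBound.setLIntegral_le {a b : ℝ} {u : ℝ → ℂ} (h : SumBound a b u) {s : Set ℝ}
    (hs : volume s ≤ 1) :
    ∫⁻ x in s, ‖u x‖ₑ ≤ ENNReal.ofReal a + ENNReal.ofReal b := by
  obtain ⟨f, g, hf, hg, hfg, h1, h2⟩ := h
  have key : ∀ (p : ℝ≥0∞) (w : ℝ → ℂ), 1 ≤ p → MemLp w p volume →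
      ∫⁻ x in s, ‖w x‖ₑ ≤ eLpNorm w p volume := by
    intro p w hp hw
    rw [← eLpNorm_one_eq_lintegral_enorm]
    refine (eLpNorm_le_eLpNorm_mul_rpow_measure_univ hp hw.1.restrict).trans ?_
    calc _ ≤ eLpNorm w p volume * 1 := by
          gcongr
          · exact Measure.restrict_le_self
          · rw [Measure.restrict_apply_univ]
            refine ENNReal.rpow_le_one hs ?_
            simp only [ENNReal.toReal_one, sub_nonneg]
            rcases eq_or_ne p ∞ with rfl | hp'
            · simp
            · have := ENNReal.toReal_mono hp' hp
              simp only [ENNReal.toReal_one] at this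
              exact one_div_le_one_div_of_le one_pos this
      _ = _ := mul_one _
  calc ∫⁻ x in s, ‖u x‖ₑ = ∫⁻ x in s, ‖f x + g x‖ₑ := by
        refine lintegral_congr_ae ?_
        filter_upwards [ae_restrict_of_ae hfg] with x hx
        rw [← hx]; rfl
    _ ≤ ∫⁻ x in s, (‖f x‖ₑ + ‖g x‖ₑ) := lintegral_mono fun x => enorm_add_le _ _
    _ = (∫⁻ x in s, ‖f x‖ₑ) + ∫⁻ x in s, ‖g x‖ₑ := lintegral_add_left' hf.1.enorm.restrict _
    _ ≤ _ := add_le_add ((key _ _ (by simp) hf).trans h1)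
        ((key _ _ (by norm_num) hg).trans h2)

/-- Functions with a Hardy bound are bounded on closed substrips. -/
lemma HardyBound.exists_bound {C : ℝ} {h : ℂ → ℂ} (hb : HardyBound C h) (hC : 0 ≤ C)
    (hd : DifferentiableOn ℂ h lowerStrip) {δ : ℝ} (hδ : 0 < δ) (hδ' : δ ≤ 1 / 2) :
    ∃ M, ∀ z : ℂ, -1 + δ ≤ z.im → z.im ≤ -δ → ‖h z‖ ≤ M := by
  refine ⟨(Real.pi * δ ^ 2)⁻¹ * (2 * δ * (C + C)), fun z hz1 hz2 => ?_⟩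
  have hsub : Metric.ball z δ ⊆ lowerStrip := by
    intro w hw
    have h1 := (Complex.abs_im_le_norm (w - z)).trans_lt (by rwa [← dist_eq_norm])
    rw [Complex.sub_im, abs_lt] at h1
    exact ⟨by linarith [h1.1], by linarith [h1.2]⟩
  have hd' := hd.mono hsub
  have h1 := area_mul_enorm_le_lintegral_ball hδ hd'
  have h2 : ∫⁻ w in Metric.ball z δ, ‖h w‖ₑ
      ≤ ENNReal.ofReal (2 * δ) * (ENNReal.ofReal C + ENNReal.ofReal C) := by
    refine lintegral_ball_le (fun y hy => ?_) ?_
    -- The slice has length `2δ`, at most one because `δ ≤ 1/2`.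
    · refine (hb.sumBound hC (by linarith [hy.1]) (by linarith [hy.2])).setLIntegral_le ?_
      rw [Real.volume_Ioo, ← ENNReal.ofReal_one]
      exact ENNReal.ofReal_le_ofReal (by linarith)
    · classical
      have := hd'.continuousOn.enorm
      rw [← Set.piecewise_eq_indicator]
      exact this.measurable_piecewise continuousOn_const Metric.isOpen_ball.measurableSet
  have h3 := h1.trans h2
  rw [← ofReal_norm, ← ENNReal.ofReal_mul (by positivity), ← ENNReal.ofReal_add hC hC,
    ← ENNReal.ofReal_mul (by positivity), ENNReal.ofReal_le_ofReal_iff (by positivity)] at h3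
  rw [← div_eq_inv_mul, le_div_iff₀ (by positivity)]
  linarith

/-! ### Exponentially decaying functions and contour shifts -/

lemma integrable_exp_neg_mul_abs {c : ℝ} (hc : 0 < c) :
    Integrable (fun x : ℝ => Real.exp (-c * |x|)) volume := by
  have h1 : IntegrableOn (fun x : ℝ => Real.exp (-c * |x|)) (Set.Ioi 0) :=
    (integrableOn_exp_mul_Ioi (by linarith : -c < 0) 0).congr_fun
      (fun x hx => by simp only; rw [abs_of_pos hx]) measurableSet_Ioi
  have h2 : IntegrableOn (fun x : ℝ => Real.exp (-c * |x|)) (Set.Iic 0) :=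
    (integrableOn_exp_mul_Iic hc 0).congr_fun
      (fun x hx => by simp only; rw [abs_of_nonpos hx, neg_mul_neg]) measurableSet_Iic
  rw [← integrableOn_univ, ← Set.Iic_union_Ioi (a := (0 : ℝ))]
  exact h2.union h1

lemma integrable_of_exp_bound {φ : ℝ → ℂ} (hφ : AEStronglyMeasurable φ volume) {M c : ℝ}
    (hc : 0 < c) (hb : ∀ x, ‖φ x‖ ≤ M * Real.exp (-c * |x|)) : Integrable φ volume :=
  ((integrable_exp_neg_mul_abs hc).const_mul M).mono' hφ (Eventually.of_forall hb)

lemma memLp_two_of_exp_bound {φ : ℝ → ℂ} (hφ : AEStronglyMeasurable φ volume) {M c : ℝ}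
    (hc : 0 < c) (hb : ∀ x, ‖φ x‖ ≤ M * Real.exp (-c * |x|)) : MemLp φ 2 volume := by
  rw [memLp_two_iff_integrable_sq_norm hφ]
  refine ((integrable_exp_neg_mul_abs (by linarith : 0 < 2 * c)).const_mul (M ^ 2)).mono'
    (hφ.norm.pow 2) (Eventually.of_forall fun x => ?_)
  rw [Real.norm_of_nonneg (by positivity)]
  calc ‖φ x‖ ^ 2 ≤ (M * Real.exp (-c * |x|)) ^ 2 := by gcongr; exact hb x
    _ = M ^ 2 * Real.exp (-(2 * c) * |x|) := by
      rw [mul_pow, ← Real.exp_nat_mul]; congr 2; push_cast; ring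

lemma continuous_lineAt {V : ℂ → ℂ} {s : Set ℂ} (hV : ContinuousOn V s) {y : ℝ}
    (hs : ∀ x : ℝ, (x : ℂ) + (y : ℂ) * Complex.I ∈ s) : Continuous (lineAt V y) :=
  hV.comp_continuous (by fun_prop) hs

/-- Contour shift for holomorphic functions with exponential decay on a closed strip. -/
lemma integral_lineAt_eq {V : ℂ → ℂ} {y₁ y₂ M c : ℝ} (hy : y₁ ≤ y₂) (hc : 0 < c)
    (hV : DifferentiableOn ℂ V {z | y₁ ≤ z.im ∧ z.im ≤ y₂})
    (hb : ∀ z : ℂ, y₁ ≤ z.im → z.im ≤ y₂ → ‖V z‖ ≤ M * Real.exp (-c * |z.re|)) :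
    ∫ x, lineAt V y₁ x = ∫ x, lineAt V y₂ x := by
  have hInt : ∀ y, y₁ ≤ y → y ≤ y₂ → Integrable (lineAt V y) volume := fun y h1 h2 => by
    refine integrable_of_exp_bound (continuous_lineAt hV.continuousOn
      fun x => by simp [h1, h2]).aestronglyMeasurable hc (M := M) fun x => ?_
    simpa [lineAt] using hb ((x : ℂ) + (y : ℂ) * Complex.I) (by simpa) (by simpa)
  have hrect : ∀ R : ℝ, (∫ x in (-R)..R, lineAt V y₁ x) - (∫ x in (-R)..R, lineAt V y₂ x)
      = Complex.I * (∫ y in y₁..y₂, V (((-R : ℝ) : ℂ) + y * Complex.I))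
        - Complex.I * (∫ y in y₁..y₂, V ((R : ℂ) + y * Complex.I)) := fun R => by
    have := Complex.integral_boundary_rect_eq_zero_of_differentiableOn V ⟨-R, y₁⟩ ⟨R, y₂⟩
      (hV.mono fun z hz => by
        have := hz.2
        simpa [Set.uIcc_of_le hy] using this)
    simp only [smul_eq_mul] at this
    simp only [lineAt]
    linear_combination this
  have hside : ∀ s : ℝ, (s = 1 ∨ s = -1) → Tendsto (fun R : ℝ =>
      Complex.I * ∫ y in y₁..y₂, V (((s * R : ℝ) : ℂ) + y * Complex.I)) atTop (𝓝 0) := by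
    intro s hs
    have hz : Tendsto (fun R : ℝ => M * Real.exp (-c * |R|) * |y₂ - y₁|) atTop (𝓝 0) := by
      have : Tendsto (fun R : ℝ => Real.exp (-c * |R|)) atTop (𝓝 0) :=
        Real.tendsto_exp_atBot.comp (tendsto_abs_atTop_atTop.const_mul_atTop_of_neg (by linarith))
      simpa using (this.const_mul M).mul_const |y₂ - y₁|
    refine squeeze_zero_norm (fun R => ?_) hz
    rw [norm_mul, Complex.norm_I, one_mul]
    refine intervalIntegral.norm_integral_le_of_norm_le_const fun y hy' => ?_
    rw [Set.uIoc_of_le hy] at hy'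
    have := hb (((s * R : ℝ) : ℂ) + y * Complex.I) (by simpa using hy'.1.le) (by simpa using hy'.2)
    have habs : |s * R| = |R| := by rcases hs with rfl | rfl <;> simp
    have e : (((s * R : ℝ) : ℂ) + y * Complex.I).re = s * R := by simp
    rwa [e, habs] at this
  have h1 := (intervalIntegral_tendsto_integral (hInt y₁ le_rfl hy) tendsto_neg_atTop_atBot
    tendsto_id).sub (intervalIntegral_tendsto_integral (hInt y₂ hy le_rfl) tendsto_neg_atTop_atBot
    tendsto_id)
  have h2 := (hside (-1) (Or.inr rfl)).sub (hside 1 (Or.inl rfl))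
  rw [sub_zero] at h2
  refine sub_eq_zero.mp (tendsto_nhds_unique h1 (h2.congr fun R => ?_))
  have := hrect R
  simp only [id]
  rw [this]
  simp

/-! ### Existence of boundary values -/

lemma HardyBound.exists_deriv_bound {C : ℝ} {h : ℂ → ℂ} (hb : HardyBound C h) (hC : 0 ≤ C)
    (hd : DifferentiableOn ℂ h lowerStrip) {δ : ℝ} (hδ : 0 < δ) (hδ' : δ ≤ 1 / 2) :
    ∃ M, ∀ z : ℂ, -1 + δ ≤ z.im → z.im ≤ -δ → ‖deriv h z‖ ≤ M := by
  obtain ⟨M, hM⟩ := hb.exists_bound hC hd (by positivity : 0 < δ / 2) (by linarith)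
  refine ⟨M / (δ / 2), fun z h1 h2 => ?_⟩
  have hball : ∀ w ∈ Metric.closedBall z (δ / 2), -1 + δ / 2 ≤ w.im ∧ w.im ≤ -(δ / 2) := by
    intro w hw
    rw [Metric.mem_closedBall, dist_eq_norm] at hw
    have := (Complex.abs_im_le_norm (w - z)).trans hw
    rw [Complex.sub_im, abs_le] at this
    constructor <;> linarith
  refine Complex.norm_deriv_le_of_forall_mem_sphere_norm_le (by positivity) ?_ fun w hw => ?_
  · refine DifferentiableOn.diffContOnCl (hd.mono fun w hw => ?_)
    have := hball w (Metric.closure_ball_subset_closedBall hw)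
    exact ⟨by linarith, by linarith⟩
  · have := hball w (Metric.sphere_subset_closedBall hw)
    exact hM w this.1 this.2

lemma hasDerivAt_vertical {h : ℂ → ℂ} {x y : ℝ}
    (hd : DifferentiableAt ℂ h ((x : ℂ) + (y : ℂ) * Complex.I)) :
    HasDerivAt (fun s : ℝ => lineAt h s x) (Complex.I * deriv h ((x : ℂ) + (y : ℂ) * Complex.I)) y := by
  have h1 : HasDerivAt (fun s : ℝ => (x : ℂ) + (s : ℂ) * Complex.I) Complex.I y := by
    simpa using ((Complex.ofRealCLM.hasDerivAt (x := y)).mul_const Complex.I).const_add (x : ℂ)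
  have := hd.hasDerivAt.comp (𝕜 := ℝ) y h1
  rw [mul_comm] at this
  exact this

lemma hasDerivAt_horizontal {h : ℂ → ℂ} {x y : ℝ}
    (hd : DifferentiableAt ℂ h ((x : ℂ) + (y : ℂ) * Complex.I)) :
    HasDerivAt (lineAt h y) (deriv h ((x : ℂ) + (y : ℂ) * Complex.I)) x := by
  have h1 : HasDerivAt (fun s : ℝ => (s : ℂ) + (y : ℂ) * Complex.I) 1 x := by
    simpa using (Complex.ofRealCLM.hasDerivAt (x := x)).add_const ((y : ℂ) * Complex.I)
  have := hd.hasDerivAt.comp (𝕜 := ℝ) x h1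
  rw [mul_one] at this
  exact this

lemma mem_lowerStrip_line {y : ℝ} (h1 : -1 < y) (h0 : y < 0) (x : ℝ) :
    (x : ℂ) + (y : ℂ) * Complex.I ∈ lowerStrip := by
  simp [lowerStrip, h1, h0]

/-- The pairing of `h_y` with a Schwartz function is differentiable in `y`, and the derivative
falls on the Schwartz function. -/
lemma HardyBound.hasDerivAt_pairing {C : ℝ} {h : ℂ → ℂ} (hb : HardyBound C h) (hC : 0 ≤ C)
    (hd : DifferentiableOn ℂ h lowerStrip) (ψ : 𝓢(ℝ, ℂ)) {y : ℝ} (h1 : -1 < y) (h0 : y < 0) :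
    HasDerivAt (fun s : ℝ => ∫ x, lineAt h s x * ψ x)
      (-Complex.I * ∫ x, lineAt h y x * SchwartzMap.derivCLM ℂ ℂ ψ x) y := by
  obtain ⟨δ, hδ, hδ1, hδ0, hδ2⟩ : ∃ δ, 0 < δ ∧ -1 + 2 * δ ≤ y ∧ y ≤ -(2 * δ) ∧ δ ≤ 1 / 2 := by
    refine ⟨min (1 + y) (-y) / 2, ?_, ?_, ?_, ?_⟩
    · have : 0 < min (1 + y) (-y) := lt_min (by linarith) (by linarith)
      linarith
    · linarith [min_le_left (1 + y) (-y)]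
    · linarith [min_le_right (1 + y) (-y)]
    · linarith [min_le_left (1 + y) (-y)]
  obtain ⟨M, hM⟩ := hb.exists_deriv_bound hC hd hδ hδ2
  have hnear : ∀ s ∈ Metric.ball y δ, -1 + δ ≤ s ∧ s ≤ -δ := by
    intro s hs
    rw [Metric.mem_ball, Real.dist_eq, abs_lt] at hs
    constructor <;> linarith
  have hda : ∀ s : ℝ, -1 < s → s < 0 → ∀ x : ℝ,
      DifferentiableAt ℂ h ((x : ℂ) + (s : ℂ) * Complex.I) := fun s hs1 hs0 x =>
    (hd _ (mem_lowerStrip_line hs1 hs0 x)).differentiableAt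
      (isOpen_lowerStrip.mem_nhds (mem_lowerStrip_line hs1 hs0 x))
  have hcont : ∀ s : ℝ, -1 < s → s < 0 → Continuous (lineAt h s) := fun s hs1 hs0 =>
    continuous_lineAt hd.continuousOn (mem_lowerStrip_line hs1 hs0)
  have hcd : Continuous (lineAt (deriv h) y) :=
    continuous_lineAt (hd.deriv isOpen_lowerStrip).continuousOn (mem_lowerStrip_line h1 h0)
  have hψ1 : Integrable ψ volume := ψ.integrable
  have hu'v : Integrable (lineAt (deriv h) y * (ψ : ℝ → ℂ)) volume := by
    refine (hψ1.norm.const_mul M).mono' (hcd.mul ψ.continuous).aestronglyMeasurable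
      (Eventually.of_forall fun x => ?_)
    simp only [Pi.mul_apply, norm_mul]
    gcongr
    exact hM _ (by simpa using (by linarith : -1 + δ ≤ y)) (by simpa using (by linarith : y ≤ -δ))
  have key := (hasDerivAt_integral_of_dominated_loc_of_deriv_le (μ := volume)
    (F := fun s x => lineAt h s x * ψ x)
    (F' := fun s x => Complex.I * deriv h ((x : ℂ) + (s : ℂ) * Complex.I) * ψ x)
    (bound := fun x => M * ‖ψ x‖) (x₀ := y) (Metric.ball_mem_nhds y hδ) ?_ ?_ ?_ ?_ ?_ ?_).2
  · refine key.congr_deriv (Eq.symm ?_)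
    -- The vertical derivative of a holomorphic function is `i` times the horizontal one, and
    -- integration by parts moves the latter onto `ψ`. The derivative of the pairing is thus
    -- controlled by the Hardy bound alone, uniformly up to the boundary.
    have hparts := integral_mul_deriv_eq_deriv_mul_of_integrable (A := ℂ) (u := lineAt h y) (v := ψ)
      (u' := lineAt (deriv h) y) (v' := SchwartzMap.derivCLM ℂ ℂ ψ)
      (fun x _ => hasDerivAt_horizontal (hda y h1 h0 x))
      (fun x _ => by
        rw [SchwartzMap.derivCLM_apply]
        exact ψ.differentiableAt.hasDerivAt)
      ((hb.sumBound hC h1 h0).integrable_mul (SchwartzMap.derivCLM ℂ ℂ ψ).integrable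
        ((SchwartzMap.derivCLM ℂ ℂ ψ).memLp 2))
      hu'v ((hb.sumBound hC h1 h0).integrable_mul hψ1 (ψ.memLp 2))
    rw [hparts, neg_mul_neg, ← integral_const_mul]
    refine integral_congr_ae (Eventually.of_forall fun x => ?_)
    simp only [lineAt]
    ring
  · filter_upwards [Metric.ball_mem_nhds y hδ] with s hs
    have := hnear s hs
    exact ((hcont s (by linarith) (by linarith)).mul ψ.continuous).aestronglyMeasurable
  · exact (hb.sumBound hC h1 h0).integrable_mul hψ1 (ψ.memLp 2)
  · exact ((continuous_const.mul hcd).mul ψ.continuous).aestronglyMeasurable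
  · refine Eventually.of_forall fun x s hs => ?_
    have := hnear s hs
    rw [norm_mul, norm_mul, Complex.norm_I, one_mul]
    gcongr
    exact hM _ (by simpa using this.1) (by simpa using this.2)
  · exact hψ1.norm.const_mul M
  · refine Eventually.of_forall fun x s hs => ?_
    have := hnear s hs
    exact (hasDerivAt_vertical (hda s (by linarith) (by linarith) x)).mul_const _

/-- A function with bounded derivative on an interval has limits at its end points. -/
lemma exists_tendsto_of_deriv_bound {F F' : ℝ → ℂ} {L a b : ℝ} {l : Filter ℝ} [l.NeBot]
    (hl : ∀ᶠ y in l, y ∈ Set.Ioo a b) (hl' : ∃ y₀, l ≤ 𝓝 y₀)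
    (hF : ∀ y ∈ Set.Ioo a b, HasDerivAt F (F' y) y) (hL : ∀ y ∈ Set.Ioo a b, ‖F' y‖ ≤ L) :
    ∃ v, Tendsto F l (𝓝 v) := by
  have hlip : LipschitzOnWith (Real.toNNReal L) F (Set.Ioo a b) := by
    refine (convex_Ioo a b).lipschitzOnWith_of_nnnorm_hasDerivWithin_le
      (fun y hy => (hF y hy).hasDerivWithinAt) fun y hy => ?_
    rw [← norm_toNNReal]
    exact Real.toNNReal_le_toNNReal (hL y hy)
  obtain ⟨y₀, hy₀⟩ := hl'
  rw [← cauchy_map_iff_exists_tendsto]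
  have hc : Cauchy l := cauchy_nhds.mono hy₀
  exact hc.map_of_le hlip.uniformContinuousOn (le_principal_iff.mpr hl)

lemma integral_conj_mul (u : ℝ → ℂ) (φ : 𝓢(ℝ, ℂ)) :
    ∫ x, conj (u x) * φ x
      = conj (∫ x, u x * φ.postcompCLM ((Complex.conjCLE : ℂ ≃L[ℝ] ℂ) : ℂ →L[ℝ] ℂ) x) := by
  rw [← integral_conj]
  refine integral_congr_ae (Eventually.of_forall fun x => ?_)
  simp

lemma HardyBound.exists_tendsto_pairing {C : ℝ} {h : ℂ → ℂ} (hb : HardyBound C h) (hC : 0 ≤ C)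
    (hd : DifferentiableOn ℂ h lowerStrip) {l : Filter ℝ} [l.NeBot]
    (hl : ∀ᶠ y in l, y ∈ Set.Ioo (-1 : ℝ) 0) (hl' : ∃ y₀, l ≤ 𝓝 y₀) (φ : 𝓢(ℝ, ℂ)) :
    ∃ v, Tendsto (fun y : ℝ => ∫ x, conj (lineAt h y x) * φ x) l (𝓝 v) := by
  set ψ := φ.postcompCLM ((Complex.conjCLE : ℂ ≃L[ℝ] ℂ) : ℂ →L[ℝ] ℂ)
  set ψ' := SchwartzMap.derivCLM ℂ ℂ ψ
  obtain ⟨v, hv⟩ := exists_tendsto_of_deriv_bound (L := C * (∫ x, ‖ψ' x‖) + C * normTwo ψ') hl hl'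
    (fun y hy => hb.hasDerivAt_pairing hC hd ψ hy.1 hy.2) (fun y hy => by
      rw [norm_mul, norm_neg, Complex.norm_I, one_mul]
      exact (hb.sumBound hC hy.1 hy.2).norm_integral_le hC hC ψ'.integrable (ψ'.memLp 2))
  refine ⟨conj v, ?_⟩
  simp only [integral_conj_mul]
  exact (Complex.continuous_conj.tendsto v).comp hv

/-- The bound forces `Λ` to vanish on the kernel of `T`, so `Λ` descends to a bounded functional on
the range of `T`; Hahn-Banach extends it and Riesz represents it. A linear section `g` of `T` onto
its range realizes the descent. -/
lemma exists_inner_eq_of_norm_le {E 𝓗 : Type*} [AddCommGroup E] [Module ℂ E]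
    [NormedAddCommGroup 𝓗] [InnerProductSpace ℂ 𝓗] [CompleteSpace 𝓗] (T : E →ₗ[ℂ] 𝓗)
    (Λ : E →ₗ[ℂ] ℂ) {C : ℝ} (hΛ : ∀ φ, ‖Λ φ‖ ≤ C * ‖T φ‖) :
    ∃ v : 𝓗, ∀ φ, Λ φ = inner ℂ v (T φ) := by
  obtain ⟨g, hg⟩ := T.rangeRestrict.exists_rightInverse_of_surjective
    (LinearMap.range_rangeRestrict T)
  have hg' : ∀ w : LinearMap.range T, T (g w) = w := fun w =>
    congrArg Subtype.val (LinearMap.congr_fun hg w)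
  let ℓ : StrongDual ℂ (LinearMap.range T) := (Λ.comp g).mkContinuous C fun w => by
    simpa [hg' w] using hΛ (g w)
  obtain ⟨L, hL, -⟩ := exists_extension_norm_eq (LinearMap.range T) ℓ
  refine ⟨(InnerProductSpace.toDual ℂ 𝓗).symm L, fun φ => ?_⟩
  rw [InnerProductSpace.toDual_symm_apply, show T φ = (T.rangeRestrict φ : 𝓗) from rfl, hL]
  change Λ φ = Λ (g (T.rangeRestrict φ))
  have h0 := hΛ (φ - g (T.rangeRestrict φ))
  rw [map_sub, map_sub, hg'] at h0
  simp only [LinearMap.codRestrict_apply, LinearMap.rangeRestrict, sub_self, norm_zero,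
    mul_zero] at h0
  exact sub_eq_zero.mp (norm_le_zero_iff.mp h0)

/-- The distributional limit of `h_y` along `l` as a linear functional. -/
lemma HardyBound.exists_functional {C : ℝ} {h : ℂ → ℂ} (hb : HardyBound C h) (hC : 0 ≤ C)
    (hd : DifferentiableOn ℂ h lowerStrip) {l : Filter ℝ} [l.NeBot] {y₀ : ℝ}
    (hl : ∀ᶠ y in l, y ∈ Set.Ioo (-1 : ℝ) 0) (hl' : l ≤ 𝓝 y₀) :
    ∃ Λ : 𝓢(ℝ, ℂ) →ₗ[ℂ] ℂ,
      (∀ φ, Tendsto (fun y : ℝ => ∫ x, conj (lineAt h y x) * φ x) l (𝓝 (Λ φ))) ∧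
      ∀ φ, ‖Λ φ‖ ≤ C * (1 + y₀) * (∫ x, ‖φ x‖) + C * (-y₀) * normTwo φ := by
  choose Λ hΛ using hb.exists_tendsto_pairing hC hd hl ⟨y₀, hl'⟩
  have hInt : ∀ (φ : 𝓢(ℝ, ℂ)), ∀ᶠ y in l, Integrable fun x => conj (lineAt h y x) * φ x :=
    fun φ => by
      filter_upwards [hl] with y hy
      exact (hb.sumBound hC hy.1 hy.2).conj.integrable_mul φ.integrable (φ.memLp 2)
  refine ⟨⟨⟨Λ, fun φ ψ => ?_⟩, fun c φ => ?_⟩, hΛ, fun φ => ?_⟩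
  · refine tendsto_nhds_unique (hΛ (φ + ψ)) (((hΛ φ).add (hΛ ψ)).congr' ?_)
    filter_upwards [hInt φ, hInt ψ] with y h1 h2
    rw [← integral_add h1 h2]
    simp [mul_add]
  · refine tendsto_nhds_unique (hΛ (c • φ)) (((hΛ φ).const_smul c).congr' ?_)
    filter_upwards with y
    rw [smul_eq_mul, ← integral_const_mul]
    refine integral_congr_ae (Eventually.of_forall fun x => ?_)
    simp only [smul_apply, smul_eq_mul]
    ring
  -- The weights `1 + y` and `-y` persist in the limit. Hence only the `L¹` term survives at `y₀ =
  -- 0` and only the `L²` term at `y₀ = -1`.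
  · have hlim : Tendsto (fun y : ℝ => C * (1 + y) * (∫ x, ‖φ x‖) + C * (-y) * normTwo φ) l
        (𝓝 (C * (1 + y₀) * (∫ x, ‖φ x‖) + C * (-y₀) * normTwo φ)) := by
      have : Continuous fun y : ℝ => C * (1 + y) * (∫ x, ‖φ x‖) + C * (-y) * normTwo φ := by
        fun_prop
      exact (this.tendsto y₀).mono_left hl'
    refine le_of_tendsto_of_tendsto (hΛ φ).norm hlim ?_
    filter_upwards [hl] with y hy
    exact (hb y hy.1 hy.2).conj.norm_integral_le (by nlinarith [hy.1]) (by nlinarith [hy.2])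
      φ.integrable (φ.memLp 2)

/-- Test against nonnegative bumps of integral one shrinking to `x`: each pairing is at most `C`,
and almost everywhere the averages converge to `u(x)` because the bumps have comparable inner and
outer radii. -/
lemma ae_norm_le_of_forall_integral {u : ℝ → ℂ} (hu : LocallyIntegrable u volume) {C : ℝ}
    (hC : ∀ φ : 𝓢(ℝ, ℂ), ‖∫ x, conj (u x) * φ x‖ ≤ C * ∫ x, ‖φ x‖) : ∀ᵐ x, ‖u x‖ ≤ C := by
  let b : ℕ → ContDiffBump (0 : ℝ) := fun n =>
    ⟨1 / ((n : ℝ) + 1), 2 / ((n : ℝ) + 1), by positivity, by gcongr; norm_num⟩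
  have hb : Tendsto (fun n => (b n).rOut) atTop (𝓝 0) := by
    have := (tendsto_one_div_add_atTop_nhds_zero_nat (𝕜 := ℝ)).const_mul 2
    simpa [b, div_eq_mul_inv] using this
  have hb' : ∀ᶠ n in atTop, (b n).rOut ≤ 2 * (b n).rIn := Eventually.of_forall fun n => by
    simp only [b]; apply le_of_eq; ring
  filter_upwards [ContDiffBump.ae_convolution_tendsto_right_of_locallyIntegrable hb hb' hu]
    with x hx
  refine le_of_tendsto hx.norm (Eventually.of_forall fun n => ?_)
  have hs : HasCompactSupport fun s : ℝ => (((b n).normed volume (x - s) : ℝ) : ℂ) := by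
    have h1 : HasCompactSupport fun s : ℝ => (b n).normed volume (x - s) :=
      (b n).hasCompactSupport_normed.comp_homeomorph (Homeomorph.subLeft x)
    exact h1.comp_left (g := fun r : ℝ => (r : ℂ)) (by simp)
  have hsm : ContDiff ℝ (⊤ : ℕ∞) fun s : ℝ => (((b n).normed volume (x - s) : ℝ) : ℂ) :=
    Complex.ofRealCLM.contDiff.comp ((b n).contDiff_normed.comp (contDiff_const.sub contDiff_id))
  have := hC (hs.toSchwartzMap hsm)
  simp only [HasCompactSupport.toSchwartzMap_toFun, Complex.norm_real] at this
  have e2 : ∫ s : ℝ, ‖(b n).normed volume (x - s)‖ = 1 := by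
    rw [integral_sub_left_eq_self (fun s => ‖(b n).normed volume s‖)]
    simp_rw [Real.norm_of_nonneg ((b n).nonneg_normed _)]
    exact (b n).integral_normed
  rw [e2, mul_one] at this
  refine le_trans (le_of_eq ?_) this
  rw [convolution_eq_swap, ← RCLike.norm_conj, ← integral_conj]
  congr 1
  refine integral_congr_ae (Eventually.of_forall fun s => ?_)
  simp [mul_comm]

lemma inner_toLp_eq_integral (v : Lp ℂ 2 (volume : Measure ℝ)) (φ : 𝓢(ℝ, ℂ)) :
    inner ℂ v (φ.toLp 2 volume) = ∫ x, conj (v x) * φ x := by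
  rw [L2.inner_def]
  refine integral_congr_ae ?_
  filter_upwards [φ.coeFn_toLp 2 volume] with x hx
  rw [hx, RCLike.inner_apply, mul_comm]

/-- The weight `1 + x²`. -/
def weight (x : ℝ) : ℂ := ((1 + x ^ 2 : ℝ) : ℂ)

lemma weight_hasTemperateGrowth : weight.HasTemperateGrowth := by
  unfold weight
  have : Function.HasTemperateGrowth fun x : ℝ => (1 : ℝ) + x ^ 2 :=
    (Function.HasTemperateGrowth.const 1).add (Function.HasTemperateGrowth.id'.pow 2)
  exact Function.HasTemperateGrowth.comp Function.Complex.hasTemperateGrowth_ofReal this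

lemma weight_ne_zero (x : ℝ) : weight x ≠ 0 := by
  unfold weight
  rw [Complex.ofReal_ne_zero]
  positivity

lemma continuous_weight : Continuous weight := by unfold weight; fun_prop

lemma norm_weight (x : ℝ) : ‖weight x‖ = 1 + x ^ 2 := by
  rw [weight, Complex.norm_real, Real.norm_of_nonneg (by positivity)]

lemma memLp_two_inv_weight : MemLp (fun x => (weight x)⁻¹) 2 volume := by
  have hc : Continuous fun x => (weight x)⁻¹ := continuous_weight.inv₀ weight_ne_zero
  rw [memLp_two_iff_integrable_sq_norm hc.aestronglyMeasurable]
  refine integrable_inv_one_add_sq.mono' (hc.norm.pow 2).aestronglyMeasurable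
    (Eventually.of_forall fun x => ?_)
  rw [norm_inv, norm_weight, Real.norm_of_nonneg (by positivity), inv_pow]
  gcongr
  nlinarith [sq_nonneg x, sq_nonneg (x ^ 2)]

/-- Cauchy-Schwarz against `1/(1 + x²)`. It turns an `L¹` bound into a weighted `L²` bound, so that
the functional at the top line can be represented by Riesz instead of by the duality of `L¹` and
`L^∞`. -/
lemma integral_norm_le_weight (φ : 𝓢(ℝ, ℂ)) :
    ∫ x, ‖φ x‖ ≤ normTwo (fun x => (weight x)⁻¹) *
      ‖(SchwartzMap.smulLeftCLM ℂ weight φ).toLp 2 volume‖ := by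
  set ψ := SchwartzMap.smulLeftCLM ℂ weight φ
  have hψ : ∀ x, ψ x = weight x * φ x := fun x => by
    simp [ψ, SchwartzMap.smulLeftCLM_apply_apply weight_hasTemperateGrowth]
  have h1 : MemLp (fun x => ((‖(weight x)⁻¹‖ : ℝ) : ℂ)) 2 volume := memLp_two_inv_weight.norm.ofReal
  have h2 : MemLp (fun x => ((‖ψ x‖ : ℝ) : ℂ)) 2 volume := (ψ.memLp 2).norm.ofReal
  have := norm_integral_mul_le_of_memLp_two h1 h2
  have e1 : eLpNorm (fun x => ((‖(weight x)⁻¹‖ : ℝ) : ℂ)) 2 volume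
      = eLpNorm (fun x => (weight x)⁻¹) 2 volume := eLpNorm_congr_norm_ae (by simp)
  have e2 : eLpNorm (fun x => ((‖ψ x‖ : ℝ) : ℂ)) 2 volume = eLpNorm ψ 2 volume :=
    eLpNorm_congr_norm_ae (by simp)
  rw [e1, e2, ← SchwartzMap.norm_toLp] at this
  refine le_trans (le_of_eq ?_) this
  have e3 : (fun x => ((‖(weight x)⁻¹‖ : ℝ) : ℂ) * ((‖ψ x‖ : ℝ) : ℂ))
      = fun x => ((‖φ x‖ : ℝ) : ℂ) := by
    funext x
    rw [← Complex.ofReal_mul, ← norm_mul, hψ, inv_mul_cancel_left₀ (weight_ne_zero x)]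
  rw [e3, integral_complex_ofReal, Complex.norm_real, Real.norm_of_nonneg]
  exact integral_nonneg fun x => norm_nonneg _

/-- Functions in the Hardy space of the lower strip have boundary values. -/
theorem exists_hasBoundaryValues {f : ℂ → ℂ} (hf : MemHardyLower ∞ 2 f) :
    ∃ f₀ f₁ : ℝ → ℂ, HasBoundaryValues f f₀ f₁ := by
  obtain ⟨C, hC, hb⟩ := hf.exists_hardyBound
  have hd := hf.1
  have hl0 : ∀ᶠ y in 𝓝[<] (0 : ℝ), y ∈ Set.Ioo (-1 : ℝ) 0 :=
    Ioo_mem_nhdsLT (by norm_num)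
  have hl1 : ∀ᶠ y in 𝓝[>] (-1 : ℝ), y ∈ Set.Ioo (-1 : ℝ) 0 :=
    Ioo_mem_nhdsGT (by norm_num)
  obtain ⟨Λ₀, hΛ₀, hB₀⟩ := hb.exists_functional hC hd hl0 nhdsWithin_le_nhds
  obtain ⟨Λ₁, hΛ₁, hB₁⟩ := hb.exists_functional hC hd hl1 nhdsWithin_le_nhds
  simp only [add_zero, mul_one, neg_zero, mul_zero, zero_mul] at hB₀
  simp only [add_neg_cancel, mul_zero, zero_mul, neg_neg, mul_one, zero_add] at hB₁
  obtain ⟨v₁, hv₁⟩ := exists_inner_eq_of_norm_le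
    (SchwartzMap.toLpCLM ℂ ℂ 2 volume : 𝓢(ℝ, ℂ) →L[ℂ] Lp ℂ 2 volume).toLinearMap Λ₁ (C := C)
    fun φ => by
      simpa [SchwartzMap.norm_toLp, normTwo] using hB₁ φ
  -- At the top line the functional is represented in terms of `(1 + x²)φ`, so the boundary value is
  -- `(1 + x²) v₀`. At this stage it is only locally integrable; its boundedness comes from the `L¹`
  -- bound by mollification.
  obtain ⟨v₀, hv₀⟩ := exists_inner_eq_of_norm_le
    ((SchwartzMap.toLpCLM ℂ ℂ 2 volume : 𝓢(ℝ, ℂ) →L[ℂ] Lp ℂ 2 volume).comp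
      (SchwartzMap.smulLeftCLM ℂ weight)).toLinearMap Λ₀
    (C := C * normTwo (fun x => (weight x)⁻¹)) fun φ => by
      rw [mul_assoc]
      exact (hB₀ φ).trans (mul_le_mul_of_nonneg_left (integral_norm_le_weight φ) hC)
  have hv₀' : ∀ φ : 𝓢(ℝ, ℂ), Λ₀ φ = ∫ x, conj (weight x * v₀ x) * φ x := fun φ => by
    rw [hv₀ φ]
    refine (inner_toLp_eq_integral v₀ (SchwartzMap.smulLeftCLM ℂ weight φ)).trans ?_
    refine integral_congr_ae (Eventually.of_forall fun x => ?_)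
    simp only [SchwartzMap.smulLeftCLM_apply_apply weight_hasTemperateGrowth, smul_eq_mul, map_mul]
    rw [show conj (weight x) = weight x from Complex.conj_ofReal _]
    ring
  have hloc : LocallyIntegrable (fun x => weight x * v₀ x) volume := by
    have h2 : LocallyIntegrable v₀ volume := (Lp.memLp v₀).locallyIntegrable (by norm_num)
    rw [← locallyIntegrableOn_univ] at h2 ⊢
    exact h2.continuousOn_mul continuous_weight.continuousOn isOpen_univ.isLocallyClosed
  have hbd : ∀ᵐ x, ‖weight x * v₀ x‖ ≤ C := ae_norm_le_of_forall_integral hloc fun φ => by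
    rw [← hv₀']
    exact hB₀ φ
  refine ⟨fun x => weight x * v₀ x, v₁, ⟨?_, Lp.memLp v₁, fun φ => ?_, fun φ => ?_⟩⟩
  · exact memLp_top_of_bound hloc.aestronglyMeasurable C hbd
  · rw [← hv₀']; exact hΛ₀ φ
  · rw [← (hv₁ φ).trans (inner_toLp_eq_integral v₁ φ)]; exact hΛ₁ φ

/-! ### Convergence against test functions with exponential decay -/

lemma normTwo_eq_sqrt {φ : ℝ → ℂ} (hφ : AEStronglyMeasurable φ volume) :
    normTwo φ = √(∫ x, ‖φ x‖ ^ 2) := by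
  unfold normTwo
  by_cases h : MemLp φ 2 volume
  · rw [h.eLpNorm_eq_integral_rpow_norm (by norm_num) (by norm_num), ENNReal.toReal_ofReal]
    · rw [Real.sqrt_eq_rpow]
      simp
    · positivity
  -- Outside `L²` both sides are zero by convention: the real part of an infinite norm, and the
  -- square root of an undefined integral.
  · have h1 : ¬ Integrable (fun x => ‖φ x‖ ^ 2) volume := by
      rwa [← memLp_two_iff_integrable_sq_norm hφ]
    have h2 : eLpNorm φ 2 volume = ∞ := by
      by_contra hne
      exact h ⟨hφ, lt_top_iff_ne_top.mpr hne⟩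
    rw [integral_undef h1, h2]; simp

lemma tendsto_norms_zero {ι : Type*} {l : Filter ι} [l.IsCountablyGenerated] {φ : ι → ℝ → ℂ}
    {ρ : ℝ → ℝ} (hm : ∀ᶠ i in l, AEStronglyMeasurable (φ i) volume)
    (hb : ∀ᶠ i in l, ∀ x, ‖φ i x‖ ≤ ρ x) (h1 : Integrable ρ volume)
    (h2 : Integrable (fun x => ρ x ^ 2) volume) (h0 : ∀ x, Tendsto (fun i => φ i x) l (𝓝 0)) :
    Tendsto (fun i => ∫ x, ‖φ i x‖) l (𝓝 0) ∧ Tendsto (fun i => normTwo (φ i)) l (𝓝 0) := by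
  constructor
  · have := tendsto_integral_filter_of_dominated_convergence (l := l) (μ := volume)
      (F := fun i x => ‖φ i x‖) (f := fun _ => (0 : ℝ)) ρ (hm.mono fun i hi => hi.norm)
      (hb.mono fun i hi => Eventually.of_forall fun x => by simpa using hi x) h1
      (Eventually.of_forall fun x => by simpa using (h0 x).norm)
    simpa using this
  · have := tendsto_integral_filter_of_dominated_convergence (l := l) (μ := volume)
      (F := fun i x => ‖φ i x‖ ^ 2) (f := fun _ => (0 : ℝ)) (fun x => ρ x ^ 2)
      (hm.mono fun i hi => hi.norm.pow 2)
      (hb.mono fun i hi => Eventually.of_forall fun x => by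
        rw [Real.norm_of_nonneg (by positivity)]
        gcongr
        exact hi x) h2
      (Eventually.of_forall fun x => by simpa using (h0 x).norm.pow 2)
    have h3 := (Real.continuous_sqrt.tendsto _).comp this
    simp only [integral_zero, Real.sqrt_zero] at h3
    refine h3.congr' (hm.mono fun i hi => ?_)
    exact (normTwo_eq_sqrt hi).symm

lemma TendsToDistributionally.tendsto_of_hasCompactSupport {h : ℂ → ℂ} {l : Filter ℝ} {u : ℝ → ℂ}
    (hu : TendsToDistributionally h l u) {φ : ℝ → ℂ} (hφ : ContDiff ℝ (⊤ : ℕ∞) φ)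
    (hs : HasCompactSupport φ) :
    Tendsto (fun y : ℝ => ∫ x, lineAt h y x * φ x) l (𝓝 (∫ x, u x * φ x)) := by
  have hs' : HasCompactSupport fun x => conj (φ x) := hs.comp_left (map_zero _)
  have hφ' : ContDiff ℝ (⊤ : ℕ∞) fun x => conj (φ x) := Complex.conjCLE.contDiff.comp hφ
  have := (Complex.continuous_conj.tendsto _).comp (hu (hs'.toSchwartzMap hφ'))
  have key : ∀ w : ℝ → ℂ, conj (∫ x, conj (w x) * (hs'.toSchwartzMap hφ') x)
      = ∫ x, w x * φ x := fun w => by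
    rw [← integral_conj]
    refine integral_congr_ae (Eventually.of_forall fun x => ?_)
    simp
  rw [key] at this
  exact this.congr fun y => key _

/-- Distributional convergence of `h_y` extends to smooth functions in `L¹ ∩ L²`. -/
lemma TendsToDistributionally.tendsto_of_contDiff {C a b : ℝ} {h : ℂ → ℂ} {l : Filter ℝ}
    {u : ℝ → ℂ} (hu : TendsToDistributionally h l u) (hb : HardyBound C h) (hC : 0 ≤ C)
    (hl : ∀ᶠ y in l, y ∈ Set.Ioo (-1 : ℝ) 0) (hub : SumBound a b u)
    {φ : ℝ → ℂ} (hφ : ContDiff ℝ (⊤ : ℕ∞) φ) (h1 : Integrable φ volume) (h2 : MemLp φ 2 volume) :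
    Tendsto (fun y : ℝ => ∫ x, lineAt h y x * φ x) l (𝓝 (∫ x, u x * φ x)) := by
  let χ : ℕ → ContDiffBump (0 : ℝ) := fun n =>
    ⟨(n : ℝ) + 1, (n : ℝ) + 2, by positivity, by linarith⟩
  set φn : ℕ → ℝ → ℂ := fun n x => ((χ n x : ℝ) : ℂ) * φ x with hφn
  have hφn_smooth : ∀ n, ContDiff ℝ (⊤ : ℕ∞) (φn n) := fun n =>
    (Complex.ofRealCLM.contDiff.comp (χ n).contDiff).mul hφ
  have hφn_supp : ∀ n, HasCompactSupport (φn n) := fun n =>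
    ((χ n).hasCompactSupport.comp_left (g := fun r : ℝ => (r : ℂ)) (by simp)).mul_right
  have hφn1 : ∀ n, Integrable (φn n) volume := fun n =>
    (hφn_smooth n).continuous.integrable_of_hasCompactSupport (hφn_supp n)
  have hφn2 : ∀ n, MemLp (φn n) 2 volume := fun n =>
    (hφn_smooth n).continuous.memLp_of_hasCompactSupport (hφn_supp n)
  have hbound : ∀ n x, ‖φ x - φn n x‖ ≤ ‖φ x‖ := fun n x => by
    have e : φ x - φn n x = ((1 - χ n x : ℝ) : ℂ) * φ x := by simp [hφn, sub_mul]
    rw [e, norm_mul, Complex.norm_real, Real.norm_of_nonneg (by linarith [(χ n).le_one (x := x)])]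
    exact mul_le_of_le_one_left (norm_nonneg _) (by linarith [(χ n).nonneg' x])
  have hptw : ∀ x, Tendsto (fun n => φ x - φn n x) atTop (𝓝 0) := fun x => by
    refine tendsto_const_nhds.congr' ?_
    filter_upwards [eventually_ge_atTop ⌈|x|⌉₊] with n hn
    have : χ n x = 1 := by
      refine (χ n).one_of_mem_closedBall ?_
      rw [Metric.mem_closedBall, Real.dist_eq, sub_zero]
      have := Nat.ceil_le.mp hn
      change |x| ≤ (n : ℝ) + 1
      linarith
    simp [hφn, this]
  obtain ⟨he1, he2⟩ := tendsto_norms_zero (l := atTop) (φ := fun n x => φ x - φn n x)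
    (ρ := fun x => ‖φ x‖)
    (Eventually.of_forall fun n => (h1.sub (hφn1 n)).aestronglyMeasurable)
    (Eventually.of_forall hbound) h1.norm
    ((memLp_two_iff_integrable_sq_norm h2.1).mp h2) hptw
  -- One constant serves all `h_y` and the limit `u`, which makes the truncation error uniform in
  -- `y` and lets `n` be fixed before `y` moves.
  set A := max C (max a b)
  have hA : 0 ≤ A := hC.trans (le_max_left _ _)
  have herr : ∀ (w : ℝ → ℂ), SumBound A A w → ∀ n, ‖(∫ x, w x * φ x) - ∫ x, w x * φn n x‖
      ≤ A * (∫ x, ‖φ x - φn n x‖) + A * normTwo (fun x => φ x - φn n x) := fun w hw n => by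
    rw [← integral_sub (hw.integrable_mul h1 h2) (hw.integrable_mul (hφn1 n) (hφn2 n))]
    simp only [← mul_sub]
    exact hw.norm_integral_le hA hA (h1.sub (hφn1 n)) (h2.sub (hφn2 n))
  have hE : Tendsto (fun n => A * (∫ x, ‖φ x - φn n x‖) + A * normTwo (fun x => φ x - φn n x))
      atTop (𝓝 0) := by
    simpa using (he1.const_mul A).add (he2.const_mul A)
  rw [Metric.tendsto_nhds]
  intro ε hε
  obtain ⟨n, hn⟩ := (hE.eventually (gt_mem_nhds (by positivity : 0 < ε / 3))).exists
  have hconv := Metric.tendsto_nhds.mp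
    (hu.tendsto_of_hasCompactSupport (hφn_smooth n) (hφn_supp n)) (ε / 3) (by positivity)
  filter_upwards [hl, hconv] with y hy hy2
  have e1 := herr _ ((hb.sumBound hC hy.1 hy.2).mono (le_max_left _ _) (le_max_left _ _)) n
  have e2 := herr _ (hub.mono ((le_max_left _ _).trans (le_max_right _ _))
    ((le_max_right _ _).trans (le_max_right _ _))) n
  rw [← dist_eq_norm] at e1 e2
  rw [dist_comm] at e2
  have := dist_triangle4 (∫ x, lineAt h y x * φ x) (∫ x, lineAt h y x * φn n x)
    (∫ x, u x * φn n x) (∫ x, u x * φ x)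
  linarith

/-- The pairing of `h_y` with `N_y` converges to the pairing of the boundary values, when `N` is
continuous up to the boundary and decays exponentially. -/
lemma TendsToDistributionally.tendsto_pairing_lineAt {C a b M c y₀ : ℝ} {h N : ℂ → ℂ}
    {l : Filter ℝ} [l.IsCountablyGenerated] {u : ℝ → ℂ}
    (hu : TendsToDistributionally h l u) (hb : HardyBound C h) (hC : 0 ≤ C)
    (hl : ∀ᶠ y in l, y ∈ Set.Ioo (-1 : ℝ) 0) (hub : SumBound a b u)
    (hc : 0 < c) (hN0 : ContDiff ℝ (⊤ : ℕ∞) (lineAt N y₀))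
    (hNb0 : ∀ x, ‖lineAt N y₀ x‖ ≤ M * Real.exp (-c * |x|))
    (hNc : ∀ᶠ y in l, Continuous (lineAt N y))
    (hNb : ∀ᶠ y in l, ∀ x, ‖lineAt N y x‖ ≤ M * Real.exp (-c * |x|))
    (hNt : ∀ x, Tendsto (fun y => lineAt N y x) l (𝓝 (lineAt N y₀ x))) :
    Tendsto (fun y : ℝ => ∫ x, lineAt h y x * lineAt N y x) l (𝓝 (∫ x, u x * lineAt N y₀ x)) := by
  have hN1 := integrable_of_exp_bound hN0.continuous.aestronglyMeasurable hc hNb0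
  have hN2 := memLp_two_of_exp_bound hN0.continuous.aestronglyMeasurable hc hNb0
  have hmain := hu.tendsto_of_contDiff hb hC hl hub hN0 hN1 hN2
  obtain ⟨he1, he2⟩ := tendsto_norms_zero (l := l) (φ := fun y x => lineAt N y x - lineAt N y₀ x)
    (ρ := fun x => 2 * M * Real.exp (-c * |x|))
    (hNc.mono fun y hy => (hy.sub hN0.continuous).aestronglyMeasurable)
    (hNb.mono fun y hy x => (norm_sub_le _ _).trans (by linarith [hy x, hNb0 x]))
    ((integrable_exp_neg_mul_abs hc).const_mul _)
    (by
      have := (integrable_exp_neg_mul_abs (by linarith : 0 < 2 * c)).const_mul ((2 * M) ^ 2)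
      refine this.congr (Eventually.of_forall fun x => ?_)
      simp only
      rw [mul_pow _ (Real.exp _), ← Real.exp_nat_mul]; congr 2; push_cast; ring)
    (fun x => by simpa using (hNt x).sub_const (lineAt N y₀ x))
  have hE : Tendsto (fun y => C * (∫ x, ‖lineAt N y x - lineAt N y₀ x‖)
      + C * normTwo (fun x => lineAt N y x - lineAt N y₀ x)) l (𝓝 0) := by
    simpa using (he1.const_mul C).add (he2.const_mul C)
  -- Only the boundary test function `N_{y₀}` is handled by distributional convergence. The change
  -- from `N_{y₀}` to `N_y` tends to zero in `L¹` and in `L²`, against which the `h_y` are uniformly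
  -- bounded.
  have hdiff : Tendsto (fun y : ℝ => ∫ x, lineAt h y x * (lineAt N y x - lineAt N y₀ x)) l
      (𝓝 0) := by
    refine squeeze_zero_norm' ?_ hE
    filter_upwards [hl, hNc, hNb] with y hy hy1 hy2
    exact (hb.sumBound hC hy.1 hy.2).norm_integral_le hC hC
      ((integrable_of_exp_bound hy1.aestronglyMeasurable hc hy2).sub hN1)
      ((memLp_two_of_exp_bound hy1.aestronglyMeasurable hc hy2).sub hN2)
  have := hdiff.add hmain
  rw [zero_add] at this
  refine this.congr' ?_
  filter_upwards [hl, hNc, hNb] with y hy hy1 hy2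
  have hs := hb.sumBound hC hy.1 hy.2
  have i1 := integrable_of_exp_bound hy1.aestronglyMeasurable hc hy2
  have i2 := memLp_two_of_exp_bound hy1.aestronglyMeasurable hc hy2
  refine (integral_add (hs.integrable_mul (i1.sub hN1) (i2.sub hN2))
    (hs.integrable_mul hN1 hN2)).symm.trans ?_
  refine integral_congr_ae (Eventually.of_forall fun x => ?_)
  simp only [Pi.sub_apply]
  ring

/-! ### The weight and the convergence of the phase integral -/

lemma norm_exp_le_exp_abs_re (z : ℂ) : ‖Complex.exp z‖ ≤ Real.exp |z.re| := by
  rw [Complex.norm_exp]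
  exact Real.exp_le_exp.mpr (le_abs_self _)

lemma norm_cos_le_exp (z : ℂ) : ‖Complex.cos z‖ ≤ Real.exp |z.im| := by
  rw [Complex.cos, norm_div, Complex.norm_ofNat, div_le_iff₀ two_pos]
  refine (norm_add_le _ _).trans ?_
  have h1 := norm_exp_le_exp_abs_re (z * Complex.I)
  have h2 := norm_exp_le_exp_abs_re (-z * Complex.I)
  simp only [Complex.mul_re, Complex.neg_re, Complex.neg_im, Complex.I_re, Complex.I_im, mul_zero,
    mul_one, zero_sub, abs_neg, neg_neg] at h1 h2
  linarith

/-- Mean value inequality on the segment from `0` to `w`, along which neither the norm nor `|Im|`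
exceeds its value at `w`. Iterated below, it gives Taylor remainders that grow exponentially in `|Im
w|` only. -/
lemma norm_image_sub_le_of_segment {f f' : ℂ → ℂ} {w : ℂ} {B : ℝ}
    (hf : ∀ z, HasDerivAt f (f' z) z)
    (hB : ∀ z : ℂ, ‖z‖ ≤ ‖w‖ → |z.im| ≤ |w.im| → ‖f' z‖ ≤ B) : ‖f w - f 0‖ ≤ B * ‖w‖ := by
  have := (convex_segment (𝕜 := ℝ) (0 : ℂ) w).norm_image_sub_le_of_norm_hasDerivWithin_le
    (f := f) (f' := f') (C := B) (fun z _ => (hf z).hasDerivWithinAt) ?_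
    (left_mem_segment ℝ _ _) (right_mem_segment ℝ _ _)
  · simpa using this
  · intro z hz
    obtain ⟨s, hs, rfl⟩ := (segment_eq_image ℝ (0 : ℂ) w).subset hz
    have hs1 : |s| ≤ 1 := abs_le.mpr ⟨by linarith [hs.1], hs.2⟩
    refine hB _ ?_ ?_
    · simp only [smul_zero, zero_add, norm_smul, Real.norm_eq_abs]
      exact mul_le_of_le_one_left (norm_nonneg _) hs1
    · simp only [smul_zero, zero_add, Complex.smul_im, smul_eq_mul, abs_mul]
      exact mul_le_of_le_one_left (abs_nonneg _) hs1

lemma norm_sin_le (w : ℂ) : ‖Complex.sin w‖ ≤ Real.exp |w.im| * ‖w‖ := by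
  simpa using norm_image_sub_le_of_segment (w := w) Complex.hasDerivAt_sin
    fun z _ h2 => (norm_cos_le_exp z).trans (Real.exp_le_exp.mpr h2)

lemma norm_cos_sub_one_le (w : ℂ) : ‖Complex.cos w - 1‖ ≤ Real.exp |w.im| * ‖w‖ ^ 2 := by
  have := norm_image_sub_le_of_segment (w := w) (B := Real.exp |w.im| * ‖w‖) Complex.hasDerivAt_cos
    fun z h1 h2 => by
      rw [norm_neg]
      refine (norm_sin_le z).trans ?_
      gcongr
  rw [Complex.cos_zero] at this
  linarith [this, (by ring : Real.exp |w.im| * ‖w‖ * ‖w‖ = Real.exp |w.im| * ‖w‖ ^ 2)]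

/-- The third order zero compensates the `k⁻³` singularity of the folded `θ` integrand at `k = 0`.
-/
lemma norm_sin_sub_self_le (w : ℂ) : ‖Complex.sin w - w‖ ≤ Real.exp |w.im| * ‖w‖ ^ 3 := by
  have := norm_image_sub_le_of_segment (w := w) (B := Real.exp |w.im| * ‖w‖ ^ 2)
    (f := fun z => Complex.sin z - z) (f' := fun z => Complex.cos z - 1)
    (fun z => (Complex.hasDerivAt_sin z).sub (hasDerivAt_id z))
    fun z h1 h2 => by
      refine (norm_cos_sub_one_le z).trans ?_
      gcongr
  simp only [Complex.sin_zero, sub_zero] at this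
  linarith [this, (by ring : Real.exp |w.im| * ‖w‖ ^ 2 * ‖w‖ = Real.exp |w.im| * ‖w‖ ^ 3)]

/-- The weight `g_γ(k) / (cosh(2k) - 1)`. -/
def thetaWeight (γ k : ℝ) : ℝ := gFun γ k / (Real.cosh (2 * k) - 1)

lemma continuous_gFun (γ : ℝ) : Continuous (gFun γ) := by unfold gFun; fun_prop

lemma gFun_neg (γ k : ℝ) : gFun γ (-k) = gFun γ k := by simp [gFun]

lemma thetaWeight_neg (γ k : ℝ) : thetaWeight γ (-k) = thetaWeight γ k := by
  simp [thetaWeight, gFun_neg]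

lemma cosh_two_mul_sub_one (k : ℝ) : Real.cosh (2 * k) - 1 = 2 * Real.sinh k ^ 2 := by
  rw [Real.cosh_two_mul, Real.cosh_sq]; ring

lemma two_div_mem {γ : ℝ} (hγ : 2 < γ) : 0 < 2 / γ ∧ 2 / γ < 1 :=
  ⟨by positivity, by rw [div_lt_one (by linarith)]; exact hγ⟩

lemma gFun_nonneg {γ : ℝ} (hγ : 2 < γ) (k : ℝ) : 0 ≤ gFun γ k := by
  obtain ⟨h0, h1⟩ := two_div_mem hγ
  unfold gFun
  refine mul_nonneg Real.pi_pos.le ?_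
  have : Real.exp (-(4 - 2 / γ) * |k|) ≤ Real.exp (-(2 / γ) * |k|) := by
    refine Real.exp_le_exp.mpr (mul_le_mul_of_nonneg_right (by linarith) (abs_nonneg _))
  have := Real.exp_pos (-(2 - 2 / γ) * |k|)
  linarith

lemma gFun_le {γ : ℝ} (hγ : 2 < γ) (k : ℝ) : gFun γ k ≤ 3 * Real.pi := by
  obtain ⟨h0, h1⟩ := two_div_mem hγ
  unfold gFun
  have e1 : Real.exp (-(2 - 2 / γ) * |k|) ≤ 1 :=
    Real.exp_le_one_iff.mpr (mul_nonpos_of_nonpos_of_nonneg (by linarith) (abs_nonneg _))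
  have e2 : Real.exp (-(2 / γ) * |k|) ≤ 1 :=
    Real.exp_le_one_iff.mpr (mul_nonpos_of_nonpos_of_nonneg (by linarith) (abs_nonneg _))
  have e3 := Real.exp_pos (-(4 - 2 / γ) * |k|)
  nlinarith [Real.pi_pos]

/-- Equivalent to `1 + 2k ≤ e^{2k}`. It bounds `1/sinh k` for small and large `k` at once. -/
lemma exp_mul_le_sinh (k : ℝ) : Real.exp k * k ≤ (1 + 2 * k) * Real.sinh k := by
  rw [Real.sinh_eq]
  have h1 : (1 + 2 * k) * Real.exp (-k) ≤ Real.exp k := by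
    calc (1 + 2 * k) * Real.exp (-k) ≤ Real.exp (2 * k) * Real.exp (-k) := by
          gcongr; linarith [Real.add_one_le_exp (2 * k)]
      _ = Real.exp k := by rw [← Real.exp_add]; congr 1; ring
  linarith

lemma thetaWeight_nonneg {γ : ℝ} (hγ : 2 < γ) (k : ℝ) : 0 ≤ thetaWeight γ k := by
  refine div_nonneg (gFun_nonneg hγ k) ?_
  rw [cosh_two_mul_sub_one]; positivity

/-- Decay of the weight: `k² g_γ(k)/(cosh(2k) - 1) = O(e^{-(2-ε)|k|})`. -/
lemma exists_thetaWeight_bound {γ : ℝ} (hγ : 2 < γ) {ε : ℝ} (hε : 0 < ε) :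
    ∃ D, 0 ≤ D ∧ ∀ k : ℝ, k ^ 2 * thetaWeight γ k ≤ D * Real.exp (-(2 - ε) * |k|) := by
  refine ⟨3 * Real.pi / 2 * (1 + 4 / ε) ^ 2, by positivity, ?_⟩
  have main : ∀ k : ℝ, 0 < k → k ^ 2 * thetaWeight γ k
      ≤ 3 * Real.pi / 2 * (1 + 4 / ε) ^ 2 * Real.exp (-(2 - ε) * k) := by
    intro k hk
    have hs : 0 < Real.sinh k := Real.sinh_pos_iff.mpr hk
    have h1 : k ≤ (1 + 4 / ε) * Real.exp (ε / 2 * k) * Real.exp (-k) * Real.sinh k := by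
      -- The polynomial factor is absorbed by `e^{εk/2}` at the price of the constant `1 + 4/ε`;
      -- squaring produces the loss `ε` in the exponent.
      have e1 : 1 + 2 * k ≤ (1 + 4 / ε) * Real.exp (ε / 2 * k) := by
        calc 1 + 2 * k ≤ (1 + 4 / ε) * (ε / 2 * k + 1) := by
              have : (1 + 4 / ε) * (ε / 2 * k + 1) = 1 + 2 * k + ε / 2 * k + 4 / ε := by
                field_simp; ring
              rw [this]
              have : 0 < ε / 2 * k + 4 / ε := by positivity
              linarith
          _ ≤ _ := by gcongr; exact Real.add_one_le_exp _
      calc k = Real.exp (-k) * (Real.exp k * k) := by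
            rw [← mul_assoc, ← Real.exp_add]; simp
        _ ≤ Real.exp (-k) * ((1 + 2 * k) * Real.sinh k) := 
            mul_le_mul_of_nonneg_left (exp_mul_le_sinh k) (Real.exp_pos _).le
        _ ≤ Real.exp (-k) * ((1 + 4 / ε) * Real.exp (ε / 2 * k) * Real.sinh k) := by gcongr
        _ = _ := by ring
    rw [thetaWeight, cosh_two_mul_sub_one, mul_div_assoc', div_le_iff₀ (by positivity)]
    calc k ^ 2 * gFun γ k ≤ ((1 + 4 / ε) * Real.exp (ε / 2 * k) * Real.exp (-k) * Real.sinh k) ^ 2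
          * (3 * Real.pi) := by
          gcongr
          · exact gFun_nonneg hγ k
          · exact gFun_le hγ k
      _ = 3 * Real.pi / 2 * (1 + 4 / ε) ^ 2 * (Real.exp (ε / 2 * k) * Real.exp (-k)) ^ 2
          * (2 * Real.sinh k ^ 2) := by ring
      _ = _ := by
          rw [← Real.exp_add, ← Real.exp_nat_mul]
          congr 3; push_cast; ring
  intro k
  rcases lt_trichotomy k 0 with hk | rfl | hk
  · have := main (-k) (by linarith)
    rwa [thetaWeight_neg, neg_sq, ← abs_of_neg hk] at this
  · simp; positivity
  · rw [abs_of_pos hk]; exact main k hk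

lemma measurable_thetaWeight (γ : ℝ) : Measurable (thetaWeight γ) := by
  unfold thetaWeight
  exact (continuous_gFun γ).measurable.div (by fun_prop)

/-- The integrand `g_γ(k) (sin(zk) - zk) / (k (cosh(2k) - 1))` on the half line. -/
def thetaKernel (γ : ℝ) (z : ℂ) (k : ℝ) : ℂ :=
  (thetaWeight γ k : ℂ) * ((Complex.sin (z * k) - z * k) / k)

lemma measurable_thetaKernel (γ : ℝ) (z : ℂ) : Measurable (thetaKernel γ z) := by
  unfold thetaKernel
  refine (Complex.measurable_ofReal.comp (measurable_thetaWeight γ)).mul ?_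
  have h1 : Continuous fun k : ℝ => Complex.sin (z * k) - z * k := by fun_prop
  exact h1.measurable.div Complex.measurable_ofReal

lemma norm_thetaKernel_le {γ : ℝ} (hγ : 2 < γ) {ε D : ℝ}
    (hD : ∀ k : ℝ, k ^ 2 * thetaWeight γ k ≤ D * Real.exp (-(2 - ε) * |k|)) (z : ℂ) (k : ℝ) :
    ‖thetaKernel γ z k‖ ≤ ‖z‖ ^ 3 * D * Real.exp (-(2 - ε - |z.im|) * |k|) := by
  have him : |(z * k).im| = |z.im| * |k| := by simp [abs_mul]
  -- At `k = 0` the kernel is zero by the convention for division, so the bound holds for every `k`.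
  rcases eq_or_ne k 0 with rfl | hk
  · have := hD 0
    simp only [abs_zero, mul_zero, Real.exp_zero, mul_one] at this ⊢
    simp only [thetaKernel, Complex.ofReal_zero, div_zero, mul_zero, norm_zero]
    have : 0 ≤ D := by simpa using this
    positivity
  rw [thetaKernel, norm_mul, norm_div, Complex.norm_real, Complex.norm_real,
    Real.norm_of_nonneg (thetaWeight_nonneg hγ k), Real.norm_eq_abs]
  have h1 := norm_sin_sub_self_le (z * k)
  rw [him, norm_mul, Complex.norm_real, Real.norm_eq_abs] at h1
  have hk' : 0 < |k| := abs_pos.mpr hk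
  calc _ ≤ thetaWeight γ k * (Real.exp (|z.im| * |k|) * (‖z‖ * |k|) ^ 3 / |k|) := by
        gcongr
        exact thetaWeight_nonneg hγ k
    _ = ‖z‖ ^ 3 * (k ^ 2 * thetaWeight γ k) * Real.exp (|z.im| * |k|) := by
        rw [← sq_abs k]; field_simp
    _ ≤ ‖z‖ ^ 3 * (D * Real.exp (-(2 - ε) * |k|)) * Real.exp (|z.im| * |k|) := by
        gcongr ‖z‖ ^ 3 * ?_ * _
        exact hD k
    _ = _ := by
        rw [mul_assoc, mul_assoc, ← Real.exp_add, ← mul_assoc]; congr 2; ring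

lemma integrable_thetaKernel {γ : ℝ} (hγ : 2 < γ) {z : ℂ} (hz : |z.im| < 2) :
    Integrable (thetaKernel γ z) volume := by
  obtain ⟨D, -, hD⟩ := exists_thetaWeight_bound hγ (by linarith : 0 < (2 - |z.im|) / 2)
  exact integrable_of_exp_bound (measurable_thetaKernel γ z).aestronglyMeasurable
    (by linarith) (norm_thetaKernel_le hγ hD z)

lemma thetaIntegrand_eq (γ : ℝ) (z : ℂ) (k : ℝ) :
    thetaIntegrand γ z k = (thetaWeight γ k : ℂ) *
      ((Complex.exp (Complex.I * z * k) - Complex.I * z * k) / k) := by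
  rw [thetaIntegrand, thetaWeight]
  push_cast
  rw [div_mul_div_comm, mul_comm (k : ℂ)]

/-- The weight is even and the denominator `k` odd, so folding `k` with `-k` kills the even part of
the exponential, which carries the singularity `1/k³`, and leaves the integrable `sin(zk) - zk`.
This is why the principal value exists. -/
lemma thetaIntegrand_add_neg (γ : ℝ) (z : ℂ) (k : ℝ) :
    thetaIntegrand γ z k + thetaIntegrand γ z (-k) = 2 * Complex.I * thetaKernel γ z k := by
  rw [thetaIntegrand_eq, thetaIntegrand_eq, thetaWeight_neg, thetaKernel, Complex.sin]
  push_cast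
  have e1 : Complex.I * z * -(k : ℂ) = -(z * k) * Complex.I := by ring
  have e2 : Complex.I * z * (k : ℂ) = z * k * Complex.I := by ring
  rw [e1, e2, div_neg]
  have hI : Complex.I * Complex.I = -1 := Complex.I_mul_I
  linear_combination (-(thetaWeight γ k : ℂ) * (Complex.exp (-(z * k) * Complex.I) -
    Complex.exp (z * k * Complex.I)) / k) * hI

lemma integrableOn_thetaIntegrand {γ : ℝ} (hγ : 2 < γ) {z : ℂ} (hz : |z.im| < 2) {ε : ℝ}
    (hε : 0 < ε) : IntegrableOn (thetaIntegrand γ z) {k : ℝ | ε ≤ |k|} volume := by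
  -- The weight decays like `e^{-(2-η)|k|}`, while both `e^{izk}` and the linear term are bounded by
  -- multiples of `e^{(2-2η)|k|}` (the latter since `η ≤ 1/2`); a factor `e^{-η|k|}` remains.
  set η := (2 - |z.im|) / 4 with hη
  have hη0 : 0 < η := by linarith
  have hη1 : η ≤ 1 / 2 := by linarith [abs_nonneg z.im]
  obtain ⟨D, hD0, hD⟩ := exists_thetaWeight_bound hγ hη0
  have hmeas : Measurable (thetaIntegrand γ z) := by
    have : thetaIntegrand γ z = fun k => (thetaWeight γ k : ℂ) *
      ((Complex.exp (Complex.I * z * k) - Complex.I * z * k) / k) := funext (thetaIntegrand_eq γ z)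
    rw [this]
    refine (Complex.measurable_ofReal.comp (measurable_thetaWeight γ)).mul ?_
    have h1 : Continuous fun k : ℝ => Complex.exp (Complex.I * z * k) - Complex.I * z * k := by
      fun_prop
    exact h1.measurable.div Complex.measurable_ofReal
  have hset : MeasurableSet {k : ℝ | ε ≤ |k|} := measurableSet_le measurable_const (by fun_prop)
  refine Integrable.mono' (g := fun k => (ε ^ 3)⁻¹ * D * (1 + ‖z‖) * Real.exp (-η * |k|))
    (((integrable_exp_neg_mul_abs hη0).const_mul _).integrableOn) hmeas.aestronglyMeasurable ?_
  filter_upwards [ae_restrict_mem hset] with k hk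
  have hk : ε ≤ |k| := hk
  have hk' : 0 < |k| := hε.trans_le hk
  rw [thetaIntegrand_eq, norm_mul, norm_div, Complex.norm_real, Complex.norm_real,
    Real.norm_of_nonneg (thetaWeight_nonneg hγ k), Real.norm_eq_abs]
  have h1 : ‖Complex.exp (Complex.I * z * k) - Complex.I * z * k‖
      ≤ (1 + ‖z‖) * Real.exp ((2 - 2 * η) * |k|) := by
    refine (norm_sub_le _ _).trans ?_
    rw [add_mul, one_mul]
    refine add_le_add ?_ ?_
    · refine (norm_exp_le_exp_abs_re _).trans (Real.exp_le_exp.mpr ?_)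
      have : |(Complex.I * z * k).re| = |z.im| * |k| := by simp [abs_mul]
      rw [this]
      gcongr
      linarith
    · rw [norm_mul, norm_mul, Complex.norm_I, one_mul, Complex.norm_real, Real.norm_eq_abs]
      gcongr
      calc |k| ≤ Real.exp |k| := by linarith [Real.add_one_le_exp |k|]
        _ ≤ _ := Real.exp_le_exp.mpr (by nlinarith)
  calc _ ≤ thetaWeight γ k * ((1 + ‖z‖) * Real.exp ((2 - 2 * η) * |k|) / |k|) := by
        gcongr
        exact thetaWeight_nonneg hγ k
    _ = (|k| ^ 3)⁻¹ * (k ^ 2 * thetaWeight γ k) * (1 + ‖z‖) * Real.exp ((2 - 2 * η) * |k|) := by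
        rw [← sq_abs k]; field_simp
    _ ≤ (ε ^ 3)⁻¹ * (D * Real.exp (-(2 - η) * |k|)) * (1 + ‖z‖) * Real.exp ((2 - 2 * η) * |k|) := by
        have := thetaWeight_nonneg hγ k
        have := hD k
        gcongr ?_ * ?_ * _ * _
        gcongr
    _ = (ε ^ 3)⁻¹ * D * (1 + ‖z‖) * (Real.exp (-(2 - η) * |k|) * Real.exp ((2 - 2 * η) * |k|)) := by
        ring
    _ = _ := by
        rw [← Real.exp_add]; congr 2; ring

/-- The value of the principal value integral. -/
def thetaInt (γ : ℝ) (z : ℂ) : ℂ :=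
  Complex.I / Real.pi * ∫ k in Set.Ioi (0 : ℝ), thetaKernel γ z k

lemma thetaTrunc_eq {γ : ℝ} (hγ : 2 < γ) {z : ℂ} (hz : |z.im| < 2) {ε : ℝ} (hε : 0 < ε) :
    thetaTrunc γ z ε = Complex.I / Real.pi * ∫ k in Set.Ioi ε, thetaKernel γ z k := by
  have hset : {k : ℝ | ε ≤ |k|} = Set.Iic (-ε) ∪ Set.Ici ε := by
    ext k
    simp only [Set.mem_ofPred_eq, Set.mem_union, Set.mem_Iic, Set.mem_Ici, le_abs]
    constructor
    · rintro (h | h)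
      · exact Or.inr h
      · exact Or.inl (by linarith)
    · rintro (h | h)
      · exact Or.inr (by linarith)
      · exact Or.inl h
  have hInt := integrableOn_thetaIntegrand hγ hz hε
  rw [hset] at hInt
  have hdisj : Disjoint (Set.Iic (-ε)) (Set.Ici ε) := by
    rw [Set.disjoint_left]
    intro k hk hk'
    have h1 : k ≤ -ε := hk
    have h2 : ε ≤ k := hk'
    linarith
  have hneg : IntegrableOn (fun k => thetaIntegrand γ z (-k)) (Set.Ioi ε) := by
    have := hInt.left_of_union
    have h2 := (integrableOn_Ici_iff_integrableOn_Ioi (f := fun k => thetaIntegrand γ z (-k))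
      (b := ε) (μ := volume)).mp
    refine h2 ?_
    simpa using this.comp_neg
  rw [thetaTrunc, hset, setIntegral_union hdisj measurableSet_Ici hInt.left_of_union
    hInt.right_of_union, integral_Ici_eq_integral_Ioi]
  have e : ∫ k in Set.Iic (-ε), thetaIntegrand γ z k
      = ∫ k in Set.Ioi ε, thetaIntegrand γ z (-k) := by
    rw [integral_comp_neg_Ioi]
  rw [e, add_comm, ← integral_add (hInt.right_of_union.mono_set Set.Ioi_subset_Ici_self) hneg]
  simp only [thetaIntegrand_add_neg]
  rw [integral_const_mul]
  have : (Real.pi : ℂ) ≠ 0 := by exact_mod_cast Real.pi_ne_zero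
  push_cast
  field_simp

lemma tendsto_thetaTrunc_thetaInt {γ : ℝ} (hγ : 2 < γ) {z : ℂ} (hz : |z.im| < 2) :
    Tendsto (thetaTrunc γ z) (𝓝[>] (0 : ℝ)) (𝓝 (thetaInt γ z)) := by
  have hcov : AECover (volume.restrict (Set.Ioi (0 : ℝ))) (𝓝[>] (0 : ℝ)) fun ε : ℝ => Set.Ioi ε :=
    aecover_Ioi_of_Ioi nhdsWithin_le_nhds
  have := hcov.integral_tendsto_of_countably_generated (integrable_thetaKernel hγ hz).integrableOn
  have h2 := this.const_mul (Complex.I / Real.pi)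
  refine h2.congr' ?_
  filter_upwards [self_mem_nhdsWithin] with ε hε
  have hε : 0 < ε := hε
  rw [thetaTrunc_eq hγ hz hε, Measure.restrict_restrict measurableSet_Ioi,
    Set.inter_eq_left.mpr (Set.Ioi_subset_Ioi hε.le)]

lemma theta_eq {γ : ℝ} (hγ : 2 < γ) {z : ℂ} (hz : |z.im| < 2) : theta γ z = thetaInt γ z :=
  (tendsto_thetaTrunc_thetaInt hγ hz).limUnder_eq

/-! ### Sine transforms -/

lemma integral_sin_mul_exp_neg {a : ℝ} (ha : 0 < a) (x : ℝ) :
    ∫ k in Set.Ioi (0 : ℝ), Real.sin (x * k) * Real.exp (-a * k) = x / (x ^ 2 + a ^ 2) := by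
  have hre : (((-a : ℝ) : ℂ) + x * Complex.I).re < 0 := by simpa using ha
  have h := integral_exp_mul_complex_Ioi hre 0
  have hi := integrableOn_exp_mul_complex_Ioi hre 0
  have h2 := congrArg Complex.im h
  have h3 : (∫ k in Set.Ioi (0 : ℝ), Complex.exp ((((-a : ℝ) : ℂ) + x * Complex.I) * k)).im
      = ∫ k in Set.Ioi (0 : ℝ), (Complex.exp ((((-a : ℝ) : ℂ) + x * Complex.I) * k)).im :=
    (integral_im hi).symm
  rw [h3] at h2
  have e : ∀ k : ℝ, (Complex.exp ((((-a : ℝ) : ℂ) + x * Complex.I) * k)).im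
      = Real.sin (x * k) * Real.exp (-a * k) := fun k => by
    rw [Complex.exp_im]
    simp [mul_comm]
  simp only [e] at h2
  rw [h2]
  simp only [Complex.ofReal_zero, mul_zero, Complex.exp_zero, Complex.div_im, Complex.neg_re,
    Complex.one_re, Complex.neg_im, Complex.one_im, Complex.normSq_apply]
  simp
  rw [neg_div, neg_neg]
  congr 1
  ring

lemma integrableOn_mul_exp_neg {a : ℝ} (ha : 0 < a) :
    IntegrableOn (fun k : ℝ => k * Real.exp (-a * k)) (Set.Ioi 0) := by
  have := integrableOn_rpow_mul_exp_neg_mul_rpow (p := 1) (s := 1) (b := a) (by norm_num)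
    one_pos ha
  simpa using this

lemma integral_mul_exp_neg {a : ℝ} (ha : 0 < a) :
    ∫ k in Set.Ioi (0 : ℝ), k * Real.exp (-a * k) = 1 / a ^ 2 := by
  have := Real.integral_rpow_mul_exp_neg_mul_Ioi (a := 2) (r := a) (by norm_num) ha
  rw [Real.Gamma_two, mul_one] at this
  norm_num at this
  simpa using this

lemma integrableOn_sin_mul_exp_neg {a : ℝ} (ha : 0 < a) (x : ℝ) :
    IntegrableOn (fun k : ℝ => Real.sin (x * k) * Real.exp (-a * k)) (Set.Ioi 0) := by
  refine (integrableOn_exp_mul_Ioi (by linarith : -a < 0) 0).mono'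
    (by fun_prop) (Eventually.of_forall fun k => ?_)
  rw [norm_mul, Real.norm_of_nonneg (Real.exp_pos _).le]
  exact mul_le_of_le_one_left (Real.exp_pos _).le (Real.abs_sin_le_one _)

/-- Expansion of `∫ sin(xk) e^{-ak} / (1 - e^{-2k}) dk` in partial fractions. -/
lemma hasSum_integral_sin {a : ℝ} (ha : 0 < a) (ha' : a ≤ 2) (x : ℝ) :
    HasSum (fun n : ℕ => x / (x ^ 2 + (2 * n + a) ^ 2))
      (∫ k in Set.Ioi (0 : ℝ), Real.sin (x * k) * Real.exp (-a * k) / (1 - Real.exp (-2 * k))) := by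
  have hpos : ∀ n : ℕ, 0 < 2 * (n : ℝ) + a := fun n => by positivity
  have hsum : Summable fun n : ℕ =>
      ∫ k in Set.Ioi (0 : ℝ), ‖Real.sin (x * k) * Real.exp (-(2 * n + a) * k)‖ := by
    have h0 : Summable fun n : ℕ => |x| * ((2 / a) ^ 2 * (1 / ((n : ℝ) + 1) ^ 2)) := by
      have := (summable_nat_add_iff 1).mpr (Real.summable_one_div_nat_pow.mpr (one_lt_two))
      refine (Summable.mul_left _ ?_).mul_left _
      simpa using this
    refine Summable.of_nonneg_of_le (fun n => integral_nonneg fun k => norm_nonneg _)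
      (fun n => ?_) h0
    -- Bounding `|sin(xk)|` by `|x|k` instead of `1` gives `1/(2n + a)²`, which is summable, in
    -- place of `1/(2n + a)`, which is not.
    calc _ ≤ ∫ k in Set.Ioi (0 : ℝ), |x| * (k * Real.exp (-(2 * n + a) * k)) := by
          refine setIntegral_mono_on (integrableOn_sin_mul_exp_neg (hpos n) x).norm
            ((integrableOn_mul_exp_neg (hpos n)).const_mul _) measurableSet_Ioi fun k hk => ?_
          rw [norm_mul, Real.norm_of_nonneg (Real.exp_pos _).le, ← mul_assoc]
          gcongr
          have hk : 0 < k := hk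
          calc ‖Real.sin (x * k)‖ ≤ |x * k| := Real.abs_sin_le_abs
            _ = |x| * k := by rw [abs_mul, abs_of_pos hk]
      _ = |x| * (1 / (2 * n + a) ^ 2) := by
          rw [integral_const_mul, integral_mul_exp_neg (hpos n)]
      _ ≤ _ := by
          gcongr
          rw [← one_div_pow, ← one_div_pow, ← mul_pow]
          gcongr
          rw [div_mul_div_comm, div_le_div_iff₀ (hpos n) (by positivity)]
          nlinarith [(Nat.cast_nonneg n : (0 : ℝ) ≤ n)]
  have := hasSum_integral_of_summable_integral_norm (μ := volume.restrict (Set.Ioi (0 : ℝ)))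
    (F := fun (n : ℕ) (k : ℝ) => Real.sin (x * k) * Real.exp (-(2 * n + a) * k))
    (fun n : ℕ => (integrableOn_sin_mul_exp_neg (hpos n) x)) hsum
  simp only [integral_sin_mul_exp_neg (hpos _)] at this
  have e : (∫ k in Set.Ioi (0 : ℝ), Real.sin (x * k) * Real.exp (-a * k) / (1 - Real.exp (-2 * k)))
      = ∫ k in Set.Ioi (0 : ℝ), ∑' n : ℕ, Real.sin (x * k) * Real.exp (-(2 * n + a) * k) := ?_
  · rw [e]; exact this
  refine setIntegral_congr_fun measurableSet_Ioi fun k hk => ?_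
  have hk : 0 < k := hk
  have hr : Real.exp (-2 * k) < 1 := Real.exp_lt_one_iff.mpr (by linarith)
  have hgeo := (hasSum_geometric_of_lt_one (Real.exp_pos (-2 * k)).le hr).mul_left
    (Real.sin (x * k) * Real.exp (-a * k))
  rw [div_eq_mul_inv, ← hgeo.tsum_eq]
  congr 1
  funext n
  rw [← Real.exp_nat_mul, mul_assoc, ← Real.exp_add]
  congr 2
  ring

lemma integrableOn_sin_div {a : ℝ} (ha : 0 < a) (x : ℝ) :
    IntegrableOn (fun k : ℝ => Real.sin (x * k) * Real.exp (-a * k) / (1 - Real.exp (-2 * k)))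
      (Set.Ioi 0) := by
  refine Integrable.mono' (g := fun k => |x| * (Real.exp (-a * k) + k * Real.exp (-a * k)))
    (((integrableOn_exp_mul_Ioi (by linarith : -a < 0) 0).add
      (integrableOn_mul_exp_neg ha)).const_mul _) ?_ ?_
  · refine Measurable.aestronglyMeasurable ?_
    fun_prop
  · filter_upwards [ae_restrict_mem measurableSet_Ioi] with k hk
    have hk : 0 < k := hk
    have hr : 0 < 1 - Real.exp (-2 * k) := by
      have := Real.exp_lt_one_iff.mpr (by linarith : -2 * k < 0); linarith
    have h1 : k ≤ (1 + k) * (1 - Real.exp (-2 * k)) := by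
      have h2 : Real.exp (-2 * k) * (1 + k) ≤ 1 := by
        calc Real.exp (-2 * k) * (1 + k) ≤ Real.exp (-k) * Real.exp k := by
              gcongr
              · linarith
              · linarith [Real.add_one_le_exp k]
          _ = 1 := by rw [← Real.exp_add]; simp
      linarith
    rw [norm_div, norm_mul, Real.norm_of_nonneg (Real.exp_pos _).le, Real.norm_of_nonneg hr.le,
      div_le_iff₀ hr]
    calc ‖Real.sin (x * k)‖ * Real.exp (-a * k) ≤ (|x| * k) * Real.exp (-a * k) := by
          gcongr
          calc ‖Real.sin (x * k)‖ ≤ |x * k| := Real.abs_sin_le_abs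
            _ = |x| * k := by rw [abs_mul, abs_of_pos hk]
      _ ≤ (|x| * ((1 + k) * (1 - Real.exp (-2 * k)))) * Real.exp (-a * k) := by gcongr
      _ = _ := by ring

lemma cosh_add_cos_pos {t : ℝ} (h1 : 0 < t) (h2 : t < 1) (x : ℝ) :
    0 < Real.cosh (Real.pi * x) + Real.cos (Real.pi * t) := by
  have e1 := Real.one_le_cosh (Real.pi * x)
  have e2 : Real.cos Real.pi < Real.cos (Real.pi * t) :=
    Real.cos_lt_cos_of_nonneg_of_le_pi (by positivity) le_rfl (by nlinarith [Real.pi_pos])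
  rw [Real.cos_pi] at e2
  linarith

/-- With `A = π(1 - t)/2` and `B = πx/2`, the imaginary part of `cot(A - iB)` is `sinh B cosh B /
(sin² A + sinh² B)`; the double angle formulas then give the quotient. -/
lemma im_cot_eq {t : ℝ} (h1 : 0 < t) (h2 : t < 1) (x : ℝ) :
    (Complex.cot (Real.pi * (((1 - t : ℝ) - x * Complex.I) / 2))).im
      = Real.sinh (Real.pi * x) / (Real.cosh (Real.pi * x) + Real.cos (Real.pi * t)) := by
  set A := Real.pi * (1 - t) / 2 with hA
  set B := Real.pi * x / 2 with hB
  have hw : (Real.pi : ℂ) * (((1 - t : ℝ) - x * Complex.I) / 2)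
      = ((A : ℝ) : ℂ) + ((-B : ℝ) : ℂ) * Complex.I := by
    rw [hA, hB]; push_cast; ring
  have hs : Complex.sin (((A : ℝ) : ℂ) + ((-B : ℝ) : ℂ) * Complex.I)
      = ((Real.sin A * Real.cosh B : ℝ) : ℂ) + ((-(Real.cos A * Real.sinh B) : ℝ) : ℂ) * Complex.I := by
    rw [Complex.sin_add_mul_I]; push_cast; rw [Complex.cosh_neg, Complex.sinh_neg]; ring
  have hc : Complex.cos (((A : ℝ) : ℂ) + ((-B : ℝ) : ℂ) * Complex.I)
      = ((Real.cos A * Real.cosh B : ℝ) : ℂ) + ((Real.sin A * Real.sinh B : ℝ) : ℂ) * Complex.I := by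
    rw [Complex.cos_add_mul_I]; push_cast; rw [Complex.cosh_neg, Complex.sinh_neg]; ring
  have hsA : 0 < Real.sin A := Real.sin_pos_of_pos_of_lt_pi
    (by have := Real.pi_pos; have : 0 < 1 - t := by linarith
        positivity) (by nlinarith [Real.pi_pos])
  have hden : Real.cosh (Real.pi * x) + Real.cos (Real.pi * t)
      = 2 * (Real.sin A ^ 2 + Real.sinh B ^ 2) := by
    have e1 : Real.pi * x = 2 * B := by rw [hB]; ring
    have e2 : Real.pi * t = Real.pi - 2 * A := by rw [hA]; ring
    rw [e1, e2, Real.cos_pi_sub, Real.cosh_two_mul, Real.cos_two_mul, Real.cosh_sq, Real.cos_sq']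
    ring
  have hnum : Real.sinh (Real.pi * x) = 2 * (Real.sinh B * Real.cosh B) := by
    have e1 : Real.pi * x = 2 * B := by rw [hB]; ring
    rw [e1, Real.sinh_two_mul]; ring
  rw [hw, Complex.cot, hs, hc, hden, hnum, Complex.div_im]
  simp only [Complex.normSq_add_mul_I, Complex.add_re, Complex.add_im, Complex.ofReal_re,
    Complex.ofReal_im, Complex.re_ofReal_mul, Complex.im_ofReal_mul, Complex.I_re, Complex.I_im,
    mul_zero, mul_one, add_zero, zero_add]
  have hn : (Real.sin A * Real.cosh B) ^ 2 + (-(Real.cos A * Real.sinh B)) ^ 2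
      = Real.sin A ^ 2 + Real.sinh B ^ 2 := by
    linear_combination Real.sin A ^ 2 * Real.cosh_sq B + Real.sinh B ^ 2 * Real.sin_sq_add_cos_sq A
  have hpos : 0 < Real.sin A ^ 2 + Real.sinh B ^ 2 := by positivity
  rw [hn]
  field_simp
  linear_combination Real.sinh B * Real.sin_sq_add_cos_sq A

lemma im_one_div (p q : ℝ) : (1 / (((p : ℂ) - q * Complex.I) / 2)).im = 2 * (q / (q ^ 2 + p ^ 2)) := by
  rw [one_div_div, Complex.div_im]
  simp [Complex.normSq_apply]
  ring

/-- Since `1/sinh k = 2e^{-k}/(1 - e^{-2k})`, the two exponentials of `cosh(tk)` lead to geometric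
series with `a = 1 - t` and `a = 1 + t`. -/
lemma sin_mul_cosh_div_sinh_eq (t x : ℝ) {k : ℝ} (hk : 0 < k) :
    Real.sin (x * k) * Real.cosh (t * k) / Real.sinh k
      = Real.sin (x * k) * Real.exp (-(1 - t) * k) / (1 - Real.exp (-2 * k))
        + Real.sin (x * k) * Real.exp (-(1 + t) * k) / (1 - Real.exp (-2 * k)) := by
  have hr : 0 < 1 - Real.exp (-2 * k) := by
    have := Real.exp_lt_one_iff.mpr (by linarith : -2 * k < 0); linarith
  have hsk : Real.sinh k ≠ 0 := (Real.sinh_pos_iff.mpr hk).ne'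
  have e0 : 2 * Real.sinh k * Real.exp (-k) = 1 - Real.exp (-2 * k) := by
    rw [Real.sinh_eq]
    have : Real.exp k * Real.exp (-k) = 1 := by rw [← Real.exp_add]; simp
    have h' : Real.exp (-k) * Real.exp (-k) = Real.exp (-2 * k) := by
      rw [← Real.exp_add]; congr 1; ring
    linear_combination this - h'
  have e1 : Real.exp (-(1 - t) * k) + Real.exp (-(1 + t) * k)
      = 2 * Real.cosh (t * k) * Real.exp (-k) := by
    rw [Real.cosh_eq]
    have u1 : Real.exp (-(1 - t) * k) = Real.exp (t * k) * Real.exp (-k) := by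
      rw [← Real.exp_add]; congr 1; ring
    have u2 : Real.exp (-(1 + t) * k) = Real.exp (-(t * k)) * Real.exp (-k) := by
      rw [← Real.exp_add]; congr 1; ring
    rw [u1, u2]; ring
  rw [← add_div, ← mul_add, e1, ← e0]
  have := (Real.exp_pos (-k)).ne'
  field_simp

lemma integrableOn_sin_mul_cosh_div_sinh {t : ℝ} (h1 : 0 < t) (h2 : t < 1) (x : ℝ) :
    IntegrableOn (fun k : ℝ => Real.sin (x * k) * Real.cosh (t * k) / Real.sinh k)
      (Set.Ioi 0) := by
  refine ((integrableOn_sin_div (by linarith : 0 < 1 - t) x).add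
    (integrableOn_sin_div (by linarith : 0 < 1 + t) x)).congr_fun (fun k hk => ?_) measurableSet_Ioi
  exact (sin_mul_cosh_div_sinh_eq t x hk).symm

/-- The sine transform of `cosh(tk)/sinh(k)`. -/
lemma integral_sin_mul_cosh_div_sinh {t : ℝ} (h1 : 0 < t) (h2 : t < 1) (x : ℝ) :
    ∫ k in Set.Ioi (0 : ℝ), Real.sin (x * k) * Real.cosh (t * k) / Real.sinh k
      = Real.pi / 2 * (Real.sinh (Real.pi * x) /
        (Real.cosh (Real.pi * x) + Real.cos (Real.pi * t))) := by
  have ha := hasSum_integral_sin (by linarith : 0 < 1 - t) (by linarith) x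
  have hb := hasSum_integral_sin (by linarith : 0 < 1 + t) (by linarith) x
  -- At this point the imaginary parts of `1/(Z - (n+1))` and `1/(Z + (n+1))` are twice the partial
  -- fractions for `a = 1 + t` and `a = 1 - t`, so both series are summed by the cotangent
  -- expansion.
  set Z : ℂ := ((1 - t : ℝ) - x * Complex.I) / 2 with hZ
  have hZre : Z.re = (1 - t) / 2 := by simp [hZ]
  have hZmem : Z ∈ Complex.integerComplement := by
    rintro ⟨n, hn⟩
    have := congrArg Complex.re hn
    rw [hZre, Complex.intCast_re] at this
    have h3 : (0 : ℝ) < n := by rw [this]; linarith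
    have h4 : (n : ℝ) < 1 := by rw [this]; linarith
    have h3' : (0 : ℤ) < n := by exact_mod_cast h3
    have h4' : n < (1 : ℤ) := by exact_mod_cast h4
    omega
  have hcot : HasSum (fun n : ℕ => 1 / (Z - (n + 1)) + 1 / (Z + (n + 1)))
      (Real.pi * Complex.cot (Real.pi * Z) - 1 / Z) := by
    rw [cot_series_rep' hZmem]
    exact (summable_cotTerm hZmem).hasSum
  have him := Complex.hasSum_im hcot
  have hterm : ∀ n : ℕ, (1 / (Z - (n + 1)) + 1 / (Z + (n + 1))).im
      = 2 * (x / (x ^ 2 + (2 * n + (1 + t)) ^ 2))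
        + 2 * (x / (x ^ 2 + (2 * ((n + 1 : ℕ) : ℝ) + (1 - t)) ^ 2)) := by
    intro n
    have e1 : Z - (n + 1) = (((-(2 * n + (1 + t)) : ℝ) : ℂ) - x * Complex.I) / 2 := by
      rw [hZ]; push_cast; ring
    have e2 : Z + (n + 1) = (((2 * ((n + 1 : ℕ) : ℝ) + (1 - t) : ℝ) : ℂ) - x * Complex.I) / 2 := by
      rw [hZ]; push_cast; ring
    rw [Complex.add_im, e1, e2, im_one_div, im_one_div, neg_sq]
  simp only [hterm] at him
  -- The `n = 0` term for `a = 1 - t` corresponds to the separate `1/Z` of the expansion, so this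
  -- series is shifted by one.
  have ha1 := (hasSum_nat_add_iff' 1).mpr ha
  have hsum := (hb.mul_left 2).add (ha1.mul_left 2)
  have key := him.unique hsum
  rw [Complex.sub_im, Complex.im_ofReal_mul, im_cot_eq h1 h2, hZ, im_one_div] at key
  simp only [Finset.range_one, Finset.sum_singleton, Nat.cast_zero, mul_zero, zero_add] at key
  have hab : (∫ k in Set.Ioi (0 : ℝ), Real.sin (x * k) * Real.cosh (t * k) / Real.sinh k)
      = (∫ k in Set.Ioi (0 : ℝ),
          Real.sin (x * k) * Real.exp (-(1 - t) * k) / (1 - Real.exp (-2 * k)))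
        + ∫ k in Set.Ioi (0 : ℝ),
          Real.sin (x * k) * Real.exp (-(1 + t) * k) / (1 - Real.exp (-2 * k)) := by
    rw [← integral_add (integrableOn_sin_div (by linarith) x) (integrableOn_sin_div (by linarith) x)]
    exact setIntegral_congr_fun measurableSet_Ioi fun k hk => sin_mul_cosh_div_sinh_eq t x hk
  rw [hab]
  linarith

/-! ### Derivative and real part of the phase -/

/-- The integrand of the derivative of `θ_γ`. -/
def thetaDerivKernel (γ : ℝ) (z : ℂ) (k : ℝ) : ℂ :=
  (thetaWeight γ k : ℂ) * (Complex.cos (z * k) - 1)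

lemma measurable_thetaDerivKernel (γ : ℝ) (z : ℂ) : Measurable (thetaDerivKernel γ z) := by
  unfold thetaDerivKernel
  refine (Complex.measurable_ofReal.comp (measurable_thetaWeight γ)).mul ?_
  fun_prop

lemma norm_thetaDerivKernel_le {γ : ℝ} (hγ : 2 < γ) {ε D : ℝ}
    (hD : ∀ k : ℝ, k ^ 2 * thetaWeight γ k ≤ D * Real.exp (-(2 - ε) * |k|)) (z : ℂ) (k : ℝ) :
    ‖thetaDerivKernel γ z k‖ ≤ ‖z‖ ^ 2 * D * Real.exp (-(2 - ε - |z.im|) * |k|) := by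
  have him : |(z * k).im| = |z.im| * |k| := by simp [abs_mul]
  rw [thetaDerivKernel, norm_mul, Complex.norm_real,
    Real.norm_of_nonneg (thetaWeight_nonneg hγ k)]
  have h1 := norm_cos_sub_one_le (z * k)
  rw [him, norm_mul, Complex.norm_real, Real.norm_eq_abs] at h1
  calc _ ≤ thetaWeight γ k * (Real.exp (|z.im| * |k|) * (‖z‖ * |k|) ^ 2) := by
        gcongr
        exact thetaWeight_nonneg hγ k
    _ = ‖z‖ ^ 2 * (k ^ 2 * thetaWeight γ k) * Real.exp (|z.im| * |k|) := by
        rw [← sq_abs k]; ring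
    _ ≤ ‖z‖ ^ 2 * (D * Real.exp (-(2 - ε) * |k|)) * Real.exp (|z.im| * |k|) := by
        gcongr ‖z‖ ^ 2 * ?_ * _
        exact hD k
    _ = _ := by
        rw [mul_assoc, mul_assoc, ← Real.exp_add, ← mul_assoc]; congr 2; ring

lemma integrable_thetaDerivKernel {γ : ℝ} (hγ : 2 < γ) {z : ℂ} (hz : |z.im| < 2) :
    Integrable (thetaDerivKernel γ z) volume := by
  obtain ⟨D, -, hD⟩ := exists_thetaWeight_bound hγ (by linarith : 0 < (2 - |z.im|) / 2)
  exact integrable_of_exp_bound (measurable_thetaDerivKernel γ z).aestronglyMeasurable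
    (by linarith) (norm_thetaDerivKernel_le hγ hD z)

lemma hasDerivAt_thetaInt {γ : ℝ} (hγ : 2 < γ) {z : ℂ} (hz : |z.im| < 2) :
    HasDerivAt (thetaInt γ) (Complex.I / Real.pi * ∫ k in Set.Ioi (0 : ℝ), thetaDerivKernel γ z k)
      z := by
  set r := (2 - |z.im|) / 4 with hr
  have hr0 : 0 < r := by linarith
  obtain ⟨D, hD0, hD⟩ := exists_thetaWeight_bound hγ hr0
  have hball : ∀ w ∈ Metric.ball z r, |w.im| ≤ |z.im| + r ∧ ‖w‖ ≤ ‖z‖ + r := by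
    intro w hw
    rw [Metric.mem_ball, dist_eq_norm] at hw
    have e : w = z + (w - z) := by ring
    constructor
    · have := Complex.abs_im_le_norm (w - z)
      calc |w.im| = |z.im + (w - z).im| := by simp
        _ ≤ |z.im| + |(w - z).im| := abs_add_le _ _
        _ ≤ _ := by linarith
    · calc ‖w‖ = ‖z + (w - z)‖ := by rw [← e]
        _ ≤ ‖z‖ + ‖w - z‖ := norm_add_le _ _
        _ ≤ _ := by linarith
  refine HasDerivAt.const_mul _ ?_
  refine (hasDerivAt_integral_of_dominated_loc_of_deriv_le (F := thetaKernel γ)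
    (F' := thetaDerivKernel γ) (bound := fun k => (‖z‖ + r) ^ 2 * D * Real.exp (-(2 * r) * |k|))
    (Metric.ball_mem_nhds z hr0) ?_ (integrable_thetaKernel hγ hz).integrableOn ?_ ?_ ?_ ?_).2
  · exact Eventually.of_forall fun w => (measurable_thetaKernel γ w).aestronglyMeasurable
  · exact (measurable_thetaDerivKernel γ z).aestronglyMeasurable
  · refine Eventually.of_forall fun k w hw => ?_
    obtain ⟨h1, h2⟩ := hball w hw
    refine (norm_thetaDerivKernel_le hγ hD w k).trans ?_
    gcongr
    linarith
  · exact ((integrable_exp_neg_mul_abs (by positivity)).const_mul _).integrableOn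
  · filter_upwards [ae_restrict_mem measurableSet_Ioi] with k hk w hw
    have hk : (k : ℂ) ≠ 0 := by
      have : 0 < k := hk
      exact_mod_cast this.ne'
    unfold thetaKernel thetaDerivKernel
    refine HasDerivAt.const_mul _ ?_
    have h1 : HasDerivAt (fun w : ℂ => w * k) (k : ℂ) w := by
      simpa using (hasDerivAt_id w).mul_const (k : ℂ)
    have h2 := (h1.csin.sub h1).div_const (k : ℂ)
    refine h2.congr_deriv ?_
    field_simp

lemma im_sin_mul (x y k : ℝ) : (Complex.sin (((x : ℂ) + y * Complex.I) * k)).im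
    = Real.cos (x * k) * Real.sinh (y * k) := by
  have : ((x : ℂ) + y * Complex.I) * k = ((x * k : ℝ) : ℂ) + ((y * k : ℝ) : ℂ) * Complex.I := by
    push_cast; ring
  rw [this, Complex.sin_add_mul_I, ← Complex.ofReal_sin, ← Complex.ofReal_cos,
    ← Complex.ofReal_sinh, ← Complex.ofReal_cosh, ← Complex.ofReal_mul, ← Complex.ofReal_mul,
    Complex.add_im, Complex.ofReal_im, Complex.im_ofReal_mul, Complex.I_im]
  ring

lemma im_cos_mul (x y k : ℝ) : (Complex.cos (((x : ℂ) + y * Complex.I) * k)).im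
    = -(Real.sin (x * k) * Real.sinh (y * k)) := by
  have : ((x : ℂ) + y * Complex.I) * k = ((x * k : ℝ) : ℂ) + ((y * k : ℝ) : ℂ) * Complex.I := by
    push_cast; ring
  rw [this, Complex.cos_add_mul_I, ← Complex.ofReal_sin, ← Complex.ofReal_cos,
    ← Complex.ofReal_sinh, ← Complex.ofReal_cosh, ← Complex.ofReal_mul, ← Complex.ofReal_mul,
    Complex.sub_im, Complex.ofReal_im, Complex.im_ofReal_mul, Complex.I_im]
  ring

lemma re_I_div_pi_mul (J : ℂ) : (Complex.I / Real.pi * J).re = -(1 / Real.pi * J.im) := by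
  rw [div_mul_eq_mul_div, Complex.div_ofReal_re]
  simp [div_eq_inv_mul]

lemma thetaInt_re {γ : ℝ} (hγ : 2 < γ) (x : ℝ) {y : ℝ} (hy : |y| < 2) :
    (thetaInt γ ((x : ℂ) + y * Complex.I)).re = -(1 / Real.pi * ∫ k in Set.Ioi (0 : ℝ),
      thetaWeight γ k * ((Real.cos (x * k) * Real.sinh (y * k) - y * k) / k)) := by
  have hz : |((x : ℂ) + y * Complex.I).im| < 2 := by simpa using hy
  rw [thetaInt, re_I_div_pi_mul]
  congr 2
  refine (integral_im (integrable_thetaKernel hγ hz).integrableOn).symm.trans ?_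
  refine setIntegral_congr_fun measurableSet_Ioi fun k _ => ?_
  change (thetaKernel γ _ k).im = _
  rw [thetaKernel, Complex.im_ofReal_mul, Complex.div_ofReal_im, Complex.sub_im, im_sin_mul]
  simp

/-- The growth rate of `Re θ_γ` along horizontal lines. -/
def thetaGrowth (γ x : ℝ) : ℝ :=
  1 / Real.pi * ∫ k in Set.Ioi (0 : ℝ), thetaWeight γ k * (Real.cos (x * k) - 1)

/-- The function `sinh - id` is odd and increasing. -/
lemma abs_sinh_sub_le {y k : ℝ} (hy : |y| ≤ 1) (hk : 0 ≤ k) :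
    |Real.sinh (y * k) - y * k| ≤ Real.sinh k - k := by
  have hm := Real.sinh_sub_id_strictMono.monotone
  obtain ⟨h1, h2⟩ := abs_le.mp hy
  have e1 := hm (by nlinarith : y * k ≤ k)
  have e2 := hm (by nlinarith : -k ≤ y * k)
  simp only [Real.sinh_neg] at e1 e2
  exact abs_le.mpr ⟨by linarith, by linarith⟩

lemma integrableOn_thetaWeight_cos {γ : ℝ} (hγ : 2 < γ) (x : ℝ) :
    IntegrableOn (fun k : ℝ => thetaWeight γ k * (Real.cos (x * k) - 1)) (Set.Ioi 0) := by
  have := (integrable_thetaDerivKernel hγ (z := (x : ℂ)) (by simp)).integrableOn (s := Set.Ioi 0)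
  refine this.re.congr (Eventually.of_forall fun k => ?_)
  simp only [RCLike.re_to_complex, thetaDerivKernel]
  rw [Complex.re_ofReal_mul, ← Complex.ofReal_mul, ← Complex.ofReal_cos, Complex.sub_re,
    Complex.ofReal_re, Complex.one_re]

/-- Replacing `sinh(yk)` by `yk` in the formula for `Re θ` costs a remainder dominated,
independently of `x` and `y`, by the integrable kernel at `z = i`. So `Re θ` is linear in `y` up to
a bounded error, and its growth on all lines follows from one of them. -/
lemma exists_thetaInt_re_bound {γ : ℝ} (hγ : 2 < γ) :
    ∃ R, ∀ x y : ℝ, |y| ≤ 1 →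
      |(thetaInt γ ((x : ℂ) + y * Complex.I)).re + y * thetaGrowth γ x| ≤ R := by
  refine ⟨1 / Real.pi * ∫ k in Set.Ioi (0 : ℝ), ‖thetaKernel γ Complex.I k‖, fun x y hy => ?_⟩
  have hy2 : |y| < 2 := by linarith
  have hz : |((x : ℂ) + y * Complex.I).im| < 2 := by simpa using hy2
  have i1 : IntegrableOn (fun k : ℝ => thetaWeight γ k *
      ((Real.cos (x * k) * Real.sinh (y * k) - y * k) / k)) (Set.Ioi 0) := by
    have := (integrable_thetaKernel hγ hz).integrableOn (s := Set.Ioi 0)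
    refine this.im.congr (Eventually.of_forall fun k => ?_)
    simp only [RCLike.im_to_complex]
    rw [thetaKernel, Complex.im_ofReal_mul, Complex.div_ofReal_im, Complex.sub_im, im_sin_mul]
    simp
  have i2 := integrableOn_thetaWeight_cos hγ x
  rw [thetaInt_re hγ x hy2, thetaGrowth]
  have e : -(1 / Real.pi * ∫ k in Set.Ioi (0 : ℝ),
        thetaWeight γ k * ((Real.cos (x * k) * Real.sinh (y * k) - y * k) / k))
      + y * (1 / Real.pi * ∫ k in Set.Ioi (0 : ℝ), thetaWeight γ k * (Real.cos (x * k) - 1))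
      = -(1 / Real.pi * ∫ k in Set.Ioi (0 : ℝ),
        thetaWeight γ k * (Real.cos (x * k) * ((Real.sinh (y * k) - y * k) / k))) := by
    have : (∫ k in Set.Ioi (0 : ℝ),
        thetaWeight γ k * (Real.cos (x * k) * ((Real.sinh (y * k) - y * k) / k)))
        = (∫ k in Set.Ioi (0 : ℝ),
        thetaWeight γ k * ((Real.cos (x * k) * Real.sinh (y * k) - y * k) / k))
        - y * ∫ k in Set.Ioi (0 : ℝ), thetaWeight γ k * (Real.cos (x * k) - 1) := by
      rw [← integral_const_mul, ← integral_sub i1 (i2.const_mul y)]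
      refine setIntegral_congr_fun measurableSet_Ioi fun k hk => ?_
      have hk : k ≠ 0 := (show (0 : ℝ) < k from hk).ne'
      field_simp
      ring
    rw [this]; ring
  rw [e, abs_neg, abs_mul, abs_of_pos (by positivity : 0 < 1 / Real.pi)]
  gcongr
  refine (norm_integral_le_integral_norm (G := ℝ) _).trans
    (setIntegral_mono_on ?_ ?_ measurableSet_Ioi ?_)
  · refine IntegrableOn.congr_fun ((i1.sub (i2.const_mul y)).norm) (fun k hk => ?_) measurableSet_Ioi
    have hk : k ≠ 0 := (show (0 : ℝ) < k from hk).ne'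
    simp only [Pi.sub_apply]
    congr 1
    field_simp
    ring
  · exact (integrable_thetaKernel hγ (by simp)).norm.integrableOn
  · intro k hk
    have hk : 0 < k := hk
    have e1 : ‖thetaKernel γ Complex.I k‖ = thetaWeight γ k * ((Real.sinh k - k) / k) := by
      have : thetaKernel γ Complex.I k
          = ((thetaWeight γ k * ((Real.sinh k - k) / k) : ℝ) : ℂ) * Complex.I := by
        rw [thetaKernel, mul_comm Complex.I, Complex.sin_mul_I]
        push_cast
        ring
      rw [this, norm_mul, Complex.norm_I, mul_one, Complex.norm_real, Real.norm_of_nonneg]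
      refine mul_nonneg (thetaWeight_nonneg hγ k) (div_nonneg ?_ hk.le)
      linarith [Real.self_le_sinh_iff.mpr hk.le]
    rw [e1, norm_mul, Real.norm_of_nonneg (thetaWeight_nonneg hγ k), norm_mul, norm_div,
      Real.norm_of_nonneg hk.le]
    have h1 : ‖Real.cos (x * k)‖ ≤ 1 := Real.abs_cos_le_one _
    have h2 : ‖Real.sinh (y * k) - y * k‖ ≤ Real.sinh k - k := abs_sinh_sub_le hy hk.le
    gcongr ?_ * ?_
    · exact thetaWeight_nonneg hγ k
    calc ‖Real.cos (x * k)‖ * (‖Real.sinh (y * k) - y * k‖ / k)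
        ≤ 1 * ((Real.sinh k - k) / k) := by gcongr
      _ = _ := one_mul _

/-- This identity explains the choice of `g_γ`. The sine transform of the hyperbolic quotient is
half the logarithmic derivative of `cosh πx + cos(2π/γ)`; those of the exponentials are half the
logarithmic derivatives of `x² + (1 - 2/γ)²` and `x² + (3 - 2/γ)²`, whose ratio is governed by the
Blaschke factor on `Im z = -1`. -/
lemma thetaWeight_mul_sinh {γ k : ℝ} (hk : 0 < k) :
    1 / Real.pi * (thetaWeight γ k * Real.sinh k) = Real.cosh (2 / γ * k) / Real.sinh k
      - Real.exp (-(1 - 2 / γ) * k) + Real.exp (-(3 - 2 / γ) * k) := by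
  have hs : Real.sinh k ≠ 0 := (Real.sinh_pos_iff.mpr hk).ne'
  have hpi := Real.pi_ne_zero
  rw [thetaWeight, cosh_two_mul_sub_one, gFun, abs_of_pos hk]
  set t := 2 / γ
  have hE : Real.exp k ≠ 0 := (Real.exp_pos k).ne'
  have hT : Real.exp (t * k) ≠ 0 := (Real.exp_pos _).ne'
  have u1 : Real.exp (-(2 - t) * k) = Real.exp (t * k) / (Real.exp k) ^ 2 := by
    rw [← Real.exp_nat_mul, ← Real.exp_sub]; congr 1; push_cast; ring
  have u2 : Real.exp (-t * k) = 1 / Real.exp (t * k) := by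
    rw [neg_mul, Real.exp_neg, one_div]
  have u3 : Real.exp (-(4 - t) * k) = Real.exp (t * k) / (Real.exp k) ^ 4 := by
    rw [← Real.exp_nat_mul, ← Real.exp_sub]; congr 1; push_cast; ring
  have u4 : Real.exp (-(1 - t) * k) = Real.exp (t * k) / Real.exp k := by
    rw [← Real.exp_sub]; congr 1; ring
  have u5 : Real.exp (-(3 - t) * k) = Real.exp (t * k) / (Real.exp k) ^ 3 := by
    rw [← Real.exp_nat_mul, ← Real.exp_sub]; congr 1; push_cast; ring
  have hsinh : Real.sinh k = (Real.exp k - 1 / Real.exp k) / 2 := by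
    rw [Real.sinh_eq, Real.exp_neg, one_div]
  have hcosh : Real.cosh (t * k) = (Real.exp (t * k) + 1 / Real.exp (t * k)) / 2 := by
    rw [Real.cosh_eq, Real.exp_neg, one_div]
  have key : 2 * Real.exp (-(2 - t) * k) + Real.exp (-t * k) - Real.exp (-(4 - t) * k)
      = 2 * (Real.cosh (t * k) - Real.sinh k * Real.exp (-(1 - t) * k)
        + Real.sinh k * Real.exp (-(3 - t) * k)) := by
    rw [u1, u2, u3, u4, u5, hcosh, hsinh]
    field_simp
    ring
  rw [key]
  field_simp

lemma hasDerivAt_thetaInt_re_line {γ : ℝ} (hγ : 2 < γ) (x : ℝ) :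
    HasDerivAt (fun x : ℝ => (thetaInt γ ((x : ℂ) + ((-1 : ℝ) : ℂ) * Complex.I)).re)
      (-(Real.pi / 2 * (Real.sinh (Real.pi * x) /
        (Real.cosh (Real.pi * x) + Real.cos (Real.pi * (2 / γ)))))
        + x / (x ^ 2 + (1 - 2 / γ) ^ 2) - x / (x ^ 2 + (3 - 2 / γ) ^ 2)) x := by
  obtain ⟨ht0, ht1⟩ := two_div_mem hγ
  have hz : |((x : ℂ) + ((-1 : ℝ) : ℂ) * Complex.I).im| < 2 := by simp
  have h1 : HasDerivAt (fun s : ℝ => (s : ℂ) + ((-1 : ℝ) : ℂ) * Complex.I) 1 x := by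
    simpa using (Complex.ofRealCLM.hasDerivAt (x := x)).add_const (((-1 : ℝ) : ℂ) * Complex.I)
  have h2 := (hasDerivAt_thetaInt hγ hz).comp (𝕜 := ℝ) x h1
  have h3 := Complex.reCLM.hasFDerivAt.comp_hasDerivAt x h2
  simp only [Function.comp_def, Complex.reCLM_apply, mul_one] at h3
  refine h3.congr_deriv ?_
  rw [re_I_div_pi_mul]
  have e1 : (∫ k in Set.Ioi (0 : ℝ),
      thetaDerivKernel γ ((x : ℂ) + ((-1 : ℝ) : ℂ) * Complex.I) k).im
      = ∫ k in Set.Ioi (0 : ℝ), thetaWeight γ k * (Real.sin (x * k) * Real.sinh k) := by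
    refine (integral_im (integrable_thetaDerivKernel hγ hz).integrableOn).symm.trans ?_
    refine setIntegral_congr_fun measurableSet_Ioi fun k _ => ?_
    change (thetaDerivKernel γ _ k).im = _
    rw [thetaDerivKernel, Complex.im_ofReal_mul, Complex.sub_im, im_cos_mul]
    simp
  rw [e1, ← integral_const_mul]
  have e2 : (∫ k in Set.Ioi (0 : ℝ),
      1 / Real.pi * (thetaWeight γ k * (Real.sin (x * k) * Real.sinh k)))
      = ∫ k in Set.Ioi (0 : ℝ), (Real.sin (x * k) * Real.cosh (2 / γ * k) / Real.sinh k
        - Real.sin (x * k) * Real.exp (-(1 - 2 / γ) * k)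
        + Real.sin (x * k) * Real.exp (-(3 - 2 / γ) * k)) := by
    refine setIntegral_congr_fun measurableSet_Ioi fun k hk => ?_
    have := thetaWeight_mul_sinh (γ := γ) hk
    linear_combination Real.sin (x * k) * this
  have i1 := integrableOn_sin_mul_cosh_div_sinh ht0 ht1 x
  have i2 := integrableOn_sin_mul_exp_neg (by linarith : 0 < 1 - 2 / γ) x
  have i3 := integrableOn_sin_mul_exp_neg (by linarith : 0 < 3 - 2 / γ) x
  rw [e2]
  have e3 := (integral_add (i1.sub i2) i3).trans (congrArg₂ (· + ·) (integral_sub i1 i2) rfl)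
  simp only [Pi.sub_apply] at e3
  rw [e3, integral_sin_mul_cosh_div_sinh ht0 ht1,
    integral_sin_mul_exp_neg (by linarith), integral_sin_mul_exp_neg (by linarith)]
  ring

/-- The modulus of the explicit optimizer on the lower boundary line. -/
lemma exists_thetaInt_re_line_eq {γ : ℝ} (hγ : 2 < γ) : ∃ c : ℝ, ∀ x : ℝ,
    2 * (thetaInt γ ((x : ℂ) + ((-1 : ℝ) : ℂ) * Complex.I)).re
      + Real.log (x ^ 2 + (3 - 2 / γ) ^ 2) - Real.log (x ^ 2 + (1 - 2 / γ) ^ 2)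
      + Real.log (Real.cosh (Real.pi * x) + Real.cos (Real.pi * (2 / γ))) = c := by
  obtain ⟨ht0, ht1⟩ := two_div_mem hγ
  have hq : ∀ a : ℝ, 0 < a → ∀ x : ℝ, HasDerivAt (fun x : ℝ => Real.log (x ^ 2 + a ^ 2))
      (2 * x / (x ^ 2 + a ^ 2)) x := fun a ha x => by
    have h1 : HasDerivAt (fun x : ℝ => x ^ 2 + a ^ 2) (2 * x) x := by
      simpa using (hasDerivAt_pow 2 x).add_const (a ^ 2)
    exact h1.log (by positivity)
  have hc : ∀ x : ℝ, HasDerivAt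
      (fun x : ℝ => Real.log (Real.cosh (Real.pi * x) + Real.cos (Real.pi * (2 / γ))))
      (Real.pi * Real.sinh (Real.pi * x) /
        (Real.cosh (Real.pi * x) + Real.cos (Real.pi * (2 / γ)))) x := fun x => by
    have h1 : HasDerivAt (fun x : ℝ => Real.pi * x) Real.pi x := by
      simpa using (hasDerivAt_id x).const_mul Real.pi
    have h2 := h1.cosh.add_const (Real.cos (Real.pi * (2 / γ)))
    have := h2.log (cosh_add_cos_pos ht0 ht1 x).ne'
    rwa [mul_comm (Real.sinh _)] at this
  have hder := fun x : ℝ => ((((hasDerivAt_thetaInt_re_line hγ x).const_mul 2).add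
    (hq (3 - 2 / γ) (by linarith) x)).sub (hq (1 - 2 / γ) (by linarith) x)).add (hc x)
  refine ⟨_, fun x => is_const_of_deriv_eq_zero (fun y => (hder y).differentiableAt)
    (fun y => ?_) x 0⟩
  rw [(hder y).deriv]
  ring

/-! ### Modulus of the explicit optimizer -/

lemma explicitOptimizer_eq {γ : ℝ} (hγ : 2 < γ) {z : ℂ} (hz : |z.im| < 2) :
    explicitOptimizer γ z = blaschke γ z * Complex.exp (thetaInt γ z) := by
  rw [explicitOptimizer, theta_eq hγ hz]

/-- The strip `|Im z| < 2 - 2/γ`, on which the explicit optimizer is holomorphic without zeros. -/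
def bigStrip (γ : ℝ) : Set ℂ := {z | |z.im| < 2 - 2 / γ}

lemma isOpen_bigStrip (γ : ℝ) : IsOpen (bigStrip γ) :=
  isOpen_lt (by fun_prop) continuous_const

lemma sub_ne_zero_of_mem_bigStrip {γ : ℝ} {z : ℂ} (hz : z ∈ bigStrip γ) :
    z - Complex.I * ((2 - 2 / γ : ℝ) : ℂ) ≠ 0 := by
  intro h
  have := congrArg Complex.im h
  simp only [Complex.sub_im, Complex.im_mul_ofReal, Complex.I_im, Complex.zero_im] at this
  have h2 : |z.im| < 2 - 2 / γ := hz
  linarith [le_abs_self z.im]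

lemma add_ne_zero_of_mem_bigStrip {γ : ℝ} {z : ℂ} (hz : z ∈ bigStrip γ) :
    z + Complex.I * ((2 - 2 / γ : ℝ) : ℂ) ≠ 0 := by
  intro h
  have := congrArg Complex.im h
  simp only [Complex.add_im, Complex.im_mul_ofReal, Complex.I_im, Complex.zero_im] at this
  have h2 : |z.im| < 2 - 2 / γ := hz
  linarith [neg_abs_le z.im]

lemma abs_im_lt_two {γ : ℝ} (hγ : 2 < γ) {z : ℂ} (hz : z ∈ bigStrip γ) : |z.im| < 2 := by
  have h2 : |z.im| < 2 - 2 / γ := hz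
  linarith [(two_div_mem hγ).1]

lemma explicitOptimizer_ne_zero {γ : ℝ} {z : ℂ} (hz : z ∈ bigStrip γ) :
    explicitOptimizer γ z ≠ 0 :=
  mul_ne_zero (div_ne_zero (sub_ne_zero_of_mem_bigStrip hz) (add_ne_zero_of_mem_bigStrip hz))
    (Complex.exp_ne_zero _)

lemma differentiableOn_explicitOptimizer {γ : ℝ} (hγ : 2 < γ) :
    DifferentiableOn ℂ (explicitOptimizer γ) (bigStrip γ) := by
  have : DifferentiableOn ℂ (fun z => blaschke γ z * Complex.exp (thetaInt γ z)) (bigStrip γ) := by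
    intro z hz
    refine DifferentiableAt.differentiableWithinAt ?_
    refine DifferentiableAt.mul ?_ (hasDerivAt_thetaInt hγ (abs_im_lt_two hγ hz)).differentiableAt.cexp
    unfold blaschke
    exact DifferentiableAt.div (by fun_prop) (by fun_prop) (add_ne_zero_of_mem_bigStrip hz)
  exact this.congr fun z hz => explicitOptimizer_eq hγ (abs_im_lt_two hγ hz)

lemma line_mem_bigStrip {γ : ℝ} (hγ : 2 < γ) {y : ℝ} (h1 : -1 ≤ y) (h0 : y ≤ 0) (x : ℝ) :
    (x : ℂ) + (y : ℂ) * Complex.I ∈ bigStrip γ := by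
  have : |y| ≤ 1 := abs_le.mpr ⟨h1, by linarith⟩
  have h : ((x : ℂ) + (y : ℂ) * Complex.I).im = y := by simp
  change |((x : ℂ) + (y : ℂ) * Complex.I).im| < 2 - 2 / γ
  rw [h]
  linarith [(two_div_mem hγ).2]

lemma norm_sq_blaschke (γ x y : ℝ) : ‖blaschke γ ((x : ℂ) + (y : ℂ) * Complex.I)‖ ^ 2
    = (x ^ 2 + (2 - 2 / γ - y) ^ 2) / (x ^ 2 + (2 - 2 / γ + y) ^ 2) := by
  rw [blaschke, norm_div, div_pow, ← Complex.normSq_eq_norm_sq, ← Complex.normSq_eq_norm_sq]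
  have e1 : (x : ℂ) + (y : ℂ) * Complex.I - Complex.I * ((2 - 2 / γ : ℝ) : ℂ)
      = (x : ℂ) + ((y - (2 - 2 / γ) : ℝ) : ℂ) * Complex.I := by push_cast; ring
  have e2 : (x : ℂ) + (y : ℂ) * Complex.I + Complex.I * ((2 - 2 / γ : ℝ) : ℂ)
      = (x : ℂ) + ((y + (2 - 2 / γ) : ℝ) : ℂ) * Complex.I := by push_cast; ring
  rw [e1, e2, Complex.normSq_add_mul_I, Complex.normSq_add_mul_I]
  congr 1 <;> ring

lemma norm_explicitOptimizer {γ : ℝ} (hγ : 2 < γ) {y : ℝ} (h1 : -1 ≤ y) (h0 : y ≤ 0) (x : ℝ) :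
    ‖lineAt (explicitOptimizer γ) y x‖ = ‖blaschke γ ((x : ℂ) + (y : ℂ) * Complex.I)‖
      * Real.exp (thetaInt γ ((x : ℂ) + (y : ℂ) * Complex.I)).re := by
  rw [lineAt, explicitOptimizer_eq hγ (abs_im_lt_two hγ (line_mem_bigStrip hγ h1 h0 x)), norm_mul,
    Complex.norm_exp]

lemma norm_explicitOptimizer_zero {γ : ℝ} (hγ : 2 < γ) (x : ℝ) :
    ‖lineAt (explicitOptimizer γ) 0 x‖ = 1 := by
  obtain ⟨ht0, ht1⟩ := two_div_mem hγ
  rw [norm_explicitOptimizer hγ (by norm_num) le_rfl, thetaInt_re hγ x (by simp)]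
  have h := norm_sq_blaschke γ x 0
  have hb : 0 < 2 - 2 / γ := by linarith
  rw [sub_zero, add_zero, div_self (by positivity)] at h
  have h2 : ‖blaschke γ ((x : ℂ) + ((0 : ℝ) : ℂ) * Complex.I)‖ = 1 := by
    exact (pow_eq_one_iff_of_nonneg (norm_nonneg _) two_ne_zero).mp h
  rw [h2]
  simp

lemma exists_norm_sq_explicitOptimizer {γ : ℝ} (hγ : 2 < γ) : ∃ c : ℝ, 0 < c ∧ ∀ x : ℝ,
    ‖lineAt (explicitOptimizer γ) (-1) x‖ ^ 2
      = c / (Real.cosh (Real.pi * x) + Real.cos (Real.pi * (2 / γ))) := by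
  obtain ⟨ht0, ht1⟩ := two_div_mem hγ
  obtain ⟨c, hc⟩ := exists_thetaInt_re_line_eq hγ
  refine ⟨Real.exp c, Real.exp_pos c, fun x => ?_⟩
  have hp := cosh_add_cos_pos ht0 ht1 x
  have h3 : 0 < x ^ 2 + (3 - 2 / γ) ^ 2 := by
    have : 0 < 3 - 2 / γ := by linarith
    positivity
  have h1 : 0 < x ^ 2 + (1 - 2 / γ) ^ 2 := by
    have : 0 < 1 - 2 / γ := by linarith
    positivity
  rw [norm_explicitOptimizer hγ le_rfl (by norm_num), mul_pow, norm_sq_blaschke, ← hc x,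
    Real.exp_add, Real.exp_sub, Real.exp_add, Real.exp_log hp, Real.exp_log h3, Real.exp_log h1,
    ← Real.exp_nat_mul]
  have e1 : 2 - 2 / γ - -1 = 3 - 2 / γ := by ring
  have e2 : 2 - 2 / γ + -1 = 1 - 2 / γ := by ring
  rw [e1, e2, mul_div_assoc, div_self hp.ne', mul_one]
  push_cast
  ring

lemma exists_log_cosh_bound {t : ℝ} (ht0 : 0 < t) (ht1 : t < 1) : ∃ L : ℝ, ∀ x : ℝ,
    |Real.log (Real.cosh (Real.pi * x) + Real.cos (Real.pi * t)) - Real.pi * (|x|)| ≤ L := by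
  set m := 1 + Real.cos (Real.pi * t) with hm
  have hm0 : 0 < m := by simpa using cosh_add_cos_pos ht0 ht1 0
  have hm2 : m ≤ 2 := by linarith [Real.cos_le_one (Real.pi * t)]
  refine ⟨max (Real.log 2) (-Real.log (m / 4)), fun x => ?_⟩
  have hp := cosh_add_cos_pos ht0 ht1 x
  have hE : 0 < Real.exp (Real.pi * |x|) := Real.exp_pos _
  have hcosh : Real.cosh (Real.pi * x) = (Real.exp (Real.pi * |x|) + Real.exp (-(Real.pi * |x|))) / 2 := by
    rw [← Real.cosh_abs, abs_mul, abs_of_pos Real.pi_pos, Real.cosh_eq]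
  have hE1 : Real.exp (-(Real.pi * |x|)) ≤ 1 :=
    Real.exp_le_one_iff.mpr (by have := Real.pi_pos; have := abs_nonneg x; nlinarith)
  have hE2 : 1 ≤ Real.exp (Real.pi * |x|) := Real.one_le_exp (by positivity)
  have hE3 := Real.exp_pos (-(Real.pi * |x|))
  have up : Real.cosh (Real.pi * x) + Real.cos (Real.pi * t) ≤ 2 * Real.exp (Real.pi * |x|) := by
    rw [hcosh]; linarith [Real.cos_le_one (Real.pi * t)]
  -- Write the sum as `(cosh - 1) + m`; since `m ≤ 2`, it is at least `(m/2) cosh`, and `cosh(πx) ≥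
  -- e^{π|x|}/2`.
  have lo : m / 4 * Real.exp (Real.pi * |x|) ≤ Real.cosh (Real.pi * x) + Real.cos (Real.pi * t) := by
    have e : Real.cos (Real.pi * t) = m - 1 := by rw [hm]; ring
    have h1 := Real.one_le_cosh (Real.pi * x)
    rw [e]
    nlinarith [hcosh]
  have l1 := Real.log_le_log hp up
  have l2 := Real.log_le_log (by positivity) lo
  rw [Real.log_mul (by norm_num) hE.ne', Real.log_exp] at l1
  rw [Real.log_mul (by positivity) hE.ne', Real.log_exp] at l2
  have := le_max_left (Real.log 2) (-Real.log (m / 4))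
  have := le_max_right (Real.log 2) (-Real.log (m / 4))
  exact abs_le.mpr ⟨by linarith, by linarith⟩

lemma exists_log_ratio_bound {a b : ℝ} (ha : 0 < a) (hab : a ≤ b) : ∃ L : ℝ, ∀ x : ℝ,
    |Real.log (x ^ 2 + b ^ 2) - Real.log (x ^ 2 + a ^ 2)| ≤ L := by
  refine ⟨Real.log (b ^ 2 / a ^ 2), fun x => ?_⟩
  have hb : 0 < b := ha.trans_le hab
  have l1 : Real.log (x ^ 2 + a ^ 2) ≤ Real.log (x ^ 2 + b ^ 2) :=
    Real.log_le_log (by positivity) (by gcongr)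
  have l2 : Real.log (x ^ 2 + b ^ 2) ≤ Real.log (b ^ 2 / a ^ 2 * (x ^ 2 + a ^ 2)) := by
    refine Real.log_le_log (by positivity) ?_
    rw [mul_add, div_mul_cancel₀ _ (by positivity)]
    have : 1 ≤ b ^ 2 / a ^ 2 := by rw [one_le_div (by positivity)]; gcongr
    nlinarith [sq_nonneg x]
  rw [Real.log_mul (by positivity) (by positivity)] at l2
  rw [abs_of_nonneg (by linarith)]
  linarith

/-- The slope of `Re θ` in `y` is read off at `y = -1`. There the explicit formula gives `-(1/2)
log(cosh πx + cos(2π/γ))` up to a bounded error, that is `-π|x|/2`. -/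
lemma exists_thetaInt_re_asymptotics {γ : ℝ} (hγ : 2 < γ) : ∃ R : ℝ, ∀ x y : ℝ, -1 ≤ y → y ≤ 0 →
    |(thetaInt γ ((x : ℂ) + y * Complex.I)).re - y * (Real.pi / 2 * |x|)| ≤ R := by
  obtain ⟨ht0, ht1⟩ := two_div_mem hγ
  obtain ⟨R, hR⟩ := exists_thetaInt_re_bound hγ
  obtain ⟨c, hc⟩ := exists_thetaInt_re_line_eq hγ
  obtain ⟨L₁, hL₁⟩ := exists_log_cosh_bound ht0 ht1
  obtain ⟨L₂, hL₂⟩ := exists_log_ratio_bound (a := 1 - 2 / γ) (b := 3 - 2 / γ) (by linarith)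
    (by linarith)
  refine ⟨R + (R + |c| + L₁ + L₂), fun x y h1 h0 => ?_⟩
  have e1 := hR x y (abs_le.mpr ⟨h1, by linarith⟩)
  have e2 := hR x (-1) (by simp)
  have e3 := hc x
  have hg : |thetaGrowth γ x + Real.pi / 2 * (|x|)| ≤ R + |c| + L₁ + L₂ := by
    have b1 := abs_le.mp (hL₁ x)
    have b2 := abs_le.mp (hL₂ x)
    have b3 := abs_le.mp e2
    have b4 := le_abs_self c
    have b5 := neg_abs_le c
    have hL1n : 0 ≤ L₁ := (abs_nonneg _).trans (hL₁ x)
    have hL2n : 0 ≤ L₂ := (abs_nonneg _).trans (hL₂ x)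
    have := abs_nonneg c
    exact abs_le.mpr ⟨by linarith [b1.1, b1.2, b2.1, b2.2, b3.1, b3.2],
      by linarith [b1.1, b1.2, b2.1, b2.2, b3.1, b3.2]⟩
  calc |(thetaInt γ ((x : ℂ) + y * Complex.I)).re - y * (Real.pi / 2 * |x|)|
      = |((thetaInt γ ((x : ℂ) + y * Complex.I)).re + y * thetaGrowth γ x)
        - y * (thetaGrowth γ x + Real.pi / 2 * |x|)| := by congr 1; ring
    _ ≤ |(thetaInt γ ((x : ℂ) + y * Complex.I)).re + y * thetaGrowth γ x|
        + |y * (thetaGrowth γ x + Real.pi / 2 * |x|)| := abs_sub _ _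
    _ ≤ R + 1 * (R + |c| + L₁ + L₂) := by
        rw [abs_mul]
        have : |y| ≤ 1 := abs_le.mpr ⟨h1, by linarith⟩
        gcongr
    _ = _ := by ring

/-- Two-sided exponential bounds for the explicit optimizer on the closed lower strip. -/
lemma exists_explicitOptimizer_bounds {γ : ℝ} (hγ : 2 < γ) : ∃ c₁ c₂ : ℝ, 0 < c₁ ∧ 0 < c₂ ∧
    ∀ x y : ℝ, -1 ≤ y → y ≤ 0 →
      c₁ * Real.exp (Real.pi / 2 * (y * |x|)) ≤ ‖lineAt (explicitOptimizer γ) y x‖ ∧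
      ‖lineAt (explicitOptimizer γ) y x‖ ≤ c₂ * Real.exp (Real.pi / 2 * (y * |x|)) := by
  obtain ⟨ht0, ht1⟩ := two_div_mem hγ
  obtain ⟨R, hR⟩ := exists_thetaInt_re_asymptotics hγ
  set b := 2 - 2 / γ with hb
  have hb1 : 1 < b := by linarith
  refine ⟨Real.exp (-R), (b + 1) / (b - 1) * Real.exp R, Real.exp_pos _, ?_, ?_⟩
  · have : 0 < b - 1 := by linarith
    positivity
  intro x y h1 h0
  rw [norm_explicitOptimizer hγ h1 h0]
  obtain ⟨l1, l2⟩ := abs_le.mp (hR x y h1 h0)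
  set B := ‖blaschke γ ((x : ℂ) + (y : ℂ) * Complex.I)‖
  have hB0 : 0 ≤ B := norm_nonneg _
  have hsq : B ^ 2 = (x ^ 2 + (b - y) ^ 2) / (x ^ 2 + (b + y) ^ 2) := norm_sq_blaschke γ x y
  have hden : 0 < x ^ 2 + (b + y) ^ 2 := by
    have : 0 < b + y := by linarith
    positivity
  -- The zero of the Blaschke factor lies in the upper half plane and its pole in the lower one, so
  -- points with `y ≤ 0` are nearer to the pole.
  have hB1 : 1 ≤ B := by
    rw [← one_le_sq_iff₀ hB0, hsq, one_le_div hden]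
    nlinarith
  have hB2 : B ≤ (b + 1) / (b - 1) := by
    have hbp : 0 < b - 1 := by linarith
    refine le_of_sq_le_sq ?_ (by positivity)
    rw [hsq, div_pow, div_le_div_iff₀ hden (by positivity)]
    have h2 : ((b - y) * (b - 1)) ^ 2 ≤ ((b + 1) * (b + y)) ^ 2 := by
      have : 0 ≤ (b - y) * (b - 1) := mul_nonneg (by linarith) hbp.le
      gcongr ?_ ^ 2
      nlinarith
    nlinarith [mul_nonneg (sq_nonneg x) (by linarith : 0 ≤ b)]
  have hE1 : Real.exp (-R) * Real.exp (Real.pi / 2 * (y * |x|))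
      ≤ Real.exp (thetaInt γ ((x : ℂ) + (y : ℂ) * Complex.I)).re := by
    rw [← Real.exp_add]; exact Real.exp_le_exp.mpr (by linarith)
  have hE2 : Real.exp (thetaInt γ ((x : ℂ) + (y : ℂ) * Complex.I)).re
      ≤ Real.exp R * Real.exp (Real.pi / 2 * (y * |x|)) := by
    rw [← Real.exp_add]; exact Real.exp_le_exp.mpr (by linarith)
  constructor
  · refine hE1.trans ?_
    exact le_mul_of_one_le_left (Real.exp_pos _).le hB1
  · rw [mul_assoc]
    gcongr

/-! ### Admissibility and boundary values of the symmetric images -/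

/-- The closed lower strip. -/
def closedLowerStrip : Set ℂ := {z | -1 ≤ z.im ∧ z.im ≤ 0}

lemma line_mem_closedLowerStrip {y : ℝ} (h1 : -1 ≤ y) (h0 : y ≤ 0) (x : ℝ) :
    (x : ℂ) + (y : ℂ) * Complex.I ∈ closedLowerStrip := by
  simp [closedLowerStrip, h1, h0]

/-- No genuine splitting is needed: for `y ≤ -1/2` the whole line function decays at rate `c/2` and
is placed in `L²`, otherwise it is placed in `L^∞`. In either case the relevant weight is at least
`1/2`, whence the factor `2`. -/
lemma exists_hardyBound_of_exp_decay {G : ℂ → ℂ} {M c : ℝ} (hc : 0 < c)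
    (hcont : ContinuousOn G closedLowerStrip)
    (hb : ∀ x y : ℝ, -1 ≤ y → y ≤ 0 → ‖lineAt G y x‖ ≤ M * Real.exp (c * (y * |x|))) :
    ∃ C, 0 ≤ C ∧ HardyBound C G := by
  have hM : 0 ≤ M := by
    have := (norm_nonneg _).trans (hb 0 0 (by norm_num) le_rfl)
    simpa using this
  set E : ℝ → ℂ := fun x => ((M * Real.exp (-(c / 2) * |x|) : ℝ) : ℂ) with hE
  have hE2 : MemLp E 2 volume := by
    refine memLp_two_of_exp_bound (c := c / 2) (M := M) ?_ (by positivity) fun x => ?_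
    · exact (by fun_prop : Continuous E).aestronglyMeasurable
    · rw [hE, Complex.norm_real, Real.norm_of_nonneg (by positivity)]
  set N := (eLpNorm E 2 volume).toReal
  have hN : 0 ≤ N := ENNReal.toReal_nonneg
  refine ⟨2 * (M + N), by positivity, fun y h1 h0 => ?_⟩
  have hm : AEStronglyMeasurable (lineAt G y) volume :=
    (continuous_lineAt hcont (line_mem_closedLowerStrip h1.le h0.le)).aestronglyMeasurable
  rcases le_or_gt y (-(1 / 2)) with hy | hy
  · have hle : eLpNorm (lineAt G y) 2 volume ≤ eLpNorm E 2 volume := by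
      refine eLpNorm_mono fun x => (hb x y h1.le h0.le).trans ?_
      rw [hE, Complex.norm_real, Real.norm_of_nonneg (by positivity)]
      refine mul_le_mul_of_nonneg_left (Real.exp_le_exp.mpr ?_) hM
      have := mul_nonneg hc.le (abs_nonneg x)
      nlinarith
    have hmem : MemLp (lineAt G y) 2 volume := ⟨hm, hle.trans_lt hE2.2⟩
    refine ((SumBound.of_memLp_two hmem).mono ?_ ?_)
    · have : 0 ≤ 1 + y := by linarith
      positivity
    · refine (ENNReal.toReal_mono hE2.2.ne hle).trans ?_
      change N ≤ _
      nlinarith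
  · have hbd : ∀ᵐ x, ‖lineAt G y x‖ ≤ M := Eventually.of_forall fun x => by
      refine (hb x y h1.le h0.le).trans (mul_le_of_le_one_right hM (Real.exp_le_one_iff.mpr ?_))
      have := mul_nonneg hc.le (abs_nonneg x)
      nlinarith
    have hmem : MemLp (lineAt G y) ∞ volume := memLp_top_of_bound hm M hbd
    refine ((SumBound.of_memLp_top hmem).mono ?_ ?_)
    · refine (ENNReal.toReal_le_of_le_ofReal hM (eLpNormEssSup_le_of_ae_bound hbd)).trans ?_
      nlinarith
    · have : 0 ≤ -y := by linarith
      positivity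

lemma tendsto_lineAt {G : ℂ → ℂ} {s : Set ℂ} {y₀ : ℝ} {l : Filter ℝ} (hcont : ContinuousOn G s)
    (hl : l ≤ 𝓝 y₀) {x : ℝ} (hl' : ∀ᶠ y : ℝ in l, (x : ℂ) + (y : ℂ) * Complex.I ∈ s)
    (hy₀ : (x : ℂ) + (y₀ : ℂ) * Complex.I ∈ s) :
    Tendsto (fun y => lineAt G y x) l (𝓝 (lineAt G y₀ x)) := by
  refine Tendsto.comp (hcont _ hy₀) (tendsto_nhdsWithin_iff.mpr ⟨?_, hl'⟩)
  have : Continuous fun y : ℝ => (x : ℂ) + (y : ℂ) * Complex.I := by fun_prop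
  exact (this.tendsto y₀).mono_left hl

lemma tendsToDistributionally_of_continuousOn {G : ℂ → ℂ} {M y₀ : ℝ} {l : Filter ℝ}
    [l.IsCountablyGenerated] (hl : l ≤ 𝓝 y₀) (hl' : ∀ᶠ y in l, y ∈ Set.Ioo (-1 : ℝ) 0)
    (hy₀ : y₀ ∈ Set.Icc (-1 : ℝ) 0) (hcont : ContinuousOn G closedLowerStrip)
    (hb : ∀ x y : ℝ, -1 ≤ y → y ≤ 0 → ‖lineAt G y x‖ ≤ M) :
    TendsToDistributionally G l (lineAt G y₀) := by
  intro φ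
  refine tendsto_integral_filter_of_dominated_convergence (fun x => M * ‖φ x‖) ?_ ?_
    (φ.integrable.norm.const_mul M) ?_
  · filter_upwards [hl'] with y hy
    exact ((Complex.continuous_conj.comp (continuous_lineAt hcont
      (line_mem_closedLowerStrip hy.1.le hy.2.le))).mul φ.continuous).aestronglyMeasurable
  · filter_upwards [hl'] with y hy
    refine Eventually.of_forall fun x => ?_
    rw [norm_mul, RCLike.norm_conj]
    gcongr
    exact hb x y hy.1.le hy.2.le
  · refine Eventually.of_forall fun x => ?_
    refine Tendsto.mul_const _ ((Complex.continuous_conj.tendsto _).comp ?_)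
    exact tendsto_lineAt hcont hl
      (hl'.mono fun y hy => line_mem_closedLowerStrip hy.1.le hy.2.le x)
      (line_mem_closedLowerStrip hy₀.1 hy₀.2 x)

lemma hasBoundaryValues_of_exp_decay {G : ℂ → ℂ} {M c : ℝ} (hc : 0 < c)
    (hcont : ContinuousOn G closedLowerStrip)
    (hb : ∀ x y : ℝ, -1 ≤ y → y ≤ 0 → ‖lineAt G y x‖ ≤ M * Real.exp (c * (y * |x|))) :
    HasBoundaryValues G (lineAt G 0) (lineAt G (-1)) := by
  have hM : 0 ≤ M := by
    have := (norm_nonneg _).trans (hb 0 0 (by norm_num) le_rfl)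
    simpa using this
  have hb' : ∀ x y : ℝ, -1 ≤ y → y ≤ 0 → ‖lineAt G y x‖ ≤ M := fun x y h1 h0 => by
    refine (hb x y h1 h0).trans (mul_le_of_le_one_right hM (Real.exp_le_one_iff.mpr ?_))
    have := mul_nonneg hc.le (abs_nonneg x)
    nlinarith
  have hm : ∀ y : ℝ, -1 ≤ y → y ≤ 0 → AEStronglyMeasurable (lineAt G y) volume := fun y h1 h0 =>
    (continuous_lineAt hcont (line_mem_closedLowerStrip h1 h0)).aestronglyMeasurable
  refine ⟨memLp_top_of_bound (hm 0 (by norm_num) le_rfl) M (Eventually.of_forall fun x =>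
      hb' x 0 (by norm_num) le_rfl), ?_, ?_, ?_⟩
  · refine memLp_two_of_exp_bound (hm (-1) le_rfl (by norm_num)) hc (M := M) fun x => ?_
    refine (hb x (-1) le_rfl (by norm_num)).trans (le_of_eq ?_)
    congr 2; ring
  · exact tendsToDistributionally_of_continuousOn nhdsWithin_le_nhds (Ioo_mem_nhdsLT (by norm_num))
      (by simp) hcont hb'
  · exact tendsToDistributionally_of_continuousOn nhdsWithin_le_nhds (Ioo_mem_nhdsGT (by norm_num))
      (by simp) hcont hb'

lemma closedLowerStrip_subset_bigStrip {γ : ℝ} (hγ : 2 < γ) : closedLowerStrip ⊆ bigStrip γ := by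
  intro z hz
  have := line_mem_bigStrip hγ hz.1 hz.2 z.re
  rwa [Complex.re_add_im] at this

lemma lowerStrip_subset_closedLowerStrip : lowerStrip ⊆ closedLowerStrip :=
  fun _ hz => ⟨hz.1.le, hz.2.le⟩

lemma lineAt_transform (α κ : ℝ) (β : ℂ) (h : ℂ → ℂ) (y x : ℝ) :
    lineAt (transform α κ β h) y x = β * lineAt h y (x - κ) *
      Complex.exp (Complex.I * α * ((x : ℂ) + (y : ℂ) * Complex.I)) := by
  simp only [lineAt, transform]
  congr 3
  push_cast; ring

lemma norm_exp_I_mul (α x y : ℝ) :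
    ‖Complex.exp (Complex.I * α * ((x : ℂ) + (y : ℂ) * Complex.I))‖ = Real.exp (-(α * y)) := by
  rw [Complex.norm_exp]
  congr 1
  simp

lemma sub_ofReal_mem_closedLowerStrip {z : ℂ} (hz : z ∈ closedLowerStrip) (κ : ℝ) :
    z - κ ∈ closedLowerStrip := by
  simpa [closedLowerStrip] using hz

lemma differentiableOn_transform {γ : ℝ} (hγ : 2 < γ) (α κ : ℝ) (β : ℂ) :
    DifferentiableOn ℂ (transform α κ β (explicitOptimizer γ)) closedLowerStrip := by
  have h1 : DifferentiableOn ℂ (fun z : ℂ => explicitOptimizer γ (z - κ)) closedLowerStrip := by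
    refine (differentiableOn_explicitOptimizer hγ).comp (by fun_prop) fun z hz => ?_
    exact closedLowerStrip_subset_bigStrip hγ (sub_ofReal_mem_closedLowerStrip hz κ)
  unfold transform
  exact ((differentiableOn_const β).mul h1).mul (by fun_prop)

lemma exists_transform_bound {γ : ℝ} (hγ : 2 < γ) (α κ : ℝ) (β : ℂ) : ∃ M : ℝ, ∀ x y : ℝ,
    -1 ≤ y → y ≤ 0 → ‖lineAt (transform α κ β (explicitOptimizer γ)) y x‖
      ≤ M * Real.exp (Real.pi / 2 * (y * |x|)) := by
  obtain ⟨c₁, c₂, -, hc2, hbd⟩ := exists_explicitOptimizer_bounds hγ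
  refine ⟨‖β‖ * (c₂ * Real.exp (Real.pi / 2 * |κ|)) * Real.exp |α|, fun x y h1 h0 => ?_⟩
  rw [lineAt_transform, norm_mul, norm_mul, norm_exp_I_mul]
  have e1 : Real.exp (-(α * y)) ≤ Real.exp |α| := by
    refine Real.exp_le_exp.mpr ?_
    have : |-(α * y)| ≤ |α| * 1 := by
      rw [abs_neg, abs_mul]
      gcongr
      exact abs_le.mpr ⟨h1, by linarith⟩
    linarith [le_abs_self (-(α * y))]
  have e2 : Real.exp (Real.pi / 2 * (y * |x - κ|))
      ≤ Real.exp (Real.pi / 2 * |κ|) * Real.exp (Real.pi / 2 * (y * |x|)) := by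
    rw [← Real.exp_add, ← mul_add]
    refine Real.exp_le_exp.mpr (mul_le_mul_of_nonneg_left ?_ (by positivity))
    have := abs_sub_abs_le_abs_sub x κ
    nlinarith [abs_nonneg κ]
  calc _ ≤ ‖β‖ * (c₂ * (Real.exp (Real.pi / 2 * |κ|) * Real.exp (Real.pi / 2 * (y * |x|))))
        * Real.exp |α| := by
        gcongr
        refine ((hbd (x - κ) y h1 h0).2).trans ?_
        gcongr
    _ = _ := by ring

lemma transform_memHardyLower {γ : ℝ} (hγ : 2 < γ) (α κ : ℝ) (β : ℂ) :
    MemHardyLower ∞ 2 (transform α κ β (explicitOptimizer γ)) := by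
  obtain ⟨M, hM⟩ := exists_transform_bound hγ α κ β
  have hd := differentiableOn_transform hγ α κ β
  obtain ⟨C, hC, hb⟩ := exists_hardyBound_of_exp_decay (by positivity) hd.continuousOn hM
  exact memHardyLower_of_hardyBound hC (hd.mono lowerStrip_subset_closedLowerStrip) hb

lemma transform_hasBoundaryValues {γ : ℝ} (hγ : 2 < γ) (α κ : ℝ) (β : ℂ) :
    HasBoundaryValues (transform α κ β (explicitOptimizer γ))
      (lineAt (transform α κ β (explicitOptimizer γ)) 0)
      (lineAt (transform α κ β (explicitOptimizer γ)) (-1)) := by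
  obtain ⟨M, hM⟩ := exists_transform_bound hγ α κ β
  exact hasBoundaryValues_of_exp_decay (by positivity)
    (differentiableOn_transform hγ α κ β).continuousOn hM

lemma lineAt_congr {f g : ℂ → ℂ} (h : Set.EqOn f g lowerStrip) {y : ℝ} (hy : y ∈ Set.Ioo (-1 : ℝ) 0) :
    lineAt f y = lineAt g y :=
  funext fun x => h (mem_lowerStrip_line hy.1 hy.2 x)

lemma MemHardyLower.congr {f g : ℂ → ℂ} (hg : MemHardyLower ∞ 2 g) (h : Set.EqOn f g lowerStrip) :
    MemHardyLower ∞ 2 f := by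
  obtain ⟨C, hC, hb⟩ := hg.exists_hardyBound
  refine memHardyLower_of_hardyBound hC (hg.1.congr h) fun y h1 h0 => ?_
  rw [lineAt_congr h ⟨h1, h0⟩]
  exact hb y h1 h0

lemma HasBoundaryValues.congr {f g : ℂ → ℂ} {u₀ u₁ : ℝ → ℂ} (hg : HasBoundaryValues g u₀ u₁)
    (h : Set.EqOn f g lowerStrip) : HasBoundaryValues f u₀ u₁ := by
  refine ⟨hg.1, hg.2, fun φ => (hg.3 φ).congr' ?_, fun φ => (hg.4 φ).congr' ?_⟩
  · filter_upwards [Ioo_mem_nhdsLT (by norm_num : (-1 : ℝ) < 0)] with y hy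
    rw [lineAt_congr h hy]
  · filter_upwards [Ioo_mem_nhdsGT (by norm_num : (-1 : ℝ) < 0)] with y hy
    rw [lineAt_congr h hy]

lemma transform_zero_zero_one (h : ℂ → ℂ) : transform 0 0 1 h = h := by
  funext z
  simp [transform]

/-! ### The pole function and the residue identity -/

/-- The entire function `cosh (π w) - cos (π t)`, whose only zero in the closed lower strip is
`-it`. -/
def poleFun (t : ℝ) (w : ℂ) : ℂ := Complex.cosh (Real.pi * w) - (Real.cos (Real.pi * t) : ℝ)

lemma differentiable_poleFun (t : ℝ) : Differentiable ℂ (poleFun t) := by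
  unfold poleFun
  fun_prop

lemma lineAt_poleFun (t x y : ℝ) : lineAt (poleFun t) y x =
    ((Real.cosh (Real.pi * x) * Real.cos (Real.pi * y) - Real.cos (Real.pi * t) : ℝ) : ℂ)
      + ((Real.sinh (Real.pi * x) * Real.sin (Real.pi * y) : ℝ) : ℂ) * Complex.I := by
  rw [lineAt, poleFun, show (Real.pi : ℂ) * ((x : ℂ) + (y : ℂ) * Complex.I)
    = (Real.pi * x : ℂ) + (Real.pi * y : ℂ) * Complex.I by ring, Complex.cosh_add,
    Complex.cosh_mul_I, Complex.sinh_mul_I]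
  push_cast
  ring

/-- The factored form exposes the zeros: a factor vanishes only where `x = 0` and the corresponding
cosine is one. It also gives lower bounds factor by factor. -/
lemma norm_sq_lineAt_poleFun (t x y : ℝ) : ‖lineAt (poleFun t) y x‖ ^ 2 =
    (Real.cosh (Real.pi * x) - Real.cos (Real.pi * (y + t)))
      * (Real.cosh (Real.pi * x) - Real.cos (Real.pi * (y - t))) := by
  rw [lineAt_poleFun, ← Complex.normSq_eq_norm_sq, Complex.normSq_add_mul_I,
    mul_add Real.pi, mul_sub Real.pi, Real.cos_add, Real.cos_sub]
  have h1 := Real.cosh_sq (Real.pi * x)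
  have h2 := Real.sin_sq_add_cos_sq (Real.pi * y)
  have h3 := Real.sin_sq_add_cos_sq (Real.pi * t)
  set a := Real.cosh (Real.pi * x)
  set b := Real.sinh (Real.pi * x)
  set s := Real.sin (Real.pi * y)
  set c := Real.cos (Real.pi * y)
  set s' := Real.sin (Real.pi * t)
  set c' := Real.cos (Real.pi * t)
  linear_combination (-s ^ 2) * h1 + (a ^ 2 - c' ^ 2) * h2 + s ^ 2 * h3

/-- Away from the height `-t` both cosines in the factored form stay below one, with a uniform gap
by compactness in `y`, so the modulus is bounded below by a multiple of `cosh πx`. -/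
lemma exists_inv_poleFun_le {t : ℝ} (ht0 : 0 < t) (ht1 : t < 1) {a b : ℝ} (ha : -1 ≤ a)
    (hb : b ≤ 0) (hab : -t ∉ Set.Icc a b) : ∃ M : ℝ, 0 ≤ M ∧ ∀ x y : ℝ, y ∈ Set.Icc a b →
      lineAt (poleFun t) y x ≠ 0 ∧
      ‖(lineAt (poleFun t) y x)⁻¹‖ ≤ M * Real.exp (-Real.pi * |x|) := by
  rcases (Set.Icc a b).eq_empty_or_nonempty with he | hne
  · exact ⟨0, le_rfl, fun x y hy => by simp [he] at hy⟩
  set m : ℝ → ℝ := fun y => max (Real.cos (Real.pi * (y + t))) (Real.cos (Real.pi * (y - t)))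
  obtain ⟨y₀, hy₀, hmax⟩ := isCompact_Icc.exists_isMaxOn hne
    (by fun_prop : Continuous m).continuousOn
  have hlt : m y₀ < 1 := by
    have hpi := Real.pi_pos
    have h1 : -1 ≤ y₀ := ha.trans hy₀.1
    have h2 : y₀ ≤ 0 := hy₀.2.trans hb
    refine max_lt ?_ ?_ <;> refine (Real.cos_le_one _).lt_of_ne fun h => ?_
    · have := (Real.cos_eq_one_iff_of_lt_of_lt (by nlinarith) (by nlinarith)).mp h
      have : y₀ + t = 0 := (mul_eq_zero.mp this).resolve_left hpi.ne'
      exact hab (by rwa [show -t = y₀ by linarith])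
    · have := (Real.cos_eq_one_iff_of_lt_of_lt (by nlinarith) (by nlinarith)).mp h
      have : y₀ - t = 0 := (mul_eq_zero.mp this).resolve_left hpi.ne'
      linarith
  -- Nonnegativity of `κ` is what gives `cosh - κ ≥ (1 - κ) cosh`.
  set κ := max (m y₀) 0
  have hκ0 : 0 ≤ κ := le_max_right _ _
  have hκ1 : 0 < 1 - κ := by
    have : κ < 1 := max_lt hlt one_pos
    linarith
  have key : ∀ x y : ℝ, y ∈ Set.Icc a b →
      (1 - κ) / 2 * Real.exp (Real.pi * |x|) ≤ ‖lineAt (poleFun t) y x‖ := fun x y hy => by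
    have hm : m y ≤ κ := (hmax hy).trans (le_max_left _ _)
    have h1 : Real.cos (Real.pi * (y + t)) ≤ κ := (le_max_left _ _).trans hm
    have h2 : Real.cos (Real.pi * (y - t)) ≤ κ := (le_max_right _ _).trans hm
    have hc1 := Real.one_le_cosh (Real.pi * x)
    have hexp : Real.exp (Real.pi * |x|) / 2 ≤ Real.cosh (Real.pi * x) := by
      rw [← Real.cosh_abs, abs_mul, abs_of_pos Real.pi_pos, Real.cosh_eq]
      linarith [Real.exp_pos (-(Real.pi * |x|))]
    have hle : (1 - κ) * Real.cosh (Real.pi * x) ≤ ‖lineAt (poleFun t) y x‖ := by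
      refine abs_le_of_sq_le_sq' ?_ (norm_nonneg _) |>.2
      rw [norm_sq_lineAt_poleFun, sq]
      refine mul_le_mul ?_ ?_ (by positivity) ?_ <;> nlinarith
    nlinarith
  refine ⟨2 / (1 - κ), by positivity, fun x y hy => ?_⟩
  have hpos : 0 < ‖lineAt (poleFun t) y x‖ := lt_of_lt_of_le (by positivity) (key x y hy)
  refine ⟨norm_pos_iff.mp hpos, ?_⟩
  rw [norm_inv]
  refine (inv_anti₀ (by positivity) (key x y hy)).trans (le_of_eq ?_)
  rw [neg_mul, Real.exp_neg]
  field_simp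

lemma poleFun_eq_zero {t : ℝ} : poleFun t (((-t : ℝ) : ℂ) * Complex.I) = 0 := by
  have := lineAt_poleFun t 0 (-t)
  simpa [lineAt] using this

lemma poleFun_ne_zero {t : ℝ} (ht0 : 0 < t) (ht1 : t < 1) {z : ℂ} (hz : z ∈ closedLowerStrip)
    (hne : z ≠ ((-t : ℝ) : ℂ) * Complex.I) : poleFun t z ≠ 0 := by
  have hpi := Real.pi_pos
  have hz' : lineAt (poleFun t) z.im z.re = poleFun t z := by rw [lineAt, Complex.re_add_im]
  rw [← hz', ← norm_ne_zero_iff, ← pow_ne_zero_iff two_ne_zero, norm_sq_lineAt_poleFun,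
    mul_ne_zero_iff]
  have h1 := hz.1
  have h2 := hz.2
  have hcos : ∀ u, Real.cosh (Real.pi * z.re) - Real.cos u = 0 → z.re = 0 ∧ Real.cos u = 1 := by
    intro u hu
    have a1 := Real.one_le_cosh (Real.pi * z.re)
    have a2 := Real.cos_le_one u
    refine ⟨?_, by linarith⟩
    by_contra h
    have := Real.one_lt_cosh.mpr (mul_ne_zero hpi.ne' h)
    linarith
  constructor <;> intro h <;> obtain ⟨hr, hu⟩ := hcos _ h
  · have := (Real.cos_eq_one_iff_of_lt_of_lt (by nlinarith) (by nlinarith)).mp hu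
    have : z.im + t = 0 := (mul_eq_zero.mp this).resolve_left hpi.ne'
    exact hne (Complex.ext (by simp [hr]) (by simp; linarith))
  · have := (Real.cos_eq_one_iff_of_lt_of_lt (by nlinarith) (by nlinarith)).mp hu
    have : z.im - t = 0 := (mul_eq_zero.mp this).resolve_left hpi.ne'
    linarith

lemma deriv_poleFun_ne_zero {t : ℝ} (ht0 : 0 < t) (ht1 : t < 1) :
    deriv (poleFun t) (((-t : ℝ) : ℂ) * Complex.I) ≠ 0 := by
  have h : HasDerivAt (poleFun t) (Complex.sinh (Real.pi * (((-t : ℝ) : ℂ) * Complex.I)) * Real.pi)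
      (((-t : ℝ) : ℂ) * Complex.I) := by
    have := ((hasDerivAt_id' (((-t : ℝ) : ℂ) * Complex.I)).const_mul (Real.pi : ℂ)).ccosh.sub_const
      ((Real.cos (Real.pi * t) : ℝ) : ℂ)
    simp only [mul_one] at this
    exact this
  rw [h.deriv, ← mul_assoc, Complex.sinh_mul_I]
  have hs : 0 < Real.sin (Real.pi * t) :=
    Real.sin_pos_of_pos_of_lt_pi (by positivity) (by nlinarith [Real.pi_pos])
  have : Complex.sin (Real.pi * ((-t : ℝ) : ℂ)) = -((Real.sin (Real.pi * t) : ℝ) : ℂ) := by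
    push_cast
    rw [mul_neg, Complex.sin_neg]
  rw [this]
  refine mul_ne_zero (mul_ne_zero (neg_ne_zero.mpr ?_) Complex.I_ne_zero) ?_
  · exact_mod_cast hs.ne'
  · exact_mod_cast Real.pi_ne_zero

/-- Residue identity for `U / poleFun t` on two lines on either side of the pole `-it`. -/
lemma integral_div_poleFun_sub {t : ℝ} (ht0 : 0 < t) (ht1 : t < 1) {U : ℂ → ℂ}
    (hU : DifferentiableOn ℂ U lowerStrip) {y₁ y₂ M c : ℝ} (h1 : -1 < y₁) (h1t : y₁ < -t)
    (h2t : -t < y₂) (h2 : y₂ < 0) (hc0 : 0 ≤ c) (hc : c < Real.pi)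
    (hb : ∀ z : ℂ, y₁ ≤ z.im → z.im ≤ y₂ → ‖U z‖ ≤ M * Real.exp (c * |z.re|)) :
    (∫ x, lineAt U y₁ x * (lineAt (poleFun t) y₁ x)⁻¹)
        - U (((-t : ℝ) : ℂ) * Complex.I) * ∫ x, (lineAt (poleFun t) y₁ x)⁻¹
      = (∫ x, lineAt U y₂ x * (lineAt (poleFun t) y₂ x)⁻¹)
        - U (((-t : ℝ) : ℂ) * Complex.I) * ∫ x, (lineAt (poleFun t) y₂ x)⁻¹ := by
  set z₁ : ℂ := ((-t : ℝ) : ℂ) * Complex.I with hz₁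
  have him : z₁.im = -t := by simp [hz₁]
  have hmem : z₁ ∈ lowerStrip := ⟨by rw [him]; linarith, by rw [him]; linarith⟩
  have hnhds : lowerStrip ∈ 𝓝 z₁ := isOpen_lowerStrip.mem_nhds hmem
  -- In place of a residue computation, the constant `U z₁` is subtracted from `U`. The quotient
  -- then extends holomorphically across the simple zero `z₁` as a ratio of difference quotients,
  -- and its integrals over the two lines agree.
  set V : ℂ → ℂ := fun z => dslope U z₁ z / dslope (poleFun t) z₁ z with hV
  have hden : ∀ z ∈ lowerStrip, dslope (poleFun t) z₁ z ≠ 0 := fun z hz => by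
    rcases eq_or_ne z z₁ with rfl | hne
    · rw [dslope_same]; exact deriv_poleFun_ne_zero ht0 ht1
    · rw [dslope_of_ne _ hne, slope_def_field, poleFun_eq_zero, sub_zero]
      exact div_ne_zero (poleFun_ne_zero ht0 ht1 (lowerStrip_subset_closedLowerStrip hz) hne)
        (sub_ne_zero.mpr hne)
  have hVd : DifferentiableOn ℂ V lowerStrip :=
    ((Complex.differentiableOn_dslope hnhds).mpr hU).div
      ((Complex.differentiableOn_dslope hnhds).mpr (differentiable_poleFun t).differentiableOn) hden
  have hVeq : ∀ z, z ≠ z₁ → V z = (U z - U z₁) * (poleFun t z)⁻¹ := fun z hne => by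
    have := sub_ne_zero.mpr hne
    simp only [hV]
    rw [dslope_of_ne _ hne, dslope_of_ne _ hne, slope_def_field, slope_def_field, hz₁,
      poleFun_eq_zero, ← hz₁, sub_zero, div_div_div_cancel_right₀ this, div_eq_mul_inv]
  have hsub : {z : ℂ | y₁ ≤ z.im ∧ z.im ≤ y₂} ⊆ lowerStrip := fun z hz =>
    ⟨h1.trans_le hz.1, hz.2.trans_lt h2⟩
  have hM : 0 ≤ M := by
    have := (norm_nonneg _).trans (hb z₁ (by rw [him]; linarith) (by rw [him]; linarith))
    simpa [hz₁] using this
  -- the decay of `V`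
  obtain ⟨B, hB⟩ : ∃ B, ∀ z : ℂ, y₁ ≤ z.im → z.im ≤ y₂ →
      ‖V z‖ ≤ B * Real.exp (-(Real.pi - c) * |z.re|) := by
    have hcomp : IsCompact (Set.Icc (-1 : ℝ) 1 ×ℂ Set.Icc y₁ y₂) :=
      isCompact_Icc.reProdIm isCompact_Icc
    obtain ⟨B₁, hB₁⟩ := hcomp.exists_bound_of_continuousOn (f := V)
      (hVd.continuousOn.mono fun z hz => hsub hz.2)
    have hpc : 0 < Real.pi - c := by linarith
    have hB₁0 : 0 ≤ B₁ := (norm_nonneg _).trans (hB₁ z₁ ⟨by simp [hz₁], by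
      rw [Set.mem_preimage, him]; exact ⟨h1t.le, h2t.le⟩⟩)
    refine ⟨B₁ * Real.exp (Real.pi - c) + 8 * (M + ‖U z₁‖), fun z ha hb' => ?_⟩
    rcases le_or_gt |z.re| 1 with hre | hre
    · calc ‖V z‖ ≤ B₁ := hB₁ z ⟨abs_le.mp hre, ha, hb'⟩
        _ = B₁ * 1 := (mul_one _).symm
        _ ≤ B₁ * (Real.exp (Real.pi - c) * Real.exp (-(Real.pi - c) * |z.re|)) := by
          rw [← Real.exp_add]
          gcongr
          exact Real.one_le_exp (by nlinarith)
        _ ≤ _ := by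
          rw [add_mul, mul_assoc]
          exact le_add_of_nonneg_right (by positivity)
    · have hne : z ≠ z₁ := by
        rintro rfl
        norm_num [hz₁] at hre
      rw [hVeq z hne, norm_mul, norm_inv]
      -- For `|Re z| > 1` the bound `cosh - 1` for the pole function is uniform in the height, so
      -- the pole plays no role; the remaining compact part is bounded by continuity of `V`.
      have hD : Real.exp (Real.pi * |z.re|) / 8 ≤ ‖poleFun t z‖ := by
        have hz' : lineAt (poleFun t) z.im z.re = poleFun t z := by rw [lineAt, Complex.re_add_im]
        have hexp : Real.exp (Real.pi * |z.re|) / 2 ≤ Real.cosh (Real.pi * z.re) := by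
          rw [← Real.cosh_abs, abs_mul, abs_of_pos Real.pi_pos, Real.cosh_eq]
          linarith [Real.exp_pos (-(Real.pi * |z.re|))]
        have h4 : 3 ≤ Real.exp (Real.pi * |z.re|) := by
          have := Real.add_one_le_exp (Real.pi * |z.re|)
          nlinarith [Real.pi_gt_three]
        have hle : Real.cosh (Real.pi * z.re) - 1 ≤ ‖poleFun t z‖ := by
          have hc1 := Real.one_le_cosh (Real.pi * z.re)
          refine abs_le_of_sq_le_sq' ?_ (norm_nonneg _) |>.2
          rw [← hz', norm_sq_lineAt_poleFun, sq]
          have a1 := Real.cos_le_one (Real.pi * (z.im + t))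
          have a2 := Real.cos_le_one (Real.pi * (z.im - t))
          refine mul_le_mul ?_ ?_ ?_ ?_ <;> linarith
        linarith
      have hD' : ‖poleFun t z‖⁻¹ ≤ 8 * Real.exp (-(Real.pi * |z.re|)) := by
        refine (inv_anti₀ (by positivity) hD).trans (le_of_eq ?_)
        rw [Real.exp_neg]
        field_simp
      have hN : ‖U z - U z₁‖ ≤ (M + ‖U z₁‖) * Real.exp (c * |z.re|) := by
        refine (norm_sub_le _ _).trans ?_
        rw [add_mul]
        refine add_le_add (hb z ha hb') (le_mul_of_one_le_right (norm_nonneg _) ?_)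
        exact Real.one_le_exp (by positivity)
      calc ‖U z - U z₁‖ * ‖poleFun t z‖⁻¹
          ≤ (M + ‖U z₁‖) * Real.exp (c * |z.re|) * (8 * Real.exp (-(Real.pi * |z.re|))) := by
            gcongr
        _ = 8 * (M + ‖U z₁‖) * Real.exp (-(Real.pi - c) * |z.re|) := by
          rw [show -(Real.pi - c) * |z.re| = c * |z.re| + -(Real.pi * |z.re|) by ring, Real.exp_add]
          ring
        _ ≤ _ := by
          gcongr
          exact le_add_of_nonneg_left (by positivity)
  have hshift := integral_lineAt_eq (by linarith) (by linarith : 0 < Real.pi - c)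
    (hVd.mono hsub) hB
  have hline : ∀ y, y₁ ≤ y → y ≤ y₂ → y ≠ -t → ∫ x, lineAt V y x =
      (∫ x, lineAt U y x * (lineAt (poleFun t) y x)⁻¹)
        - U z₁ * ∫ x, (lineAt (poleFun t) y x)⁻¹ := fun y ha hb' hyt => by
    have hy1 : -1 < y := h1.trans_le ha
    have hy0 : y < 0 := hb'.trans_lt h2
    obtain ⟨B', hB'0, hB'⟩ := exists_inv_poleFun_le ht0 ht1 (a := y) (b := y) hy1.le hy0.le
      (fun h => hyt (le_antisymm h.1 h.2))
    have hle := fun x => hB' x y ⟨le_rfl, le_rfl⟩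
    have hDc : Continuous (fun x => (lineAt (poleFun t) y x)⁻¹) :=
      (continuous_lineAt (differentiable_poleFun t).continuous.continuousOn
        (fun x => Set.mem_univ _)).inv₀ fun x => (hle x).1
    have i2 : Integrable (fun x => (lineAt (poleFun t) y x)⁻¹) :=
      integrable_of_exp_bound hDc.aestronglyMeasurable Real.pi_pos fun x => (hle x).2
    have i1 : Integrable (fun x => lineAt U y x * (lineAt (poleFun t) y x)⁻¹) := by
      refine integrable_of_exp_bound (M := M * B') (c := Real.pi - c)
        ((continuous_lineAt hU.continuousOn
        (mem_lowerStrip_line hy1 hy0)).mul hDc).aestronglyMeasurable (by linarith) fun x => ?_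
      rw [norm_mul]
      have := hb ((x : ℂ) + (y : ℂ) * Complex.I) (by simpa) (by simpa)
      calc _ ≤ (M * Real.exp (c * |x|)) * (B' * Real.exp (-Real.pi * |x|)) := by
            refine mul_le_mul ?_ (hle x).2 (norm_nonneg _) (by positivity)
            simpa [lineAt] using this
        _ = _ := by
          rw [show -(Real.pi - c) * |x| = c * |x| + -Real.pi * |x| by ring, Real.exp_add]
          ring
    rw [← integral_const_mul, ← integral_sub i1 (i2.const_mul _)]
    refine integral_congr_ae (Eventually.of_forall fun x => ?_)
    have hne : (x : ℂ) + (y : ℂ) * Complex.I ≠ z₁ := fun h => by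
      have := congrArg Complex.im h
      rw [him] at this
      exact hyt (by simpa using this)
    simp only [lineAt]
    rw [hVeq _ hne, sub_mul]
  rw [← hline y₁ le_rfl (by linarith) h1t.ne, ← hline y₂ (by linarith) le_rfl h2t.ne', hshift]

/-! ### The kernel and the representation formula -/

/-- The kernel `e^{iαw} / (h(w) (cosh (π w) - cos (2π/γ)))`, where `h` is the explicit optimizer. -/
def kern (γ α : ℝ) (w : ℂ) : ℂ :=
  Complex.exp (Complex.I * α * w) / explicitOptimizer γ w * (poleFun (2 / γ) w)⁻¹

/-- The set on which `kern` is holomorphic. -/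
def kernDomain (γ : ℝ) : Set ℂ := bigStrip γ ∩ {w | poleFun (2 / γ) w ≠ 0}

lemma isOpen_kernDomain (γ : ℝ) : IsOpen (kernDomain γ) :=
  (isOpen_bigStrip γ).inter
    (isOpen_ne_fun (differentiable_poleFun (2 / γ)).continuous continuous_const)

lemma differentiableOn_kern {γ : ℝ} (hγ : 2 < γ) (α : ℝ) :
    DifferentiableOn ℂ (kern γ α) (kernDomain γ) := by
  refine DifferentiableOn.mul (DifferentiableOn.div (by fun_prop)
    ((differentiableOn_explicitOptimizer hγ).mono Set.inter_subset_left)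
    fun z hz => explicitOptimizer_ne_zero hz.1) ?_
  exact (differentiable_poleFun _).differentiableOn.inv fun z hz => hz.2

lemma line_mem_kernDomain {γ : ℝ} (hγ : 2 < γ) {y : ℝ} (h1 : -1 ≤ y) (h0 : y ≤ 0)
    (hy : y ≠ -(2 / γ)) (x : ℝ) : (x : ℂ) + (y : ℂ) * Complex.I ∈ kernDomain γ := by
  refine ⟨line_mem_bigStrip hγ h1 h0 x, poleFun_ne_zero (two_div_mem hγ).1 (two_div_mem hγ).2
    (line_mem_closedLowerStrip h1 h0 x) fun h => hy ?_⟩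
  simpa using congrArg Complex.im h

/-- Division by the optimizer costs at most `e^{π|x|/2}` in the closed strip, while the pole
function contributes `e^{-π|x|}`. -/
lemma exists_kern_bound {γ : ℝ} (hγ : 2 < γ) (α : ℝ) {a b : ℝ} (ha : -1 ≤ a)
    (hb : b ≤ 0) (hab : -(2 / γ) ∉ Set.Icc a b) : ∃ M : ℝ, 0 ≤ M ∧ ∀ x y : ℝ, y ∈ Set.Icc a b →
      ‖lineAt (kern γ α) y x‖ ≤ M * Real.exp (-(Real.pi / 2) * |x|) := by
  obtain ⟨M, hM, hle⟩ := exists_inv_poleFun_le (two_div_mem hγ).1 (two_div_mem hγ).2 ha hb hab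
  obtain ⟨c₁, c₂, hc1, -, hH⟩ := exists_explicitOptimizer_bounds hγ
  refine ⟨Real.exp |α| / c₁ * M, by positivity, fun x y hy => ?_⟩
  have h1 : -1 ≤ y := ha.trans hy.1
  have h0 : y ≤ 0 := hy.2.trans hb
  have e1 : ‖Complex.exp (Complex.I * α * ((x : ℂ) + (y : ℂ) * Complex.I))‖ ≤ Real.exp |α| := by
    rw [norm_exp_I_mul]
    refine Real.exp_le_exp.mpr ?_
    have : |-(α * y)| ≤ |α| * 1 := by
      rw [abs_neg, abs_mul]
      gcongr
      exact abs_le.mpr ⟨h1, by linarith⟩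
    linarith [le_abs_self (-(α * y))]
  have e2 : c₁ * Real.exp (-(Real.pi / 2) * |x|) ≤ ‖lineAt (explicitOptimizer γ) y x‖ := by
    refine le_trans ?_ (hH x y h1 h0).1
    refine mul_le_mul_of_nonneg_left (Real.exp_le_exp.mpr ?_) hc1.le
    have : 0 ≤ Real.pi / 2 * |x| := by positivity
    nlinarith
  have e3 := (hle x y hy).2
  calc ‖lineAt (kern γ α) y x‖
      = ‖Complex.exp (Complex.I * α * ((x : ℂ) + (y : ℂ) * Complex.I))‖
        / ‖lineAt (explicitOptimizer γ) y x‖ * ‖(lineAt (poleFun (2 / γ)) y x)⁻¹‖ := by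
        rw [← norm_div, ← norm_mul]; rfl
    _ ≤ Real.exp |α| / (c₁ * Real.exp (-(Real.pi / 2) * |x|))
        * (M * Real.exp (-Real.pi * |x|)) := by gcongr
    _ = _ := by
      rw [show -Real.pi * |x| = -(Real.pi / 2) * |x| + -(Real.pi / 2) * |x| by ring, Real.exp_add]
      field_simp

lemma contDiff_lineAt {V : ℂ → ℂ} {s : Set ℂ} (hs : IsOpen s) (hV : DifferentiableOn ℂ V s) {y : ℝ}
    (hy : ∀ x : ℝ, (x : ℂ) + (y : ℂ) * Complex.I ∈ s) : ContDiff ℝ (⊤ : ℕ∞) (lineAt V y) := by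
  have h1 : ContDiffOn ℝ (⊤ : ℕ∞) V s := (hV.contDiffOn hs).restrict_scalars ℝ
  have h2 : ContDiff ℝ (⊤ : ℕ∞) fun x : ℝ => (x : ℂ) + (y : ℂ) * Complex.I :=
    Complex.ofRealCLM.contDiff.add contDiff_const
  exact h1.comp_contDiff h2 hy

lemma exp_neg_mul_abs_sub_le {c : ℝ} (hc : 0 ≤ c) (x κ : ℝ) :
    Real.exp (-c * |x - κ|) ≤ Real.exp (c * |κ|) * Real.exp (-c * |x|) := by
  rw [← Real.exp_add]
  refine Real.exp_le_exp.mpr ?_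
  have := mul_le_mul_of_nonneg_left (abs_sub_abs_le_abs_sub x κ) hc
  linarith

lemma lineAt_comp_sub (V : ℂ → ℂ) (κ y x : ℝ) :
    lineAt (fun z => V (z - κ)) y x = lineAt V y (x - κ) := by
  simp only [lineAt]
  congr 1
  push_cast; ring

lemma tendsto_pairing_kern {γ : ℝ} (hγ : 2 < γ) (α κ : ℝ) {a b y₀ C A B : ℝ} (ha : -1 ≤ a)
    (hb : b ≤ 0) (hab : -(2 / γ) ∉ Set.Icc a b) (hy₀ : y₀ ∈ Set.Icc a b) {f : ℂ → ℂ}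
    (hf : HardyBound C f) (hC : 0 ≤ C) {l : Filter ℝ} [l.IsCountablyGenerated] (hl : l ≤ 𝓝 y₀)
    (hl' : ∀ᶠ y in l, y ∈ Set.Ioo a b) {u : ℝ → ℂ} (hu : TendsToDistributionally f l u)
    (hub : SumBound A B u) :
    Tendsto (fun y => ∫ x, lineAt f y x * lineAt (kern γ α) y (x - κ)) l
      (𝓝 (∫ x, u x * lineAt (kern γ α) y₀ (x - κ))) := by
  obtain ⟨M, hM, hMb⟩ := exists_kern_bound hγ α ha hb hab
  have hne : ∀ y ∈ Set.Icc a b, y ≠ -(2 / γ) := fun y hy h => hab (h ▸ hy)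
  have hdom : ∀ y ∈ Set.Icc a b, ∀ x : ℝ, (x : ℂ) + (y : ℂ) * Complex.I ∈ kernDomain γ :=
    fun y hy => line_mem_kernDomain hγ (ha.trans hy.1) (hy.2.trans hb) (hne y hy)
  have hcd : ∀ y ∈ Set.Icc a b, ContDiff ℝ (⊤ : ℕ∞) (lineAt (kern γ α) y) := fun y hy =>
    contDiff_lineAt (isOpen_kernDomain γ) (differentiableOn_kern hγ α) (hdom y hy)
  have hbd : ∀ y ∈ Set.Icc a b, ∀ x, ‖lineAt (fun z => kern γ α (z - κ)) y x‖
      ≤ M * Real.exp (Real.pi / 2 * |κ|) * Real.exp (-(Real.pi / 2) * |x|) := fun y hy x => by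
    rw [lineAt_comp_sub, mul_assoc]
    exact (hMb _ y hy).trans
      (mul_le_mul_of_nonneg_left (exp_neg_mul_abs_sub_le (by positivity) x κ) hM)
  have hlI : ∀ᶠ y in l, y ∈ Set.Icc a b := hl'.mono fun y hy => Set.Ioo_subset_Icc_self hy
  have := hu.tendsto_pairing_lineAt (N := fun z => kern γ α (z - κ)) (y₀ := y₀) hf hC
    (hl'.mono fun y hy => ⟨ha.trans_lt hy.1, hy.2.trans_le hb⟩) hub
    (c := Real.pi / 2) (by positivity) ?_ (hbd y₀ hy₀) ?_
    (hlI.mono hbd) ?_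
  · simpa only [lineAt_comp_sub] using this
  · have e : lineAt (fun z => kern γ α (z - κ)) y₀ = fun x => lineAt (kern γ α) y₀ (x - κ) :=
      funext fun x => lineAt_comp_sub _ _ _ _
    rw [e]
    exact (hcd y₀ hy₀).comp (contDiff_id.sub contDiff_const)
  · filter_upwards [hlI] with y hy
    have e : lineAt (fun z => kern γ α (z - κ)) y = fun x => lineAt (kern γ α) y (x - κ) :=
      funext fun x => lineAt_comp_sub _ _ _ _
    rw [e]
    exact (hcd y hy).continuous.comp (by fun_prop)
  · intro x
    simp only [lineAt_comp_sub]
    exact tendsto_lineAt (differentiableOn_kern hγ α).continuousOn hl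
      (hlI.mono fun y hy => hdom y hy _) (hdom y₀ hy₀ _)

lemma tendsto_integral_inv_poleFun {t : ℝ} (ht0 : 0 < t) (ht1 : t < 1) {a b y₀ : ℝ} (ha : -1 ≤ a)
    (hb : b ≤ 0) (hab : -t ∉ Set.Icc a b) (hy₀ : y₀ ∈ Set.Icc a b)
    {l : Filter ℝ} [l.IsCountablyGenerated] (hl : l ≤ 𝓝 y₀) (hl' : ∀ᶠ y in l, y ∈ Set.Ioo a b) :
    Tendsto (fun y => ∫ x, (lineAt (poleFun t) y x)⁻¹) l
      (𝓝 (∫ x, (lineAt (poleFun t) y₀ x)⁻¹)) := by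
  obtain ⟨M, hM, hle⟩ := exists_inv_poleFun_le ht0 ht1 ha hb hab
  have hcont := (differentiable_poleFun t).continuous.continuousOn (s := Set.univ)
  refine tendsto_integral_filter_of_dominated_convergence
    (fun x => M * Real.exp (-Real.pi * |x|)) ?_ ?_
    ((integrable_exp_neg_mul_abs Real.pi_pos).const_mul M) ?_
  · filter_upwards [hl'] with y hy
    exact ((continuous_lineAt hcont fun x => Set.mem_univ _).inv₀
      fun x => (hle x y (Set.Ioo_subset_Icc_self hy)).1).aestronglyMeasurable
  · filter_upwards [hl'] with y hy
    exact Eventually.of_forall fun x => (hle x y (Set.Ioo_subset_Icc_self hy)).2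
  · refine Eventually.of_forall fun x => Tendsto.inv₀ ?_ (hle x y₀ hy₀).1
    exact tendsto_lineAt hcont hl (Eventually.of_forall fun y => Set.mem_univ _) (Set.mem_univ _)

/-- The density `1 / (cosh (π s) - cos (2π/γ))`. -/
def densityZero (γ s : ℝ) : ℝ := (Real.cosh (Real.pi * s) - Real.cos (Real.pi * (2 / γ)))⁻¹

/-- The density `1 / (cosh (π s) + cos (2π/γ))`. -/
def densityOne (γ s : ℝ) : ℝ := (Real.cosh (Real.pi * s) + Real.cos (Real.pi * (2 / γ)))⁻¹

lemma inv_lineAt_poleFun_zero (γ x : ℝ) :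
    (lineAt (poleFun (2 / γ)) 0 x)⁻¹ = (densityZero γ x : ℂ) := by
  rw [lineAt_poleFun, densityZero]
  simp

lemma inv_lineAt_poleFun_neg_one (γ x : ℝ) :
    (lineAt (poleFun (2 / γ)) (-1) x)⁻¹ = -(densityOne γ x : ℂ) := by
  rw [lineAt_poleFun, densityOne, Complex.ofReal_inv, neg_inv, mul_neg_one, Real.cos_neg,
    Real.sin_neg, Real.cos_pi, Real.sin_pi]
  congr 1
  push_cast
  ring

/-- Representation of the values on the line `Im z = -2/γ` through the boundary values. -/
theorem representation {γ : ℝ} (hγ : 2 < γ) {f : ℂ → ℂ} (hf : MemHardyLower ∞ 2 f)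
    {u₀ u₁ : ℝ → ℂ} (hbv : HasBoundaryValues f u₀ u₁) (α κ : ℝ) :
    lineAt f (-(2 / γ)) κ * (Real.exp (α * (2 / γ)) : ℝ)
        / explicitOptimizer γ (((-(2 / γ) : ℝ) : ℂ) * Complex.I)
        * ((∫ s, densityZero γ s) + ∫ s, densityOne γ s : ℝ)
      = (∫ s, u₀ s * lineAt (kern γ α) 0 (s - κ)) - ∫ s, u₁ s * lineAt (kern γ α) (-1) (s - κ) := by
  obtain ⟨ht0, ht1⟩ := two_div_mem hγ
  set t := 2 / γ with ht
  obtain ⟨C, hC, hb⟩ := hf.exists_hardyBound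
  obtain ⟨c₁, c₂, hc1, -, hH⟩ := exists_explicitOptimizer_bounds hγ
  -- Translating `f` instead of the kernel keeps the pole at `-it`, where `U` takes the value of `f`
  -- at `κ - it`, up to explicit factors.
  set U : ℂ → ℂ := fun z => f (z + κ) * (Complex.exp (Complex.I * α * z) / explicitOptimizer γ z)
    with hU
  have hUd : DifferentiableOn ℂ U lowerStrip := by
    refine DifferentiableOn.mul (hf.1.comp (by fun_prop) fun z hz => by simpa [lowerStrip] using hz)
      (DifferentiableOn.div (by fun_prop) ((differentiableOn_explicitOptimizer hγ).mono ?_) ?_)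
    · exact lowerStrip_subset_closedLowerStrip.trans (closedLowerStrip_subset_bigStrip hγ)
    · exact fun z hz => explicitOptimizer_ne_zero
        (closedLowerStrip_subset_bigStrip hγ (lowerStrip_subset_closedLowerStrip hz))
  -- By the residue identity `F` takes the same value at any height below the pole as at any height
  -- above it; its limits at the two boundary lines give the formula.
  set F : ℝ → ℂ := fun y => (∫ x, lineAt f y x * lineAt (kern γ α) y (x - κ))
    - U (((-t : ℝ) : ℂ) * Complex.I) * ∫ x, (lineAt (poleFun t) y x)⁻¹ with hF
  have hFeq : ∀ y₁ y₂ : ℝ, -1 < y₁ → y₁ < -t → -t < y₂ → y₂ < 0 → F y₁ = F y₂ := by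
    intro y₁ y₂ h1 h1t h2t h2
    obtain ⟨δ, hδ0, hδ2, hδa, hδb⟩ : ∃ δ : ℝ, 0 < δ ∧ δ ≤ 1 / 2 ∧ -1 + δ ≤ y₁ ∧ y₂ ≤ -δ :=
      ⟨min (1 / 2) (min (1 + y₁) (-y₂)), lt_min (by norm_num) (lt_min (by linarith) (by linarith)),
        min_le_left _ _, by
          have := (min_le_right (1 / 2) (min (1 + y₁) (-y₂))).trans (min_le_left _ _)
          linarith, by
          have := (min_le_right (1 / 2) (min (1 + y₁) (-y₂))).trans (min_le_right _ _)
          linarith⟩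
    obtain ⟨M, hM⟩ := hb.exists_bound hC hf.1 hδ0 hδ2
    have hM0 : 0 ≤ M := (norm_nonneg _).trans (hM (((-t : ℝ) : ℂ) * Complex.I)
      (by simp; linarith) (by simp; linarith))
    have hUb : ∀ z : ℂ, y₁ ≤ z.im → z.im ≤ y₂ →
        ‖U z‖ ≤ M * (Real.exp |α| / c₁) * Real.exp (Real.pi / 2 * |z.re|) := by
      intro z ha hb'
      have e0 : ‖f (z + κ)‖ ≤ M := hM _ (by simp; linarith) (by simp; linarith)
      have hz1 : -1 ≤ z.im := by linarith
      have hz0 : z.im ≤ 0 := by linarith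
      have e1 : ‖Complex.exp (Complex.I * α * z)‖ ≤ Real.exp |α| := by
        rw [← Complex.re_add_im z, norm_exp_I_mul]
        refine Real.exp_le_exp.mpr ?_
        have : |-(α * z.im)| ≤ |α| * 1 := by
          rw [abs_neg, abs_mul]
          gcongr
          exact abs_le.mpr ⟨hz1, by linarith⟩
        linarith [le_abs_self (-(α * z.im))]
      have e2 : c₁ * Real.exp (-(Real.pi / 2 * |z.re|)) ≤ ‖explicitOptimizer γ z‖ := by
        have := (hH z.re z.im hz1 hz0).1
        rw [lineAt, Complex.re_add_im] at this
        refine le_trans ?_ this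
        refine mul_le_mul_of_nonneg_left (Real.exp_le_exp.mpr ?_) hc1.le
        have : 0 ≤ Real.pi / 2 * |z.re| := by positivity
        nlinarith
      rw [hU]
      simp only [norm_mul, norm_div]
      calc _ ≤ M * (Real.exp |α| / (c₁ * Real.exp (-(Real.pi / 2 * |z.re|)))) := by gcongr
        _ = _ := by
          rw [Real.exp_neg]
          field_simp
    -- The quotient `U` grows at most like `e^{π|x|/2}`, which is below the admissible rate `π`.
    have := integral_div_poleFun_sub ht0 ht1 hUd h1 h1t h2t h2 (by positivity)
      (by linarith [Real.pi_pos]) hUb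
    have hI : ∀ y : ℝ, (∫ x, lineAt U y x * (lineAt (poleFun t) y x)⁻¹)
        = ∫ x, lineAt f y x * lineAt (kern γ α) y (x - κ) := fun y => by
      rw [← integral_sub_right_eq_self _ κ]
      refine integral_congr_ae (Eventually.of_forall fun x => ?_)
      simp only [lineAt, hU, kern, ht]
      rw [mul_assoc]
      congr 2
      push_cast; ring
    rwa [hI, hI] at this
  have h0 : Tendsto F (𝓝[<] 0) (𝓝 ((∫ x, u₀ x * lineAt (kern γ α) 0 (x - κ))
      - U (((-t : ℝ) : ℂ) * Complex.I) * ∫ x, (lineAt (poleFun t) 0 x)⁻¹)) := by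
    have hnot : -t ∉ Set.Icc (-t / 2) 0 := fun h => by linarith [h.1]
    have hev : ∀ᶠ y in 𝓝[<] (0 : ℝ), y ∈ Set.Ioo (-t / 2) 0 := Ioo_mem_nhdsLT (by linarith)
    refine Tendsto.sub (tendsto_pairing_kern hγ α κ (by linarith) le_rfl hnot ⟨by linarith, le_rfl⟩
      hb hC nhdsWithin_le_nhds hev hbv.tendsto_zero (SumBound.of_memLp_top hbv.memLp_zero)) ?_
    exact (tendsto_integral_inv_poleFun ht0 ht1 (by linarith) le_rfl hnot ⟨by linarith, le_rfl⟩
      nhdsWithin_le_nhds hev).const_mul _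
  have h1 : Tendsto F (𝓝[>] (-1)) (𝓝 ((∫ x, u₁ x * lineAt (kern γ α) (-1) (x - κ))
      - U (((-t : ℝ) : ℂ) * Complex.I) * ∫ x, (lineAt (poleFun t) (-1) x)⁻¹)) := by
    have hnot : -t ∉ Set.Icc (-1) (-(1 + t) / 2) := fun h => by linarith [h.2]
    have hev : ∀ᶠ y in 𝓝[>] (-1 : ℝ), y ∈ Set.Ioo (-1) (-(1 + t) / 2) :=
      Ioo_mem_nhdsGT (by linarith)
    refine Tendsto.sub (tendsto_pairing_kern hγ α κ le_rfl (by linarith) hnot ⟨le_rfl, by linarith⟩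
      hb hC nhdsWithin_le_nhds hev hbv.tendsto_one (SumBound.of_memLp_two hbv.memLp_one)) ?_
    exact (tendsto_integral_inv_poleFun ht0 ht1 le_rfl (by linarith) hnot ⟨le_rfl, by linarith⟩
      nhdsWithin_le_nhds hev).const_mul _
  have hc0 : ∀ y₁, -1 < y₁ → y₁ < -t → F y₁ = (∫ x, u₀ x * lineAt (kern γ α) 0 (x - κ))
      - U (((-t : ℝ) : ℂ) * Complex.I) * ∫ x, (lineAt (poleFun t) 0 x)⁻¹ := fun y₁ ha hb' => by
    refine tendsto_nhds_unique (tendsto_const_nhds.congr' ?_) h0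
    filter_upwards [Ioo_mem_nhdsLT (by linarith : -t < 0)] with y hy
    exact hFeq y₁ y ha hb' hy.1 hy.2
  have heq := tendsto_nhds_unique h1 (tendsto_const_nhds.congr' (by
    filter_upwards [Ioo_mem_nhdsGT (by linarith : (-1 : ℝ) < -t)] with y hy
    exact (hc0 y hy.1 hy.2).symm))
  simp only [inv_lineAt_poleFun_zero, inv_lineAt_poleFun_neg_one, ht] at heq
  rw [integral_neg, integral_complex_ofReal, integral_complex_ofReal] at heq
  have hUv : U (((-t : ℝ) : ℂ) * Complex.I) = lineAt f (-t) κ * (Real.exp (α * t) : ℝ)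
        / explicitOptimizer γ (((-t : ℝ) : ℂ) * Complex.I) := by
    simp only [hU, lineAt]
    rw [add_comm _ (κ : ℂ), mul_div_assoc]
    congr 3
    rw [Complex.ofReal_exp]
    congr 1
    push_cast
    linear_combination (-(α * t : ℂ)) * Complex.I_mul_I
  rw [← ht] at heq
  rw [← hUv, Complex.ofReal_add]
  linear_combination heq

/-! ### The sharp inequality -/

lemma densityOne_pos {γ : ℝ} (hγ : 2 < γ) (s : ℝ) : 0 < densityOne γ s :=
  inv_pos.mpr (cosh_add_cos_pos (two_div_mem hγ).1 (two_div_mem hγ).2 s)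

lemma densityZero_pos {γ : ℝ} (hγ : 2 < γ) (s : ℝ) : 0 < densityZero γ s := by
  have h := cosh_add_cos_pos (t := 1 - 2 / γ) (by linarith [(two_div_mem hγ).2])
    (by linarith [(two_div_mem hγ).1]) s
  rw [mul_sub, mul_one, Real.cos_pi_sub, ← sub_eq_add_neg] at h
  exact inv_pos.mpr h

lemma continuous_densityOne {γ : ℝ} (hγ : 2 < γ) : Continuous (densityOne γ) :=
  Continuous.inv₀ (by fun_prop)
    fun s => (cosh_add_cos_pos (two_div_mem hγ).1 (two_div_mem hγ).2 s).ne'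

lemma continuous_densityZero {γ : ℝ} (hγ : 2 < γ) : Continuous (densityZero γ) :=
  Continuous.inv₀ (by fun_prop) fun s => by
    have := densityZero_pos hγ s
    exact (inv_pos.mp this).ne'

lemma exists_densityOne_le {γ : ℝ} (hγ : 2 < γ) :
    ∃ M, 0 ≤ M ∧ ∀ s, densityOne γ s ≤ M * Real.exp (-Real.pi * |s|) := by
  obtain ⟨ht0, ht1⟩ := two_div_mem hγ
  obtain ⟨M, hM, h⟩ := exists_inv_poleFun_le ht0 ht1 (a := -1) (b := -1) le_rfl (by norm_num)
    (by simp; intro h; linarith)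
  refine ⟨M, hM, fun s => ?_⟩
  have := (h s (-1) (by simp)).2
  rwa [inv_lineAt_poleFun_neg_one, norm_neg, Complex.norm_real,
    Real.norm_of_nonneg (densityOne_pos hγ s).le] at this

lemma exists_densityZero_le {γ : ℝ} (hγ : 2 < γ) :
    ∃ M, 0 ≤ M ∧ ∀ s, densityZero γ s ≤ M * Real.exp (-Real.pi * |s|) := by
  obtain ⟨ht0, ht1⟩ := two_div_mem hγ
  obtain ⟨M, hM, h⟩ := exists_inv_poleFun_le ht0 ht1 (a := 0) (b := 0) (by norm_num) le_rfl
    (by simp; intro h; linarith)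
  refine ⟨M, hM, fun s => ?_⟩
  have := (h s 0 (by simp)).2
  rwa [inv_lineAt_poleFun_zero, Complex.norm_real,
    Real.norm_of_nonneg (densityZero_pos hγ s).le] at this

lemma integrable_densityOne {γ : ℝ} (hγ : 2 < γ) : Integrable (densityOne γ) := by
  obtain ⟨M, -, h⟩ := exists_densityOne_le hγ
  refine ((integrable_exp_neg_mul_abs Real.pi_pos).const_mul M).mono'
    (continuous_densityOne hγ).aestronglyMeasurable (Eventually.of_forall fun s => ?_)
  rw [Real.norm_of_nonneg (densityOne_pos hγ s).le]
  exact h s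

lemma integrable_densityZero {γ : ℝ} (hγ : 2 < γ) : Integrable (densityZero γ) := by
  obtain ⟨M, -, h⟩ := exists_densityZero_le hγ
  refine ((integrable_exp_neg_mul_abs Real.pi_pos).const_mul M).mono'
    (continuous_densityZero hγ).aestronglyMeasurable (Eventually.of_forall fun s => ?_)
  rw [Real.norm_of_nonneg (densityZero_pos hγ s).le]
  exact h s

lemma integral_pos_of_forall_pos {g : ℝ → ℝ} (hg : Integrable g) (h : ∀ s, 0 < g s) :
    0 < ∫ s, g s := by
  refine (integral_pos_iff_support_of_nonneg (fun s => (h s).le) hg).mpr ?_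
  have : Function.support g = Set.univ := Set.eq_univ_of_forall fun s => (h s).ne'
  simp [this]

lemma integral_densityOne_pos {γ : ℝ} (hγ : 2 < γ) : 0 < ∫ s, densityOne γ s :=
  integral_pos_of_forall_pos (integrable_densityOne hγ) (densityOne_pos hγ)

lemma integral_densityZero_pos {γ : ℝ} (hγ : 2 < γ) : 0 < ∫ s, densityZero γ s :=
  integral_pos_of_forall_pos (integrable_densityZero hγ) (densityZero_pos hγ)

/-- On the real line both `e^{iαs}` and the optimizer are unimodular, so `α` does not enter. -/
lemma norm_kern_zero {γ : ℝ} (hγ : 2 < γ) (α s : ℝ) :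
    ‖lineAt (kern γ α) 0 s‖ = densityZero γ s := by
  have e : lineAt (kern γ α) 0 s = Complex.exp (Complex.I * α * ((s : ℂ) + ((0 : ℝ) : ℂ) * Complex.I))
    / lineAt (explicitOptimizer γ) 0 s * (lineAt (poleFun (2 / γ)) 0 s)⁻¹ := rfl
  rw [e, norm_mul, norm_div, norm_exp_I_mul, norm_explicitOptimizer_zero hγ,
    inv_lineAt_poleFun_zero, Complex.norm_real, Real.norm_of_nonneg (densityZero_pos hγ s).le]
  simp

lemma lineAt_kern_neg_one (γ α s : ℝ) : lineAt (kern γ α) (-1) s =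
    Complex.exp (Complex.I * α * ((s : ℂ) + ((-1 : ℝ) : ℂ) * Complex.I))
      / lineAt (explicitOptimizer γ) (-1) s * -(densityOne γ s : ℂ) := by
  rw [← inv_lineAt_poleFun_neg_one]
  rfl

lemma norm_kern_neg_one {γ : ℝ} (hγ : 2 < γ) (α s : ℝ) :
    ‖lineAt (kern γ α) (-1) s‖
      = Real.exp α * densityOne γ s / ‖lineAt (explicitOptimizer γ) (-1) s‖ := by
  rw [lineAt_kern_neg_one, norm_mul, norm_div, norm_exp_I_mul, norm_neg, Complex.norm_real,
    Real.norm_of_nonneg (densityOne_pos hγ s).le]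
  simp only [mul_neg, mul_one, neg_neg]
  ring

lemma continuous_kern_line {γ : ℝ} (hγ : 2 < γ) (α : ℝ) {y : ℝ} (h1 : -1 ≤ y) (h0 : y ≤ 0)
    (hy : y ≠ -(2 / γ)) : Continuous (lineAt (kern γ α) y) :=
  continuous_lineAt (differentiableOn_kern hγ α).continuousOn (line_mem_kernDomain hγ h1 h0 hy)

lemma continuous_explicitOptimizer_line {γ : ℝ} (hγ : 2 < γ) {y : ℝ} (h1 : -1 ≤ y) (h0 : y ≤ 0) :
    Continuous (lineAt (explicitOptimizer γ) y) :=
  continuous_lineAt (differentiableOn_explicitOptimizer hγ).continuousOn (line_mem_bigStrip hγ h1 h0)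

lemma continuous_kern_neg_one {γ : ℝ} (hγ : 2 < γ) (α : ℝ) : Continuous (lineAt (kern γ α) (-1)) :=
  continuous_kern_line hγ α le_rfl (by norm_num) (by linarith [(two_div_mem hγ).2])

lemma memLp_kern_neg_one {γ : ℝ} (hγ : 2 < γ) (α κ : ℝ) :
    MemLp (fun s => lineAt (kern γ α) (-1) (s - κ)) 2 volume := by
  obtain ⟨M, hM, h⟩ := exists_kern_bound hγ α (a := -1) (b := -1) le_rfl (by norm_num)
    (by simp; intro h; linarith [(two_div_mem hγ).2])
  refine memLp_two_of_exp_bound (M := M * Real.exp (Real.pi / 2 * |κ|)) (c := Real.pi / 2)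
    ((continuous_kern_neg_one hγ α).comp (by fun_prop)).aestronglyMeasurable (by positivity)
    fun s => ?_
  rw [mul_assoc]
  exact (h _ (-1) (by simp)).trans
    (mul_le_mul_of_nonneg_left (exp_neg_mul_abs_sub_le (by positivity) s κ) hM)

/-- The square of the modulus of the explicit optimizer on the line `Im z = -1`. -/
lemma exists_norm_sq_eq_mul_densityOne {γ : ℝ} (hγ : 2 < γ) : ∃ c : ℝ, 0 < c ∧
    (∀ s, ‖lineAt (explicitOptimizer γ) (-1) s‖ ^ 2 = c * densityOne γ s) ∧
    normTwo (lineAt (explicitOptimizer γ) (-1)) ^ 2 = c * ∫ s, densityOne γ s := by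
  obtain ⟨c, hc, h⟩ := exists_norm_sq_explicitOptimizer hγ
  have h' : ∀ s, ‖lineAt (explicitOptimizer γ) (-1) s‖ ^ 2 = c * densityOne γ s := fun s => by
    rw [h, densityOne, div_eq_mul_inv]
  refine ⟨c, hc, h', ?_⟩
  rw [normTwo_eq_sqrt (continuous_explicitOptimizer_line hγ le_rfl
    (by norm_num)).aestronglyMeasurable, Real.sq_sqrt (by positivity)]
  simp only [h']
  rw [integral_const_mul]

lemma normTwo_explicitOptimizer_pos {γ : ℝ} (hγ : 2 < γ) :
    0 < normTwo (lineAt (explicitOptimizer γ) (-1)) := by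
  obtain ⟨c, hc, -, h⟩ := exists_norm_sq_eq_mul_densityOne hγ
  have h0 : 0 ≤ normTwo (lineAt (explicitOptimizer γ) (-1)) := ENNReal.toReal_nonneg
  refine h0.lt_of_ne fun h' => ?_
  rw [← h'] at h
  have := mul_pos hc (integral_densityOne_pos hγ)
  norm_num at h
  rcases h with h | h <;> simp [h] at this

lemma norm_explicitOptimizer_neg_one_pos {γ : ℝ} (hγ : 2 < γ) (s : ℝ) :
    0 < ‖lineAt (explicitOptimizer γ) (-1) s‖ :=
  norm_pos_iff.mpr (explicitOptimizer_ne_zero (line_mem_bigStrip hγ le_rfl (by norm_num) s))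

/-- The squared modulus of the kernel is density squared over `|h|²`, and `|h|²` is a multiple of
the density, so it is again a multiple of the density. This proportionality is what makes
Cauchy-Schwarz sharp for `h`. -/
lemma normTwo_kern_neg_one {γ : ℝ} (hγ : 2 < γ) (α κ : ℝ) :
    normTwo (fun s => lineAt (kern γ α) (-1) (s - κ))
      = Real.exp α * (∫ s, densityOne γ s) / normTwo (lineAt (explicitOptimizer γ) (-1)) := by
  obtain ⟨c, hc, h, hn⟩ := exists_norm_sq_eq_mul_densityOne hγ
  have hn0 := normTwo_explicitOptimizer_pos hγ
  have hp := integral_densityOne_pos hγ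
  rw [normTwo_eq_sqrt (memLp_kern_neg_one hγ α κ).1, Real.sqrt_eq_iff_mul_self_eq_of_pos
    (by positivity), ← sq, div_pow, mul_pow, hn,
    integral_sub_right_eq_self (fun s => ‖lineAt (kern γ α) (-1) s‖ ^ 2) κ]
  have : ∀ s, ‖lineAt (kern γ α) (-1) s‖ ^ 2 = Real.exp α ^ 2 / c * densityOne γ s := fun s => by
    have := densityOne_pos hγ s
    rw [norm_kern_neg_one hγ, div_pow, mul_pow, h]
    field_simp
  simp only [this]
  rw [integral_const_mul]
  field_simp

lemma norm_integral_kern_zero_le {γ : ℝ} (hγ : 2 < γ) (α κ : ℝ) {u₀ : ℝ → ℂ}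
    (hu : MemLp u₀ ∞ volume) : ‖∫ s, u₀ s * lineAt (kern γ α) 0 (s - κ)‖
      ≤ (eLpNorm u₀ ∞ volume).toReal * ∫ s, densityZero γ s := by
  rw [← integral_sub_right_eq_self (densityZero γ) κ, ← integral_const_mul]
  refine norm_integral_le_of_norm_le (((integrable_densityZero hγ).comp_sub_right κ).const_mul _) ?_
  filter_upwards [ae_norm_le_of_eLpNorm_top ENNReal.toReal_nonneg
    (ENNReal.ofReal_toReal hu.2.ne).ge] with s hs
  rw [norm_mul, norm_kern_zero hγ]
  exact mul_le_mul_of_nonneg_right hs (densityZero_pos hγ _).le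

lemma norm_integral_kern_neg_one_le {γ : ℝ} (hγ : 2 < γ) (α κ : ℝ) {u₁ : ℝ → ℂ}
    (hu : MemLp u₁ 2 volume) : ‖∫ s, u₁ s * lineAt (kern γ α) (-1) (s - κ)‖
      ≤ normTwo u₁ * (Real.exp α * (∫ s, densityOne γ s)
        / normTwo (lineAt (explicitOptimizer γ) (-1))) := by
  rw [← normTwo_kern_neg_one hγ α κ]
  exact norm_integral_mul_le_of_memLp_two hu (memLp_kern_neg_one hγ α κ)

/-- The modulus of the explicit optimizer at `-2i/γ`. -/
def peak (γ : ℝ) : ℝ := ‖explicitOptimizer γ (((-(2 / γ) : ℝ) : ℂ) * Complex.I)‖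

lemma mem_bigStrip_peak {γ : ℝ} (hγ : 2 < γ) :
    (((-(2 / γ) : ℝ) : ℂ) * Complex.I) ∈ bigStrip γ := by
  have := line_mem_bigStrip hγ (y := -(2 / γ)) (by linarith [(two_div_mem hγ).2])
    (by linarith [(two_div_mem hγ).1]) 0
  simpa using this

lemma peak_pos {γ : ℝ} (hγ : 2 < γ) : 0 < peak γ :=
  norm_pos_iff.mpr (explicitOptimizer_ne_zero (mem_bigStrip_peak hγ))

/-- The representation formula with the sup norm pulled out on the real line and Cauchy-Schwarz on
`Im z = -1`, the parameter `α` still being free. -/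
lemma norm_line_mul_exp_le {γ : ℝ} (hγ : 2 < γ) {f : ℂ → ℂ} (hf : MemHardyLower ∞ 2 f)
    {u₀ u₁ : ℝ → ℂ} (hbv : HasBoundaryValues f u₀ u₁) (α κ : ℝ) :
    ‖lineAt f (-(2 / γ)) κ‖ * Real.exp (α * (2 / γ))
        * ((∫ s, densityZero γ s) + ∫ s, densityOne γ s)
      ≤ peak γ * ((eLpNorm u₀ ∞ volume).toReal * (∫ s, densityZero γ s)
        + normTwo u₁ * (Real.exp α * (∫ s, densityOne γ s)
          / normTwo (lineAt (explicitOptimizer γ) (-1)))) := by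
  have hp := peak_pos hγ
  have hp0 := integral_densityZero_pos hγ
  have hp1 := integral_densityOne_pos hγ
  have h := congrArg norm (representation hγ hf hbv α κ)
  rw [norm_mul, norm_div, norm_mul, Complex.norm_real, Complex.norm_real,
    Real.norm_of_nonneg (Real.exp_pos _).le, Real.norm_of_nonneg (by positivity)] at h
  have h2 := h.le.trans ((norm_sub_le _ _).trans (add_le_add
    (norm_integral_kern_zero_le hγ α κ hbv.memLp_zero)
    (norm_integral_kern_neg_one_le hγ α κ hbv.memLp_one)))
  change _ / peak γ * _ ≤ _ at h2
  rw [div_mul_eq_mul_div, div_le_iff₀' hp] at h2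
  exact h2

/-- Optimization over `α`. -/
lemma le_of_forall_mul_exp_le {X h n p q a b t : ℝ} (hh : 0 ≤ h) (hn : 0 < n) (hp : 0 < p)
    (hq : 0 < q) (ha : 0 ≤ a) (hb : 0 ≤ b) (ht0 : 0 < t) (ht1 : t < 1)
    (H : ∀ α : ℝ, X * Real.exp (α * t) * (p + q) ≤ h * (a * p + b * (Real.exp α * q / n))) :
    X ≤ h / n ^ t * (a ^ (1 - t) * b ^ t) := by
  -- Either norm may vanish, so `a` and `b` are made positive before the logarithm is taken, and `ε
  -- → 0` at the end.
  have key : ∀ ε : ℝ, 0 < ε → X ≤ h / n ^ t * ((a + ε) ^ (1 - t) * (b + ε) ^ t) := by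
    intro ε hε
    have hA : 0 < a + ε := by positivity
    have hB : 0 < b + ε := by positivity
    have hr : 0 < (a + ε) * n / (b + ε) := by positivity
    -- With `e^α = (a + ε)n/(b + ε)` the bracket is at most `(a + ε)(p + q)`, so the common factor
    -- `p + q` cancels.
    have h1 := H (Real.log ((a + ε) * n / (b + ε)))
    rw [mul_comm (Real.log _) t, mul_comm t, ← Real.rpow_def_of_pos hr, Real.exp_log hr] at h1
    have h2 : X * ((a + ε) * n / (b + ε)) ^ t * (p + q) ≤ h * (a + ε) * (p + q) := by
      refine h1.trans ?_
      rw [mul_assoc]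
      refine mul_le_mul_of_nonneg_left ?_ hh
      rw [mul_add]
      refine add_le_add (by nlinarith) ?_
      have : b * ((a + ε) * n / (b + ε) * q / n) = (b / (b + ε)) * ((a + ε) * q) := by field_simp
      rw [this]
      refine mul_le_of_le_one_left (by positivity) ?_
      rw [div_le_one hB]
      linarith
    have h3 := le_of_mul_le_mul_right h2 (by positivity)
    rw [← le_div_iff₀ (by positivity)] at h3
    refine h3.trans (le_of_eq ?_)
    rw [Real.div_rpow (by positivity) hB.le, Real.mul_rpow hA.le hn.le, Real.rpow_sub hA,
      Real.rpow_one]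
    field_simp
  have hc : ContinuousAt (fun ε : ℝ => h / n ^ t * ((a + ε) ^ (1 - t) * (b + ε) ^ t)) 0 := by
    have e1 : Continuous fun ε : ℝ => (a + ε) ^ (1 - t) :=
      (continuous_const.add continuous_id).rpow_const fun _ => Or.inr (by linarith)
    have e2 : Continuous fun ε : ℝ => (b + ε) ^ t :=
      (continuous_const.add continuous_id).rpow_const fun _ => Or.inr ht0.le
    exact (continuous_const.mul (e1.mul e2)).continuousAt
  have hl := hc.tendsto.mono_left (nhdsWithin_le_nhds (s := Set.Ioi 0))
  simp only [add_zero] at hl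
  exact ge_of_tendsto hl (by filter_upwards [self_mem_nhdsWithin] with ε hε using key ε hε)

/-- The three lines inequality with the sharp constant. -/
theorem norm_line_le {γ : ℝ} (hγ : 2 < γ) {f : ℂ → ℂ} (hf : MemHardyLower ∞ 2 f)
    {u₀ u₁ : ℝ → ℂ} (hbv : HasBoundaryValues f u₀ u₁) (x : ℝ) :
    ‖lineAt f (-(2 / γ)) x‖ ≤ peak γ / normTwo (lineAt (explicitOptimizer γ) (-1)) ^ (2 / γ)
      * ((eLpNorm u₀ ∞ volume).toReal ^ (1 - 2 / γ) * normTwo u₁ ^ (2 / γ)) :=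
  le_of_forall_mul_exp_le (peak_pos hγ).le (normTwo_explicitOptimizer_pos hγ)
    (integral_densityZero_pos hγ) (integral_densityOne_pos hγ) ENNReal.toReal_nonneg
    ENNReal.toReal_nonneg (two_div_mem hγ).1 (two_div_mem hγ).2
    fun α => norm_line_mul_exp_le hγ hf hbv α x

/-! ### The extremal value and its attainment -/

lemma eqOn_lowerStrip_of_line {f g : ℂ → ℂ} (hf : DifferentiableOn ℂ f lowerStrip)
    (hg : DifferentiableOn ℂ g lowerStrip) {y : ℝ} (h1 : -1 < y) (h0 : y < 0)
    (h : ∀ x, lineAt f y x = lineAt g y x) : Set.EqOn f g lowerStrip := by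
  have hconv : Convex ℝ lowerStrip :=
    (convex_halfSpace_im_gt (-1)).inter (convex_halfSpace_im_lt 0)
  refine (hf.analyticOnNhd isOpen_lowerStrip).eqOn_of_preconnected_of_mem_closure
    (hg.analyticOnNhd isOpen_lowerStrip) hconv.isPreconnected (mem_lowerStrip_line h1 h0 0) ?_
  rw [mem_closure_iff_seq_limit]
  refine ⟨fun n : ℕ => (((1 / ((n : ℝ) + 1) : ℝ) : ℂ) + (y : ℂ) * Complex.I), fun n => ⟨?_, ?_⟩, ?_⟩
  · exact h _
  · intro hn
    have := congrArg Complex.re (Set.mem_singleton_iff.mp hn)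
    have hpos : (0 : ℝ) < 1 / ((n : ℝ) + 1) := by positivity
    simp at this
    norm_cast at this
  · exact ((Complex.continuous_ofReal.tendsto _).comp
      tendsto_one_div_add_atTop_nhds_zero_nat).add_const _

/-- The value of the three lines problem. -/
def sharpConst (γ : ℝ) : ℝ := peak γ / normTwo (lineAt (explicitOptimizer γ) (-1)) ^ (2 / γ)

lemma sharpConst_pos {γ : ℝ} (hγ : 2 < γ) : 0 < sharpConst γ :=
  div_pos (peak_pos hγ) (Real.rpow_pos_of_pos (normTwo_explicitOptimizer_pos hγ) _)

lemma denominator_eq {γ : ℝ} (hγ : 2 < γ) {u₀ u₁ : ℝ → ℂ} (h₀ : MemLp u₀ ∞ volume)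
    (h₁ : MemLp u₁ 2 volume) :
    eLpNorm u₀ ∞ volume ^ (1 - 2 / γ) * eLpNorm u₁ 2 volume ^ (2 / γ)
      = ENNReal.ofReal ((eLpNorm u₀ ∞ volume).toReal ^ (1 - 2 / γ) * normTwo u₁ ^ (2 / γ)) := by
  obtain ⟨ht0, ht1⟩ := two_div_mem hγ
  have h0 : 0 ≤ (eLpNorm u₀ ∞ volume).toReal := ENNReal.toReal_nonneg
  have h1 : 0 ≤ normTwo u₁ := ENNReal.toReal_nonneg
  rw [ENNReal.ofReal_mul (by positivity), ← ENNReal.ofReal_rpow_of_nonneg h0 (by linarith),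
    ← ENNReal.ofReal_rpow_of_nonneg h1 ht0.le, ENNReal.ofReal_toReal h₀.2.ne, normTwo,
    ENNReal.ofReal_toReal h₁.2.ne]

lemma continuous_line_of_memHardyLower {f : ℂ → ℂ} (hf : MemHardyLower ∞ 2 f) {γ : ℝ}
    (hγ : 2 < γ) : Continuous (lineAt f (-(2 / γ))) :=
  continuous_lineAt hf.1.continuousOn (mem_lowerStrip_line (by linarith [(two_div_mem hγ).2])
    (by linarith [(two_div_mem hγ).1]))

lemma eLpNorm_line_le {f : ℂ → ℂ} {y m : ℝ} (h : ∀ x, ‖lineAt f y x‖ ≤ m) :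
    eLpNorm (lineAt f y) ∞ volume ≤ ENNReal.ofReal m := by
  rw [eLpNorm_exponent_top]
  exact eLpNormEssSup_le_of_ae_bound (Eventually.of_forall h)

lemma quotient_le {γ : ℝ} (hγ : 2 < γ) {f : ℂ → ℂ} (hf : MemHardyLower ∞ 2 f)
    {u₀ u₁ : ℝ → ℂ} (hbv : HasBoundaryValues f u₀ u₁) :
    quotient γ f u₀ u₁ ≤ ENNReal.ofReal (sharpConst γ) := by
  unfold quotient
  rw [denominator_eq hγ hbv.memLp_zero hbv.memLp_one]
  refine ENNReal.div_le_of_le_mul ?_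
  rw [← ENNReal.ofReal_mul (sharpConst_pos hγ).le]
  exact eLpNorm_line_le (norm_line_le hγ hf hbv)

/-- If either norm vanished, the sharp inequality would force `f` to vanish on `Im z = -2/γ`, hence
on the strip. So the quotient of an admissible function never has a zero denominator. -/
lemma boundary_norms_pos {γ : ℝ} (hγ : 2 < γ) {f : ℂ → ℂ} (hf : Admissible f)
    {u₀ u₁ : ℝ → ℂ} (hbv : HasBoundaryValues f u₀ u₁) :
    0 < (eLpNorm u₀ ∞ volume).toReal ∧ 0 < normTwo u₁ := by
  obtain ⟨ht0, ht1⟩ := two_div_mem hγ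
  obtain ⟨hf, z, hz, hne⟩ := hf
  have h0 : 0 ≤ (eLpNorm u₀ ∞ volume).toReal := ENNReal.toReal_nonneg
  have h1 : 0 ≤ normTwo u₁ := ENNReal.toReal_nonneg
  by_contra hcon
  have hzero : (eLpNorm u₀ ∞ volume).toReal ^ (1 - 2 / γ) * normTwo u₁ ^ (2 / γ) = 0 := by
    rw [not_and_or, not_lt, not_lt] at hcon
    rcases hcon with h | h
    · rw [le_antisymm h h0, Real.zero_rpow (by linarith), zero_mul]
    · rw [le_antisymm h h1, Real.zero_rpow ht0.ne', mul_zero]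
  refine hne (eqOn_lowerStrip_of_line (g := fun _ => 0) hf.1 (differentiableOn_const 0)
    (y := -(2 / γ)) (by linarith) (by linarith) (fun x => ?_) hz)
  have := norm_line_le hγ hf hbv x
  rw [hzero, mul_zero] at this
  exact norm_le_zero_iff.mp this

lemma norm_le_of_eLpNorm_top_of_continuous {g : ℝ → ℂ} (hg : Continuous g) (x : ℝ) :
    ENNReal.ofReal ‖g x‖ ≤ eLpNorm g ∞ volume := by
  by_contra! hlt
  set a := (eLpNorm g ∞ volume).toReal
  have hfin : eLpNorm g ∞ volume ≠ ∞ := (hlt.trans ENNReal.ofReal_lt_top).ne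
  have hae := ae_norm_le_of_eLpNorm_top (f := g) ENNReal.toReal_nonneg
    (ENNReal.ofReal_toReal hfin).ge
  have hopen : IsOpen {s | ¬ ‖g s‖ ≤ a} := by
    simp only [not_le]
    exact isOpen_lt continuous_const hg.norm
  have hempty := (hopen.measure_eq_zero_iff volume).mp (ae_iff.mp hae)
  have hx : x ∉ {s | ¬ ‖g s‖ ≤ a} := by rw [hempty]; exact Set.notMem_empty x
  have hx' : ‖g x‖ ≤ a := not_not.mp hx
  have := ENNReal.ofReal_le_ofReal hx'
  rw [ENNReal.ofReal_toReal hfin] at this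
  exact absurd hlt (not_lt.mpr this)

lemma norm_lineAt_transform (α κ : ℝ) (β : ℂ) (h : ℂ → ℂ) (y x : ℝ) :
    ‖lineAt (transform α κ β h) y x‖ = ‖β‖ * Real.exp (-(α * y)) * ‖lineAt h y (x - κ)‖ := by
  rw [lineAt_transform, norm_mul, norm_mul, norm_exp_I_mul]
  ring

lemma eLpNorm_transform_zero {γ : ℝ} (hγ : 2 < γ) (α κ : ℝ) (β : ℂ) :
    (eLpNorm (lineAt (transform α κ β (explicitOptimizer γ)) 0) ∞ volume).toReal = ‖β‖ := by
  have : eLpNorm (lineAt (transform α κ β (explicitOptimizer γ)) 0) ∞ volume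
      = eLpNorm (fun _ : ℝ => β) ∞ volume := eLpNorm_congr_norm_ae (Eventually.of_forall fun x => by
    simp [norm_lineAt_transform, norm_explicitOptimizer_zero hγ])
  rw [this, eLpNorm_exponent_top, eLpNormEssSup_const β (NeZero.ne volume)]
  simp

lemma normTwo_transform_neg_one {γ : ℝ} (hγ : 2 < γ) (α κ : ℝ) (β : ℂ) :
    normTwo (lineAt (transform α κ β (explicitOptimizer γ)) (-1))
      = ‖β‖ * Real.exp α * normTwo (lineAt (explicitOptimizer γ) (-1)) := by
  rw [normTwo_eq_sqrt (transform_hasBoundaryValues hγ α κ β).memLp_one.1,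
    normTwo_eq_sqrt (continuous_explicitOptimizer_line hγ le_rfl
      (by norm_num)).aestronglyMeasurable]
  simp only [norm_lineAt_transform, mul_pow _ ‖lineAt (explicitOptimizer γ) (-1) _‖]
  rw [integral_const_mul,
    integral_sub_right_eq_self (fun x => ‖lineAt (explicitOptimizer γ) (-1) x‖ ^ 2) κ,
    Real.sqrt_mul (by positivity), Real.sqrt_sq (by positivity)]
  simp

/-- The numerator is bounded below by the value at `κ - 2i/γ`, where the transform has modulus `|β|
e^{2α/γ}` times the peak; the powers of `|β|` and `e^α` cancel against the denominator. -/
lemma le_quotient_transform {γ : ℝ} (hγ : 2 < γ) (α κ : ℝ) {β : ℂ} (hβ : β ≠ 0) :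
    ENNReal.ofReal (sharpConst γ) ≤ quotient γ (transform α κ β (explicitOptimizer γ))
      (lineAt (transform α κ β (explicitOptimizer γ)) 0)
      (lineAt (transform α κ β (explicitOptimizer γ)) (-1)) := by
  obtain ⟨ht0, ht1⟩ := two_div_mem hγ
  have hbv := transform_hasBoundaryValues hγ α κ β
  have hn := normTwo_explicitOptimizer_pos hγ
  have hβ' : 0 < ‖β‖ := norm_pos_iff.mpr hβ
  unfold quotient
  rw [denominator_eq hγ hbv.memLp_zero hbv.memLp_one, eLpNorm_transform_zero hγ,
    normTwo_transform_neg_one hγ]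
  have hpos : 0 < ‖β‖ ^ (1 - 2 / γ)
      * (‖β‖ * Real.exp α * normTwo (lineAt (explicitOptimizer γ) (-1))) ^ (2 / γ) := by positivity
  rw [ENNReal.le_div_iff_mul_le (Or.inl (ENNReal.ofReal_pos.mpr hpos).ne')
    (Or.inl ENNReal.ofReal_ne_top), ← ENNReal.ofReal_mul (sharpConst_pos hγ).le]
  refine le_trans (le_of_eq ?_) (norm_le_of_eLpNorm_top_of_continuous
    (continuous_line_of_memHardyLower (transform_memHardyLower hγ α κ β) hγ) κ)
  congr 1
  have hpk : ‖lineAt (explicitOptimizer γ) (-(2 / γ)) (κ - κ)‖ = peak γ := by simp [lineAt, peak]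
  rw [norm_lineAt_transform, hpk, sharpConst, Real.mul_rpow (by positivity) hn.le,
    Real.mul_rpow hβ'.le (Real.exp_pos _).le, ← Real.exp_mul, Real.rpow_sub hβ', Real.rpow_one,
    mul_neg, neg_neg]
  have := Real.rpow_pos_of_pos hn (2 / γ)
  have := Real.rpow_pos_of_pos hβ' (2 / γ)
  field_simp

lemma admissible_transform {γ : ℝ} (hγ : 2 < γ) (α κ : ℝ) {β : ℂ} (hβ : β ≠ 0) :
    Admissible (transform α κ β (explicitOptimizer γ)) := by
  refine ⟨transform_memHardyLower hγ α κ β, ((0 : ℝ) : ℂ) + ((-(1 / 2) : ℝ) : ℂ) * Complex.I,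
    mem_lowerStrip_line (by norm_num) (by norm_num) 0, ?_⟩
  change lineAt (transform α κ β (explicitOptimizer γ)) (-(1 / 2)) 0 ≠ 0
  rw [lineAt_transform]
  exact mul_ne_zero (mul_ne_zero hβ (explicitOptimizer_ne_zero
    (line_mem_bigStrip hγ (by norm_num) (by norm_num) _))) (Complex.exp_ne_zero _)

lemma isOptimizer_of_eqOn {γ : ℝ} (hγ : 2 < γ) {f : ℂ → ℂ} {α κ : ℝ} {β : ℂ} (hβ : β ≠ 0)
    (h : Set.EqOn f (transform α κ β (explicitOptimizer γ)) lowerStrip) : IsOptimizer γ f := by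
  obtain ⟨hm, z, hz, hne⟩ := admissible_transform hγ α κ hβ
  refine ⟨⟨hm.congr h, z, hz, by rwa [h hz]⟩, _, _,
    (transform_hasBoundaryValues hγ α κ β).congr h, fun g hg g₀ g₁ hgb => ?_⟩
  refine (quotient_le hγ hg.1 hgb).trans ((le_quotient_transform hγ α κ hβ).trans (le_of_eq ?_))
  obtain ⟨ht0, ht1⟩ := two_div_mem hγ
  unfold quotient
  rw [lineAt_congr h (y := -(2 / γ)) ⟨by linarith, by linarith⟩]

/-! ### Uniqueness of the optimizer -/

/-- The pairing of an `L²` function with translates of an exponentially decaying `L²` function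
vanishes at infinity. -/
lemma tendsto_integral_mul_translate {u K : ℝ → ℂ} (hu : MemLp u 2 volume) (hK : Continuous K)
    {M c : ℝ} (hc : 0 < c) (hb : ∀ s, ‖K s‖ ≤ M * Real.exp (-c * |s|)) :
    Tendsto (fun κ : ℝ => ∫ s, u s * K (s - κ)) (cocompact ℝ) (𝓝 0) := by
  have hM : 0 ≤ M := by
    have := (norm_nonneg _).trans (hb 0)
    simpa using this
  have hK2 : MemLp K 2 volume := memLp_two_of_exp_bound hK.aestronglyMeasurable hc hb
  have hmp : ∀ κ : ℝ, MeasurePreserving (fun s : ℝ => s - κ) volume volume :=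
    fun κ => measurePreserving_sub_right volume κ
  have hKt : ∀ κ : ℝ, MemLp (fun s => K (s - κ)) 2 volume := fun κ =>
    hK2.comp_measurePreserving (hmp κ)
  have hKn : ∀ κ : ℝ, (eLpNorm (fun s => K (s - κ)) 2 volume).toReal = normTwo K := fun κ => by
    have := eLpNorm_comp_measurePreserving (p := 2) hK2.1 (hmp κ)
    rw [normTwo, ← this]
    rfl
  have hcg : (cocompact ℝ).IsCountablyGenerated := by
    rw [cocompact_eq_atBot_atTop]; infer_instance
  rw [Metric.tendsto_nhds]
  intro ε hε
  have hn : 0 ≤ normTwo K := ENNReal.toReal_nonneg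
  set η := ε / (2 * (normTwo K + 1))
  have hη : 0 < η := by positivity
  -- Translation preserves the `L²` norm of `K`, so replacing `u` by a compactly supported `g` costs
  -- less than `ε/2` for all `κ`. For fixed `g` the pairing vanishes at infinity by dominated
  -- convergence.
  obtain ⟨g, hgc, hgε, hgcont, hg2⟩ := hu.exists_hasCompactSupport_eLpNorm_sub_le (by simp)
    (ENNReal.ofReal_pos.mpr hη).ne'
  have hgt : Tendsto (fun κ : ℝ => ∫ s, g s * K (s - κ)) (cocompact ℝ) (𝓝 (∫ _ : ℝ, (0 : ℂ))) := by
    refine tendsto_integral_filter_of_dominated_convergence (fun s => ‖g s‖ * M) ?_ ?_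
      ((hgcont.integrable_of_hasCompactSupport hgc).norm.mul_const M) ?_
    · exact Eventually.of_forall fun κ => (hgcont.mul (hK.comp (by fun_prop))).aestronglyMeasurable
    · refine Eventually.of_forall fun κ => Eventually.of_forall fun s => ?_
      rw [norm_mul]
      refine mul_le_mul_of_nonneg_left ((hb _).trans (mul_le_of_le_one_right hM ?_)) (norm_nonneg _)
      exact Real.exp_le_one_iff.mpr (by nlinarith [abs_nonneg (s - κ)])
    · refine Eventually.of_forall fun s => ?_
      have h1 : Tendsto (fun κ : ℝ => ‖g s‖ * (M * (Real.exp (c * |s|) * Real.exp (-c * |κ|))))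
          (cocompact ℝ) (𝓝 0) := by
        have : Tendsto (fun κ : ℝ => Real.exp (-c * |κ|)) (cocompact ℝ) (𝓝 0) :=
          Real.tendsto_exp_atBot.comp
            ((tendsto_norm_cocompact_atTop (E := ℝ)).const_mul_atTop_of_neg (by linarith))
        simpa using ((this.const_mul (Real.exp (c * |s|))).const_mul M).const_mul ‖g s‖
      refine squeeze_zero_norm (fun κ => ?_) h1
      rw [norm_mul]
      refine mul_le_mul_of_nonneg_left ((hb _).trans (mul_le_mul_of_nonneg_left ?_ hM))
        (norm_nonneg _)
      rw [abs_sub_comm]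
      exact exp_neg_mul_abs_sub_le hc.le κ s
  rw [integral_zero, Metric.tendsto_nhds] at hgt
  filter_upwards [hgt (ε / 2) (by positivity)] with κ hκ
  rw [dist_zero_right] at hκ ⊢
  have hsplit : ∫ s, u s * K (s - κ) = (∫ s, (u - g) s * K (s - κ)) + ∫ s, g s * K (s - κ) := by
    rw [← integral_add (integrable_mul_of_memLp_two (hu.sub hg2) (hKt κ))
      (integrable_mul_of_memLp_two hg2 (hKt κ))]
    refine integral_congr_ae (Eventually.of_forall fun s => ?_)
    simp only [Pi.sub_apply]
    ring
  have h1 := norm_integral_mul_le_of_memLp_two (hu.sub hg2) (hKt κ)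
  rw [hKn] at h1
  have h2 : (eLpNorm (u - g) 2 volume).toReal ≤ η := ENNReal.toReal_le_of_le_ofReal hη.le hgε
  have h3 : η * normTwo K < ε / 2 := by
    have : η * (normTwo K + 1) = ε / 2 := by simp only [η]; field_simp
    nlinarith
  rw [hsplit]
  calc _ ≤ _ := norm_add_le _ _
    _ < ε := by nlinarith [mul_le_mul_of_nonneg_right h2 hn]

lemma exists_kern_neg_one_bound {γ : ℝ} (hγ : 2 < γ) (α : ℝ) :
    ∃ M, ∀ s, ‖lineAt (kern γ α) (-1) s‖ ≤ M * Real.exp (-(Real.pi / 2) * |s|) := by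
  obtain ⟨M, -, h⟩ := exists_kern_bound hγ α (a := -1) (b := -1) le_rfl (by norm_num)
    (by simp; intro h; linarith [(two_div_mem hγ).2])
  exact ⟨M, fun s => h s (-1) (by simp)⟩

/-- In the representation the real-line term contributes `O(e^{-2α/γ})` uniformly in `κ`, and for
fixed `α` the `L²` term tends to zero as `|κ| → ∞`. Hence `α` is chosen large first, and then `κ`.
-/
lemma tendsto_line_cocompact {γ : ℝ} (hγ : 2 < γ) {f : ℂ → ℂ} (hf : MemHardyLower ∞ 2 f)
    {u₀ u₁ : ℝ → ℂ} (hbv : HasBoundaryValues f u₀ u₁) :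
    Tendsto (lineAt f (-(2 / γ))) (cocompact ℝ) (𝓝 0) := by
  obtain ⟨ht0, ht1⟩ := two_div_mem hγ
  have hp := peak_pos hγ
  have hp0 := integral_densityZero_pos hγ
  have hp1 := integral_densityOne_pos hγ
  set p₀ := ∫ s, densityZero γ s
  set q := p₀ + ∫ s, densityOne γ s
  have hq : 0 < q := by positivity
  set a₀ := (eLpNorm u₀ ∞ volume).toReal
  have ha₀ : 0 ≤ a₀ := ENNReal.toReal_nonneg
  have hle : ∀ α κ : ℝ, ‖lineAt f (-(2 / γ)) κ‖ ≤ peak γ / q * Real.exp (-(α * (2 / γ))) *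
      (a₀ * p₀ + ‖∫ s, u₁ s * lineAt (kern γ α) (-1) (s - κ)‖) := fun α κ => by
    have h := congrArg norm (representation hγ hf hbv α κ)
    rw [norm_mul, norm_div, norm_mul, Complex.norm_real, Complex.norm_real,
      Real.norm_of_nonneg (Real.exp_pos _).le, Real.norm_of_nonneg hq.le] at h
    have h2 := h.le.trans ((norm_sub_le _ _).trans (add_le_add
      (norm_integral_kern_zero_le hγ α κ hbv.memLp_zero) le_rfl))
    change _ / peak γ * q ≤ a₀ * p₀ + _ at h2
    rw [div_mul_eq_mul_div, div_le_iff₀' hp, mul_assoc, mul_comm (Real.exp _), ← mul_assoc,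
      ← le_div_iff₀ (Real.exp_pos _), ← le_div_iff₀ hq] at h2
    refine h2.trans (le_of_eq ?_)
    rw [Real.exp_neg]
    field_simp
  rw [Metric.tendsto_nhds]
  intro ε hε
  have hα : Tendsto (fun α : ℝ => peak γ / q * Real.exp (-(α * (2 / γ))) * (a₀ * p₀)) atTop (𝓝 0) := by
    have : Tendsto (fun α : ℝ => Real.exp (-(α * (2 / γ)))) atTop (𝓝 0) :=
      Real.tendsto_exp_neg_atTop_nhds_zero.comp (tendsto_id.atTop_mul_const ht0)
    simpa using (this.const_mul (peak γ / q)).mul_const (a₀ * p₀)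
  obtain ⟨α, hα⟩ := (hα.eventually_lt_const hε).exists
  obtain ⟨M, hM⟩ := exists_kern_neg_one_bound hγ α
  have hlim := tendsto_integral_mul_translate hbv.memLp_one (continuous_kern_neg_one hγ α)
    (by positivity) hM
  have hlim2 := (hlim.norm.const_add (a₀ * p₀)).const_mul (peak γ / q * Real.exp (-(α * (2 / γ))))
  rw [norm_zero, add_zero] at hlim2
  filter_upwards [hlim2.eventually_lt_const hα] with κ hκ
  rw [dist_zero_right]
  exact (hle α κ).trans_lt hκ

/-- If the boundary values on `Im z = -1` agree, the functions agree. -/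
lemma eqOn_of_boundary_ae_eq {γ : ℝ} (hγ : 2 < γ) {f g : ℂ → ℂ} (hf : MemHardyLower ∞ 2 f)
    (hg : MemHardyLower ∞ 2 g) {u₀ u₁ v₀ v₁ : ℝ → ℂ} (hfb : HasBoundaryValues f u₀ u₁)
    (hgb : HasBoundaryValues g v₀ v₁) (h : u₁ =ᵐ[volume] v₁) : Set.EqOn f g lowerStrip := by
  obtain ⟨ht0, ht1⟩ := two_div_mem hγ
  have hp := peak_pos hγ
  have hp0 := integral_densityZero_pos hγ
  have hp1 := integral_densityOne_pos hγ
  refine eqOn_lowerStrip_of_line hf.1 hg.1 (y := -(2 / γ)) (by linarith) (by linarith) fun κ => ?_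
  set q := (∫ s, densityZero γ s) + ∫ s, densityOne γ s
  have hq : 0 < q := by positivity
  set A := (eLpNorm u₀ ∞ volume).toReal * (∫ s, densityZero γ s)
    + (eLpNorm v₀ ∞ volume).toReal * ∫ s, densityZero γ s
  have hle : ∀ α : ℝ, ‖lineAt f (-(2 / γ)) κ - lineAt g (-(2 / γ)) κ‖
      ≤ peak γ * A / q * Real.exp (-(α * (2 / γ))) := fun α => by
    have e : ∫ s, u₁ s * lineAt (kern γ α) (-1) (s - κ)
        = ∫ s, v₁ s * lineAt (kern γ α) (-1) (s - κ) :=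
      integral_congr_ae (h.mono fun s hs => by simp only [hs])
    have h1 := representation hγ hf hfb α κ
    have h2 := representation hγ hg hgb α κ
    rw [e] at h1
    have h3 : (lineAt f (-(2 / γ)) κ - lineAt g (-(2 / γ)) κ) * (Real.exp (α * (2 / γ)) : ℝ)
        / explicitOptimizer γ (((-(2 / γ) : ℝ) : ℂ) * Complex.I) * (q : ℝ)
        = (∫ s, u₀ s * lineAt (kern γ α) 0 (s - κ)) - ∫ s, v₀ s * lineAt (kern γ α) 0 (s - κ) := by
      linear_combination h1 - h2
    have h4 := congrArg norm h3
    rw [norm_mul, norm_div, norm_mul, Complex.norm_real, Complex.norm_real,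
      Real.norm_of_nonneg (Real.exp_pos _).le, Real.norm_of_nonneg hq.le] at h4
    have h5 : _ ≤ A := h4.le.trans ((norm_sub_le _ _).trans (add_le_add
      (norm_integral_kern_zero_le hγ α κ hfb.memLp_zero)
      (norm_integral_kern_zero_le hγ α κ hgb.memLp_zero)))
    change _ / peak γ * q ≤ _ at h5
    rw [div_mul_eq_mul_div, div_le_iff₀' hp, mul_assoc, mul_comm (Real.exp _), ← mul_assoc,
      ← le_div_iff₀ (Real.exp_pos _), ← le_div_iff₀ hq] at h5
    refine h5.trans (le_of_eq ?_)
    rw [Real.exp_neg]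
    field_simp
  -- The lower integrals cancelled, and the bound `A` for the upper ones is independent of `α`, so
  -- `α → ∞` leaves zero.
  have hlim : Tendsto (fun α : ℝ => peak γ * A / q * Real.exp (-(α * (2 / γ)))) atTop (𝓝 0) := by
    have : Tendsto (fun α : ℝ => Real.exp (-(α * (2 / γ)))) atTop (𝓝 0) :=
      Real.tendsto_exp_neg_atTop_nhds_zero.comp (tendsto_id.atTop_mul_const ht0)
    simpa using this.const_mul (peak γ * A / q)
  have := ge_of_tendsto' hlim hle
  exact sub_eq_zero.mp (norm_le_zero_iff.mp this)

/-- An optimizer attains its supremum on the line `Im z = -2/γ`. -/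
lemma exists_norm_line_eq {γ : ℝ} (hγ : 2 < γ) {f : ℂ → ℂ} (hf : Admissible f)
    {u₀ u₁ : ℝ → ℂ} (hbv : HasBoundaryValues f u₀ u₁)
    (hq : ENNReal.ofReal (sharpConst γ) ≤ quotient γ f u₀ u₁) :
    ∃ κ : ℝ, ‖lineAt f (-(2 / γ)) κ‖ = sharpConst γ
      * ((eLpNorm u₀ ∞ volume).toReal ^ (1 - 2 / γ) * normTwo u₁ ^ (2 / γ)) := by
  obtain ⟨ht0, ht1⟩ := two_div_mem hγ
  obtain ⟨ha₀, ha₁⟩ := boundary_norms_pos hγ hf hbv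
  have hcont := continuous_line_of_memHardyLower hf.1 hγ
  have hden : 0 < (eLpNorm u₀ ∞ volume).toReal ^ (1 - 2 / γ) * normTwo u₁ ^ (2 / γ) := by positivity
  obtain ⟨x₀, hx₀⟩ : ∃ x₀, lineAt f (-(2 / γ)) x₀ ≠ 0 := by
    by_contra! hz
    obtain ⟨z, hz', hne⟩ := hf.2
    exact hne (eqOn_lowerStrip_of_line (g := fun _ => 0) hf.1.1 (differentiableOn_const 0)
      (y := -(2 / γ)) (by linarith) (by linarith) hz hz')
  have hlim := (tendsto_line_cocompact hγ hf.1 hbv).norm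
  rw [norm_zero] at hlim
  -- A continuous function that vanishes at infinity and is nonzero somewhere attains its maximal
  -- modulus.
  obtain ⟨κ, hκ⟩ := hcont.norm.exists_forall_ge' x₀
    ((hlim.eventually_lt_const (norm_pos_iff.mpr hx₀)).mono fun _ h => h.le)
  refine ⟨κ, le_antisymm (norm_line_le hγ hf.1 hbv κ) ?_⟩
  unfold quotient at hq
  rw [denominator_eq hγ hbv.memLp_zero hbv.memLp_one,
    ENNReal.le_div_iff_mul_le (Or.inl (ENNReal.ofReal_pos.mpr hden).ne')
    (Or.inl ENNReal.ofReal_ne_top), ← ENNReal.ofReal_mul (sharpConst_pos hγ).le] at hq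
  exact (ENNReal.ofReal_le_ofReal_iff (norm_nonneg _)).mp (hq.trans (eLpNorm_line_le hκ))

lemma lineAt_transform_neg_one_eq {γ : ℝ} (hγ : 2 < γ) {α κ s : ℝ} {L v : ℂ}
    (h : v * (Complex.exp (Complex.I * α * (((s - κ : ℝ) : ℂ) + ((-1 : ℝ) : ℂ) * Complex.I))
      / lineAt (explicitOptimizer γ) (-1) (s - κ)) = L) :
    v = lineAt (transform (-α) κ (L * Complex.exp (Complex.I * α * κ)) (explicitOptimizer γ))
      (-1) s := by
  have hH := norm_pos_iff.mp (norm_explicitOptimizer_neg_one_pos hγ (s - κ))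
  rw [lineAt_transform, ← h]
  have e : Complex.exp (Complex.I * α * (((s - κ : ℝ) : ℂ) + ((-1 : ℝ) : ℂ) * Complex.I))
      * Complex.exp (Complex.I * α * κ) * Complex.exp (Complex.I * ((-α : ℝ) : ℂ)
        * ((s : ℂ) + ((-1 : ℝ) : ℂ) * Complex.I)) = 1 := by
    rw [← Complex.exp_add, ← Complex.exp_add, ← Complex.exp_zero]
    congr 1
    push_cast
    ring
  generalize Complex.exp (Complex.I * α * (((s - κ : ℝ) : ℂ) + ((-1 : ℝ) : ℂ) * Complex.I)) = E₁ at *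
  generalize Complex.exp (Complex.I * α * κ) = E₂ at *
  generalize Complex.exp (Complex.I * ((-α : ℝ) : ℂ) * ((s : ℂ) + ((-1 : ℝ) : ℂ) * Complex.I)) = E₃
    at *
  field_simp
  linear_combination (-v) * e

/-- The equality case of the three lines inequality. -/
lemma boundary_ae_eq {γ : ℝ} (hγ : 2 < γ) {f : ℂ → ℂ} (hf : Admissible f)
    {u₀ u₁ : ℝ → ℂ} (hbv : HasBoundaryValues f u₀ u₁) {κ : ℝ}
    (hκ : ‖lineAt f (-(2 / γ)) κ‖ = sharpConst γ
      * ((eLpNorm u₀ ∞ volume).toReal ^ (1 - 2 / γ) * normTwo u₁ ^ (2 / γ))) :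
    ∃ (α : ℝ) (β : ℂ), β ≠ 0 ∧
      u₁ =ᵐ[volume] lineAt (transform α κ β (explicitOptimizer γ)) (-1) := by
  obtain ⟨ht0, ht1⟩ := two_div_mem hγ
  obtain ⟨ha₀, ha₁⟩ := boundary_norms_pos hγ hf hbv
  obtain ⟨c, hc, hHsq, hnsq⟩ := exists_norm_sq_eq_mul_densityOne hγ
  have hn := normTwo_explicitOptimizer_pos hγ
  have hp := peak_pos hγ
  have hp0 := integral_densityZero_pos hγ
  have hp1 := integral_densityOne_pos hγ
  set a₀ := (eLpNorm u₀ ∞ volume).toReal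
  set a₁ := normTwo u₁ with ha₁def
  set n := normTwo (lineAt (explicitOptimizer γ) (-1))
  set p₀ := ∫ s, densityZero γ s
  set p₁ := ∫ s, densityOne γ s
  have hr : 0 < a₀ * n / a₁ := by positivity
  -- This is the value of `α` that balances the two terms of the inequality; it makes `|L| = a₀`, so
  -- the left side of the representation has modulus `a₀(p₀ + p₁)`.
  set α := Real.log (a₀ * n / a₁)
  have hexp : Real.exp α = a₀ * n / a₁ := Real.exp_log hr
  have hexpt : Real.exp (α * (2 / γ)) = (a₀ * n / a₁) ^ (2 / γ) := by
    rw [Real.rpow_def_of_pos hr]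
  set L : ℂ := lineAt f (-(2 / γ)) κ * (Real.exp (α * (2 / γ)) : ℝ)
    / explicitOptimizer γ (((-(2 / γ) : ℝ) : ℂ) * Complex.I) with hL
  have hLn : ‖L‖ = a₀ := by
    rw [hL, norm_div, norm_mul, Complex.norm_real, Real.norm_of_nonneg (Real.exp_pos _).le, hκ,
      hexpt]
    change _ / peak γ = _
    change peak γ / n ^ (2 / γ) * _ * _ / _ = _
    rw [Real.div_rpow (by positivity) ha₁.le, Real.mul_rpow ha₀.le hn.le,
      Real.rpow_sub ha₀, Real.rpow_one]
    field_simp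
  have hrep := representation hγ hf.1 hbv α κ
  rw [← hL] at hrep
  set A := ∫ s, u₀ s * lineAt (kern γ α) 0 (s - κ)
  have hA : ‖A‖ ≤ a₀ * p₀ := norm_integral_kern_zero_le hγ α κ hbv.memLp_zero
  -- `w` is the normalized boundary value, to be compared with the constant `L`
  set w : ℝ → ℂ := fun s => u₁ s * (Complex.exp (Complex.I * α *
    (((s - κ : ℝ) : ℂ) + ((-1 : ℝ) : ℂ) * Complex.I))
      / lineAt (explicitOptimizer γ) (-1) (s - κ)) with hw
  have hkern : ∀ s, u₁ s * lineAt (kern γ α) (-1) (s - κ)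
      = -((densityOne γ (s - κ) : ℂ) * w s) := fun s => by
    rw [lineAt_kern_neg_one, hw]
    ring
  have hInt : Integrable fun s => (densityOne γ (s - κ) : ℂ) * w s := by
    have := (integrable_mul_of_memLp_two hbv.memLp_one (memLp_kern_neg_one hγ α κ)).neg
    refine this.congr (Eventually.of_forall fun s => ?_)
    simp only [Pi.neg_apply]
    rw [hkern, neg_neg]
  have hIw : ∫ s, (densityOne γ (s - κ) : ℂ) * w s = L * ((p₀ + p₁ : ℝ) : ℂ) - A := by
    simp only [hkern, integral_neg] at hrep
    rw [hrep]
    ring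
  have hwsq : ∀ s, densityOne γ (s - κ) * ‖w s‖ ^ 2 = Real.exp α ^ 2 / c * ‖u₁ s‖ ^ 2 := fun s => by
    have hd := densityOne_pos hγ (s - κ)
    rw [hw]
    simp only [norm_mul, norm_div]
    rw [norm_exp_I_mul, mul_pow, div_pow, hHsq, mul_neg_one, neg_neg]
    field_simp
  have hu1i : Integrable fun s => ‖u₁ s‖ ^ 2 :=
    (memLp_two_iff_integrable_sq_norm hbv.memLp_one.1).mp hbv.memLp_one
  have hu1n : ∫ s, ‖u₁ s‖ ^ 2 = a₁ ^ 2 := by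
    rw [ha₁def, normTwo_eq_sqrt hbv.memLp_one.1, Real.sq_sqrt (by positivity)]
  have i1 : Integrable fun s => Real.exp α ^ 2 / c * ‖u₁ s‖ ^ 2 := hu1i.const_mul _
  have i2 : Integrable fun s => ‖L‖ ^ 2 * densityOne γ (s - κ) :=
    ((integrable_densityOne hγ).comp_sub_right κ).const_mul _
  have i3 : Integrable fun s => conj L * ((densityOne γ (s - κ) : ℂ) * w s) := hInt.const_mul _
  have hpt : ∀ s, densityOne γ (s - κ) * ‖w s - L‖ ^ 2 = Real.exp α ^ 2 / c * ‖u₁ s‖ ^ 2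
      + ‖L‖ ^ 2 * densityOne γ (s - κ)
      - 2 * (conj L * ((densityOne γ (s - κ) : ℂ) * w s)).re := fun s => by
    rw [← hwsq, ← Complex.normSq_eq_norm_sq, ← Complex.normSq_eq_norm_sq,
      ← Complex.normSq_eq_norm_sq, Complex.normSq_sub]
    have : (conj L * ((densityOne γ (s - κ) : ℂ) * w s)).re
        = densityOne γ (s - κ) * (w s * conj L).re := by
      rw [show conj L * ((densityOne γ (s - κ) : ℂ) * w s)
        = (densityOne γ (s - κ) : ℂ) * (w s * conj L) by ring, Complex.re_ofReal_mul]
    rw [this]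
    ring
  have i4 : Integrable fun s => 2 * (conj L * ((densityOne γ (s - κ) : ℂ) * w s)).re :=
    i3.re.const_mul 2
  have iall : Integrable fun s => densityOne γ (s - κ) * ‖w s - L‖ ^ 2 := by
    simp only [hpt]
    exact (i1.add i2).sub i4
  -- Equality in Cauchy-Schwarz, by expanding the square. The two quadratic terms give `2a₀²p₁`,
  -- while the cross term removes `2a₀²(p₀ + p₁) - 2 Re(L̄A)`, which is at least `2a₀²p₁` because
  -- `|A| ≤ a₀p₀`. Hence `w = L` almost everywhere.
  have hval : ∫ s, densityOne γ (s - κ) * ‖w s - L‖ ^ 2 ≤ 0 := by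
    simp only [hpt]
    have e4 : ∫ s, 2 * (conj L * ((densityOne γ (s - κ) : ℂ) * w s)).re
        = 2 * (conj L * (L * ((p₀ + p₁ : ℝ) : ℂ) - A)).re := by
      rw [integral_const_mul]
      have := integral_re i3
      simp only [RCLike.re_to_complex] at this
      rw [this, integral_const_mul, hIw]
    have e1 : ∫ s, Real.exp α ^ 2 / c * ‖u₁ s‖ ^ 2 = a₀ ^ 2 * p₁ := by
      rw [integral_const_mul, hu1n, hexp, div_pow, mul_pow, hnsq]
      field_simp
    have e2 : ∫ s, ‖L‖ ^ 2 * densityOne γ (s - κ) = a₀ ^ 2 * p₁ := by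
      rw [integral_const_mul, integral_sub_right_eq_self (densityOne γ) κ, hLn]
    have e12 : ∫ s, (Real.exp α ^ 2 / c * ‖u₁ s‖ ^ 2 + ‖L‖ ^ 2 * densityOne γ (s - κ))
        = a₀ ^ 2 * p₁ + a₀ ^ 2 * p₁ := by rw [integral_add i1 i2, e1, e2]
    refine ((integral_sub (i1.add i2) i4).trans (congrArg₂ _ e12 e4)).trans_le ?_
    have hre : (conj L * (L * ((p₀ + p₁ : ℝ) : ℂ) - A)).re = a₀ ^ 2 * (p₀ + p₁) - (conj L * A).re := by
      rw [mul_sub, Complex.sub_re, ← mul_assoc, mul_comm (conj L) L, Complex.mul_conj,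
        Complex.normSq_eq_norm_sq, hLn, ← Complex.ofReal_mul, Complex.ofReal_re]
    have hreA : (conj L * A).re ≤ a₀ * (a₀ * p₀) := by
      refine (Complex.re_le_norm _).trans ?_
      rw [norm_mul, RCLike.norm_conj, hLn]
      exact mul_le_mul_of_nonneg_left hA ha₀.le
    rw [hre]
    nlinarith
  have hnonneg : ∀ s, 0 ≤ densityOne γ (s - κ) * ‖w s - L‖ ^ 2 := fun s =>
    mul_nonneg (densityOne_pos hγ _).le (by positivity)
  have hzero := (integral_eq_zero_iff_of_nonneg hnonneg iall).mp
    (le_antisymm hval (integral_nonneg hnonneg))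
  refine ⟨-α, L * Complex.exp (Complex.I * α * κ), mul_ne_zero ?_ (Complex.exp_ne_zero _), ?_⟩
  · rw [← norm_pos_iff, hLn]
    exact ha₀
  · filter_upwards [hzero] with s hs
    refine lineAt_transform_neg_one_eq hγ ?_
    have h1 : ‖w s - L‖ ^ 2 = 0 := (mul_eq_zero.mp hs).resolve_left (densityOne_pos hγ _).ne'
    exact sub_eq_zero.mp (norm_eq_zero.mp (pow_eq_zero_iff two_ne_zero |>.mp h1))

lemma IsOptimizer.exists_eqOn_transform {γ : ℝ} (hγ : 2 < γ) {f : ℂ → ℂ} (hf : IsOptimizer γ f) :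
    ∃ (α κ : ℝ) (β : ℂ), β ≠ 0 ∧
      Set.EqOn f (transform α κ β (explicitOptimizer γ)) lowerStrip := by
  obtain ⟨hadm, u₀, u₁, hbv, hmax⟩ := hf
  -- An optimizer does at least as well as the explicit function, so its quotient reaches the sharp
  -- constant.
  have hq := (le_quotient_transform hγ 0 0 one_ne_zero).trans
    (hmax _ (admissible_transform hγ 0 0 one_ne_zero) _ _ (transform_hasBoundaryValues hγ 0 0 1))
  obtain ⟨κ, hκ⟩ := exists_norm_line_eq hγ hadm hbv hq
  obtain ⟨α, β, hβ, h⟩ := boundary_ae_eq hγ hadm hbv hκ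
  exact ⟨α, κ, β, hβ, eqOn_of_boundary_ae_eq hγ hadm.1 (transform_memHardyLower hγ α κ β) hbv
    (transform_hasBoundaryValues hγ α κ β) h⟩

end ThreeLines

end

theorem theorem1p2 (γ : ℝ) (hγ : 2 < γ) :
    -- the principal value integral defining `θ_γ` converges on the strip `|Im z| < 2`
    (∀ z : ℂ, |z.im| < 2 →
      (∀ ε : ℝ, 0 < ε →
        IntegrableOn (ThreeLines.thetaIntegrand γ z) {k : ℝ | ε ≤ |k|} volume) ∧
      Tendsto (ThreeLines.thetaTrunc γ z) (𝓝[>] (0 : ℝ)) (𝓝 (ThreeLines.theta γ z))) ∧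
    -- the boundary values that enter the variational problem exist for every function in the space
    (∀ f : ℂ → ℂ, ThreeLines.MemHardyLower ∞ 2 f →
      ∃ f₀ f₁ : ℝ → ℂ, ThreeLines.HasBoundaryValues f f₀ f₁) ∧
    -- the explicit function is an optimizer
    ThreeLines.IsOptimizer γ (ThreeLines.explicitOptimizer γ) ∧
    -- the optimizers are exactly its images under the symmetries
    (∀ f : ℂ → ℂ, ThreeLines.IsOptimizer γ f ↔
      ∃ (α κ : ℝ) (β : ℂ), β ≠ 0 ∧
        Set.EqOn f (ThreeLines.transform α κ β (ThreeLines.explicitOptimizer γ))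
          ThreeLines.lowerStrip) := by
  refine ⟨fun z hz => ⟨fun ε hε => ThreeLines.integrableOn_thetaIntegrand hγ hz hε, ?_⟩,
    fun f hf => ThreeLines.exists_hasBoundaryValues hf, ?_, fun f => ⟨fun hf =>
      hf.exists_eqOn_transform hγ, fun ⟨α, κ, β, hβ, h⟩ => ThreeLines.isOptimizer_of_eqOn hγ hβ h⟩⟩
  · rw [ThreeLines.theta_eq hγ hz]
    exact ThreeLines.tendsto_thetaTrunc_thetaInt hγ hz
  · refine ThreeLines.isOptimizer_of_eqOn hγ (α := 0) (κ := 0) one_ne_zero ?_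
    rw [ThreeLines.transform_zero_zero_one]
    exact fun _ _ => rfl
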